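/- **Setting.** Let $\mathbb T^3=\mathbb R^3/(2\pi\mathbb Z)^3$, with Fourier coefficients $\hat f(\xi)$, $\xi\in\mathbb Z^3$, taken with respect to the normalised measure, and with $L^2$-norm $|\cdot|_2$. The operator $|\nabla|^s$ is the Fourier multiplier with symbol $|\xi|^s$, and $(-\Delta)^\alpha$ is the one with symbol $|\xi|^{2\alpha}$. Put $\lambda_q=2^q$. Fix a smooth $\chi:\mathbb R\to[0,1]$ with $\chi(r)=1$ for $r\le 1/2$ and $\chi(r)=0$ for $r\ge1$. Let $f_q$ be the Littlewood–Paley projection of $f$ with symbol $\chi(|\xi|/\lambda_{q+1})-\chi(|\xi|/\lambda_q)$ for $q\ge1$, and with symbol $\chi(|\xi|/2)$ for $q=0$. Put $$\|f\|_{B^s_{r,\infty}}=\sup_{q\ge0}\lambda_q^s\,\|f_q\|_{L^r}\in[0,\infty].$$ **Initial datum.** Let $\alpha\in[1,5/4)$ and let $(q_j)_{j\ge1}$ be a strictly increasing sequence of natural numbers with $\lambda_{q_j}^{2\alpha}\lambda_{q_{j+1}}^{4\alpha-5}<1$ for all $j$. Put $$A_j=\Big(\big[\tfrac9{10}\lambda_{q_j},\tfrac{11}{10}\lambda_{q_j}\big]\times\big[-\tfrac1{10}\lambda_{q_j},\tfrac1{10}\lambda_{q_j}\big]^2\Big)\cap\mathbb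 Z^3,$$ $$B_j=\Big(\big[-\tfrac1{10}\lambda_{q_j-1},\tfrac1{10}\lambda_{q_j-1}\big]^2\times\big[\tfrac9{10}\lambda_{q_j-1},\tfrac{11}{10}\lambda_{q_j-1}\big]\Big)\cap\mathbb Z^3,$$ $C_j=A_j+B_j$, and $S^*=-S$ for a set $S$ of frequencies. Put $\vec e_k(\xi)=p(\xi)\vec e_k$, where $p(\xi)=\mathrm{id}-|\xi|^{-2}\xi\otimes\xi$ for $\xi\ne0$ and $p(0)=\mathrm{id}$. Consider the field $U$ with Fourier coefficients $$\hat U=\sum_{j\ge1}\lambda_{q_j}^{2\alpha-4}\Big(\vec e_2(\xi)\chi_{A_j\cup A_j^*}+i(\vec e_2(\xi)-\vec e_1(\xi))\chi_{C_j}-i(\vec e_2(\xi)-\vec e_1(\xi))\chi_{C_j^*}+\vec e_1(\xi)\chi_{B_j\cup B_j^*}\Big).$$ **Solutions.** Let $\nu,T>0$ and let $V\in L^2$ be divergence free. A weak solution on $[0,T)$ with initial value $V$ is a divergence-free real field $u\in C_w([0,T);L^2)\cap L^2([0,T);H^1)$ with $u(0)=V$ such that, for every smooth divergence-free field $\varphi$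 on $\mathbb T^3$ and every $t\in[0,T)$, $$\int u(t)\cdot\varphi=\int V\cdot\varphi+\int_0^t\Big(\int\sum_{i,k}u_iu_k\,\partial_i\varphi_k-\nu\int u\cdot(-\Delta)^\alpha\varphi\Big)ds .$$ This is the weak form of $\partial_tu+(u\cdot\nabla)u+\nabla p=-\nu(-\Delta)^\alpha u$, $\nabla\cdot u=0$. It satisfies the energy inequality if $|u(t)|_2^2+2\nu\int_0^t\big||\nabla|^\alpha u(s)\big|_2^2\,ds\le|V|_2^2$ for all $t\in(0,T)$. **Proposition.** 1. The coefficients above define a real, divergence-free field $U\in L^2(\mathbb T^3)$, and $U\in B^{1+3/r-2\alpha}_{r,\infty}$ for every $1<r\le\infty$. For every $\eta>0$ there is $\kappa>0$ with $\|\kappa U\|_{B^{1-2\alpha}_{\infty,\infty}}<\eta$. 2. Let $\kappa>0$ and $\nu>0$ (the case $\kappa=1$ is the initial datum $U$ itself). For every $T>0$ and every weak solution $u$ on $[0,T)$ with initial value $\kappa U$ there is $\delta=\delta(u)>0$ with $$\limsup_{t\to0+}\|u(t)-\kappa U\|_{B^{1-2\alpha}_{\infty,\infty}}\ge\delta .$$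 3. For given $\kappa,\nu>0$, there is one $\delta>0$ for which this inequality holds for all $T>0$ and all weak solutions $u$ on $[0,T)$ with initial value $\kappa U$ that satisfy the energy inequality. In particular, such solutions are discontinuous at $t=0$ in $B^{1-2\alpha}_{\infty,\infty}$. -/

import Mathlib

open MeasureTheory Filter Topology Set
open scoped ENNReal Pointwise

noncomputable section

namespace FracNSE

/-- Real and complex three-dimensional vectors, with the Euclidean norm. -/
abbrev R3 : Type := EuclideanSpace ℝ (Fin 3)

abbrev C3 : Type := EuclideanSpace ℂ (Fin 3)

/-- Frequencies: the lattice of integer vectors. -/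
abbrev Freq : Type := Fin 3 → ℤ

/-- The torus. It is Mathlib's `(ℝ / ℤ) ^ 3`, but it carries the coordinates of the
`2π`-periodic torus: see `covering`. -/
abbrev T3 : Type := UnitAddTorus (Fin 3)

/-- The Haar probability measure of the torus. -/
abbrev torusMeasure : Measure T3 := Measure.pi fun _ => AddCircle.haarAddCircle

/-- The covering map of the `2π`-periodic torus: `ℝ ^ 3 / (2 π ℤ) ^ 3` is identified with
`(ℝ / ℤ) ^ 3` by `x ↦ x / (2 π)`. All derivatives below are taken with respect to `x`. -/
def covering (x : Fin 3 → ℝ) : T3 := fun i => ((x i / (2 * Real.pi) : ℝ) : UnitAddCircle)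

/-- In these coordinates Mathlib's characters are `x ↦ exp (i ξ · x)`. -/
theorem mFourier_covering (ξ : Freq) (x : Fin 3 → ℝ) :
    UnitAddTorus.mFourier ξ (covering x) =
      Complex.exp (Complex.I * ((∑ i, (ξ i : ℝ) * x i : ℝ) : ℂ)) := by
  have hpi : (Real.pi : ℂ) ≠ 0 := by exact_mod_cast Real.pi_ne_zero
  simp only [UnitAddTorus.mFourier, covering, ContinuousMap.coe_mk]
  simp only [fourier_coe_apply]
  rw [← Complex.exp_sum]
  congr 1
  push_cast
  rw [Finset.mul_sum]
  refine Finset.sum_congr rfl fun i _ => ?_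
  field_simp

/-- Square-integrable real vector fields on the torus. -/
abbrev L2Field : Type := Lp R3 2 torusMeasure

/-- The partial derivative with respect to the `i`-th coordinate. -/
def pderiv (i : Fin 3) (φ : T3 → R3) (x : T3) : R3 :=
  deriv (fun s : ℝ => φ (x + covering (Pi.single i s))) 0

/-- Smooth vector fields on the torus. -/
def IsSmooth (φ : T3 → R3) : Prop :=
  ContDiff ℝ ((⊤ : ℕ∞) : WithTop ℕ∞) (fun x : Fin 3 → ℝ => φ (covering x))

/-- The Fourier coefficient of a vector field at the frequency `ξ`. -/
def coeff (f : T3 → R3) (ξ : Freq) : C3 :=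
  WithLp.toLp 2 fun i => UnitAddTorus.mFourierCoeff (fun x => ((f x i : ℝ) : ℂ)) ξ

/-- The Euclidean length of a frequency. -/
def freqNorm (ξ : Freq) : ℝ := Real.sqrt (∑ i, (ξ i : ℝ) ^ 2)

/-- Divergence-free fields: `ξ · f̂(ξ) = 0` for all frequencies, which says that the distributional
divergence is zero. -/
def IsDivFree (f : T3 → R3) : Prop := ∀ ξ : Freq, ∑ i, (ξ i : ℂ) * coeff f ξ i = 0

/-- The squared `L²` norm of `|∇|^s f`. -/
def sobolevSq (s : ℝ) (f : T3 → R3) : ℝ≥0∞ :=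
  ∑' ξ : Freq, ENNReal.ofReal (freqNorm ξ ^ (2 * s)) * ‖coeff f ξ‖ₑ ^ 2

/-- The fractional Laplacian `(-Δ)^α`, the Fourier multiplier with symbol `|ξ|^(2α)`, on smooth
real vector fields (the series converges absolutely and its sum is real). -/
def fracLaplacian (α : ℝ) (φ : T3 → R3) (x : T3) : R3 :=
  WithLp.toLp 2 fun i =>
    (∑' ξ : Freq, ((freqNorm ξ ^ (2 * α) : ℝ) : ℂ) * coeff φ ξ i * UnitAddTorus.mFourier ξ x).re

/-! ### Littlewood-Paley decomposition and Besov norms -/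

/-- The dyadic wavenumber `2 ^ q`. -/
def wavenumber (q : ℤ) : ℝ := (2 : ℝ) ^ q

/-- Radial profiles of a Littlewood-Paley decomposition. -/
structure IsCutoff (χ : ℝ → ℝ) : Prop where
  smooth : ContDiff ℝ ((⊤ : ℕ∞) : WithTop ℕ∞) χ
  range : ∀ r, χ r ∈ Icc (0 : ℝ) 1
  eq_one : ∀ r ≤ 1 / 2, χ r = 1
  eq_zero : ∀ r ≥ 1, χ r = 0

/-- The symbol of the `q`-th Littlewood-Paley projection. For `q ≥ 1` it vanishes outside the shell
`2^(q-1) < |ξ| < 2^(q+1)`. For `q = 0` it is supported in `|ξ| < 2` and also keeps the mean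
value, so that the symbols add up to `1` at every frequency. -/
def shellSymbol (χ : ℝ → ℝ) (q : ℕ) (ξ : Freq) : ℝ :=
  if q = 0 then χ (freqNorm ξ / 2)
  else χ (freqNorm ξ / wavenumber ((q : ℤ) + 1)) - χ (freqNorm ξ / wavenumber q)

/-- The `q`-th Littlewood-Paley projection; the sum over the frequencies is finite. -/
def lpProj (χ : ℝ → ℝ) (q : ℕ) (f : T3 → R3) (x : T3) : C3 :=
  ∑' ξ : Freq, ((shellSymbol χ q ξ : ℂ) * UnitAddTorus.mFourier ξ x) • coeff f ξ

/-- The norm of the Besov space `B^s_{r,∞}`, with value `∞` for fields outside the space. -/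
def besovNorm (χ : ℝ → ℝ) (s : ℝ) (r : ℝ≥0∞) (f : T3 → R3) : ℝ≥0∞ :=
  ⨆ q : ℕ, ENNReal.ofReal (wavenumber q ^ s) * eLpNorm (lpProj χ q f) r torusMeasure

/-! ### The initial datum -/

/-- The lattice block around `L e₁`. -/
def blockA (L : ℝ) : Set Freq :=
  {ξ | (ξ 0 : ℝ) ∈ Icc (9 / 10 * L) (11 / 10 * L) ∧
    (ξ 1 : ℝ) ∈ Icc (-(1 / 10 * L)) (1 / 10 * L) ∧ (ξ 2 : ℝ) ∈ Icc (-(1 / 10 * L)) (1 / 10 * L)}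

/-- The lattice block around `M e₃`. -/
def blockB (M : ℝ) : Set Freq :=
  {ξ | (ξ 0 : ℝ) ∈ Icc (-(1 / 10 * M)) (1 / 10 * M) ∧
    (ξ 1 : ℝ) ∈ Icc (-(1 / 10 * M)) (1 / 10 * M) ∧ (ξ 2 : ℝ) ∈ Icc (9 / 10 * M) (11 / 10 * M)}

/-- `p(ξ) e_k`, where `p(ξ) = id - |ξ|⁻² ξ ⊗ ξ` is the symbol of the Leray projection and
`p(0) = id`. -/
def lerayVec (k : Fin 3) (ξ : Freq) : C3 :=
  WithLp.toLp 2 fun i =>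
    (((if i = k then 1 else 0) - (ξ i : ℝ) * (ξ k : ℝ) / freqNorm ξ ^ 2 : ℝ) : ℂ)

/-- The indicator function of a set of frequencies. -/
def ind (S : Set Freq) (ξ : Freq) : ℂ := S.indicator (fun _ => 1) ξ

/-- The Fourier coefficients of `U_n + U_{n-1}`: the part of the datum with blocks
`A, C` in the shell `n` and `B` in the shell `n - 1`. Coordinates are numbered from `0`, so `e₁, e₂`
are `lerayVec 0`, `lerayVec 1`. -/
def pieceCoeff (α : ℝ) (n : ℕ) (ξ : Freq) : C3 :=
  let A := blockA (wavenumber n)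
  let B := blockB (wavenumber ((n : ℤ) - 1))
  let C := A + B
  ((wavenumber n ^ (2 * α - 4) : ℝ) : ℂ) •
    (ind (A ∪ -A) ξ • lerayVec 1 ξ
      + (Complex.I * ind C ξ) • (lerayVec 1 ξ - lerayVec 0 ξ)
      - (Complex.I * ind (-C) ξ) • (lerayVec 1 ξ - lerayVec 0 ξ)
      + ind (B ∪ -B) ξ • lerayVec 0 ξ)

/-- The Fourier coefficients of the initial datum (for each `ξ` the sum has finitely many nonzero
terms when `q` is strictly increasing). -/
def datumCoeff (α : ℝ) (q : ℕ → ℕ) (ξ : Freq) : C3 := ∑' j : ℕ, pieceCoeff α (q j) ξ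

/-! ### Weak solutions -/

/-- `u ∈ C_w([0,T); L²) ∩ L²([0,T); H¹)` is a weak solution with initial value `U` of
`∂ₜ u + (u · ∇) u + ∇ p = - ν (-Δ)^α u`, `∇ · u = 0`. -/
structure IsWeakSolution (α ν T : ℝ) (U : L2Field) (u : ℝ → L2Field) : Prop where
  init : u 0 = U
  weakly_continuous : ∀ g : L2Field, ContinuousOn (fun t => inner ℝ g (u t)) (Ico 0 T)
  square_integrable : ∫⁻ t in Ico 0 T, (‖u t‖ₑ ^ 2 + sobolevSq 1 (u t)) < ∞
  div_free : ∀ t ∈ Ico 0 T, IsDivFree (u t)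
  weak_equation : ∀ φ : T3 → R3, IsSmooth φ → IsDivFree φ → ∀ t ∈ Ico 0 T,
    (∫ x, inner ℝ (u t x) (φ x) ∂torusMeasure) = (∫ x, inner ℝ (U x) (φ x) ∂torusMeasure) +
      ∫ s in (0 : ℝ)..t,
        ((∫ x, (∑ i, ∑ k, u s x i * u s x k * pderiv i φ x k) ∂torusMeasure)
          - ν * (∫ x, inner ℝ (u s x) (fracLaplacian α φ x) ∂torusMeasure))

/-- The energy inequality
`|u(t)|₂² + 2 ν ∫₀ᵗ ||∇|^α u(s)|₂² ds ≤ |U|₂²` for all `t ∈ (0, T)`. -/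
def EnergyInequality (α ν T : ℝ) (U : L2Field) (u : ℝ → L2Field) : Prop :=
  ∀ t ∈ Ioo 0 T,
    ‖u t‖ₑ ^ 2 + 2 * ENNReal.ofReal ν * ∫⁻ s in Ioc 0 t, sobolevSq α (u s) ≤ ‖U‖ₑ ^ 2

end FracNSE

end

namespace FracNSE

/-! Fix a shell j and write L = `wavenumber (q j)`. The argument tests the equation with a
divergence-free field, `testField L`, whose frequencies lie in B - A and A - B, that is near ±(-L,
0, L/2). The datum has no Fourier coefficients there, since C = A + B sits near (L, 0, L/2). The
product of its blocks A and B does reach this region, and all these products contribute with the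
same sign. Hence the flux of U ⊗ U against the gradient of the test field is at least c L^(4α)
(`flux_datum_ge`): the squared amplitude is L^(4α-8), the symbol of one interaction is of order L²
(`interaction_AB`), and the weights `bump` sum to order L⁶ over B × A (`sum_corr_sub_ge`).

Suppose that a weak solution u stays within δ of κU in B^(1-2α)_(∞,∞) on (0, t]. In the paraproduct
decomposition `integral_mul_mul_trig_eq`, the low-frequency factors are of size L^(2α-1) in the sup
norm, and the gradient of the test field is O(L²) in L¹. So replacing u by κU costs O((κδ + δ²)
L^(4α)). The product of the two high-frequency parts is controlled by L³ times the squared gradient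
norm of u, which is integrable in time (`exists_norm_flux_sub_le`). The viscous term sees only u -
κU and is O(δ L^(4α)) (`exists_dissipation_le`). The pairings of u(t) and κU with the test field are
O(L³). For small δ, integration in time gives c t L^(4α) ≤ C L³ with C independent of j
(`exists_flux_growth`), which fails as j → ∞ because 4α > 3. The threshold δ is fixed before T and
u, so it is uniform over solutions. The gap condition enters through 2 q_j < q_(j+1), which isolates
every late shell.

For the regularity of U, the blocks are lattice boxes, so their indicator functions are the
coefficients of products of Dirichlet kernels, of L^r norm O(L^(3-3/r)) for r > 1. The Leray symbol
acts boundedly on annuli by a multiplier theorem valid for all 1 ≤ r ≤ ∞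
(`exists_eLpNorm_multiplier_le`). With the amplitude L^(2α-4) this is the growth that
B^(1+3/r-2α)_(r,∞) allows. The pieces have L² norm O(L^(2α-5/2)), which is summable because α < 5/4.
-/

/-! ### Trigonometric polynomials and Fourier coefficients on the torus. -/

/-- The trigonometric polynomial with coefficients `c` on the finite set `s`. -/
noncomputable def trig (s : Finset Freq) (c : Freq → ℂ) (x : T3) : ℂ :=
  ∑ ξ ∈ s, c ξ * UnitAddTorus.mFourier ξ x

@[fun_prop]
theorem continuous_trig (s : Finset Freq) (c : Freq → ℂ) : Continuous (trig s c) := by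
  unfold trig; fun_prop

theorem norm_mFourier_apply (ξ : Freq) (x : T3) : ‖UnitAddTorus.mFourier ξ x‖ = 1 := by
  simp only [UnitAddTorus.mFourier, ContinuousMap.coe_mk, fourier_apply, norm_prod,
    Circle.norm_coe, Finset.prod_const_one]

theorem memLp_of_continuous {E : Type*} [NormedAddCommGroup E] {f : T3 → E} (hf : Continuous f)
    (p : ℝ≥0∞) : MemLp f p torusMeasure := by
  obtain ⟨C, hC⟩ := isCompact_univ.exists_bound_of_continuousOn hf.continuousOn
  exact MemLp.of_bound (hf.stronglyMeasurable_of_hasCompactSupport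
    (HasCompactSupport.of_compactSpace f)).aestronglyMeasurable C
    (ae_of_all _ fun x => hC x (mem_univ x))

theorem integrable_of_continuous {E : Type*} [NormedAddCommGroup E] {f : T3 → E}
    (hf : Continuous f) : Integrable f torusMeasure :=
  memLp_one_iff_integrable.1 (memLp_of_continuous hf 1)

theorem norm_trig_le (s : Finset Freq) (c : Freq → ℂ) (x : T3) : ‖trig s c x‖ ≤ ∑ ξ ∈ s, ‖c ξ‖ := by
  refine (norm_sum_le _ _).trans (Finset.sum_le_sum fun ξ _ => ?_)
  rw [norm_mul, norm_mFourier_apply, mul_one]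

theorem trig_congr {s : Finset Freq} {c d : Freq → ℂ} (h : ∀ ξ ∈ s, c ξ = d ξ) :
    trig s c = trig s d := by
  funext x
  exact Finset.sum_congr rfl fun ξ hξ => by rw [h ξ hξ]

theorem trig_subset {s t : Finset Freq} {c : Freq → ℂ} (hst : s ⊆ t) (h : ∀ ξ ∈ t, ξ ∉ s → c ξ = 0) :
    trig s c = trig t c := by
  funext x
  exact Finset.sum_subset hst fun ξ ht hs => by rw [h ξ ht hs, zero_mul]

theorem trig_add (s : Finset Freq) (c d : Freq → ℂ) (x : T3) :
    trig s (fun ξ => c ξ + d ξ) x = trig s c x + trig s d x := by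
  simp [trig, add_mul, Finset.sum_add_distrib]

theorem trig_sub (s : Finset Freq) (c d : Freq → ℂ) (x : T3) :
    trig s (fun ξ => c ξ - d ξ) x = trig s c x - trig s d x := by
  simp [trig, sub_mul, Finset.sum_sub_distrib]

theorem trig_smul (s : Finset Freq) (a : ℂ) (c : Freq → ℂ) (x : T3) :
    trig s (fun ξ => a * c ξ) x = a * trig s c x := by
  simp [trig, Finset.mul_sum, mul_assoc]

theorem trig_sum {ι : Type*} (t : Finset ι) (s : Finset Freq) (c : ι → Freq → ℂ) (x : T3) :
    trig s (fun ξ => ∑ i ∈ t, c i ξ) x = ∑ i ∈ t, trig s (c i) x := by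
  simp only [trig, Finset.sum_mul]
  rw [Finset.sum_comm]

theorem trig_translate (s : Finset Freq) (c : Freq → ℂ) (x τ : T3) :
    trig s (fun ξ => UnitAddTorus.mFourier ξ τ * c ξ) x = trig s c (x + τ) := by
  refine Finset.sum_congr rfl fun ξ _ => ?_
  have : UnitAddTorus.mFourier ξ (x + τ) = UnitAddTorus.mFourier ξ x * UnitAddTorus.mFourier ξ τ := by
    simp [UnitAddTorus.mFourier, fourier_apply, smul_add, AddCircle.toCircle_add,
      Finset.prod_mul_distrib]
  rw [this]; ring

theorem integral_mul_mFourier (f : T3 → ℂ) (ξ : Freq) :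
    ∫ x, f x * UnitAddTorus.mFourier ξ x ∂torusMeasure = UnitAddTorus.mFourierCoeff f (-ξ) := by
  unfold UnitAddTorus.mFourierCoeff
  rw [neg_neg]
  exact integral_congr_ae (ae_of_all _ fun x => by simp [mul_comm])

theorem integrable_mul_continuous {f g : T3 → ℂ} (hf : Integrable f torusMeasure)
    (hg : Continuous g) : Integrable (fun x => f x * g x) torusMeasure := by
  obtain ⟨C, hC⟩ := isCompact_univ.exists_bound_of_continuousOn hg.continuousOn
  exact hf.mul_bdd hg.aestronglyMeasurable (ae_of_all _ fun x => hC x (mem_univ x))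

theorem integral_mul_trig {f : T3 → ℂ} (hf : Integrable f torusMeasure) (s : Finset Freq)
    (c : Freq → ℂ) :
    ∫ x, f x * trig s c x ∂torusMeasure = ∑ ξ ∈ s, c ξ * UnitAddTorus.mFourierCoeff f (-ξ) := by
  simp only [trig, Finset.mul_sum]
  rw [integral_finsetSum]
  · refine Finset.sum_congr rfl fun ξ _ => ?_
    rw [← integral_mul_mFourier, ← integral_const_mul]
    exact integral_congr_ae (ae_of_all _ fun x => by simp only []; ring)
  · intro ξ _
    exact integrable_mul_continuous hf (by fun_prop)

theorem mFourier_mul (ξ η : Freq) (x : T3) :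
    UnitAddTorus.mFourier ξ x * UnitAddTorus.mFourier η x = UnitAddTorus.mFourier (ξ + η) x :=
  UnitAddTorus.mFourier_add.symm

theorem integral_mul_trig_mul_trig {f : T3 → ℂ} (hf : Integrable f torusMeasure)
    (s t : Finset Freq) (c d : Freq → ℂ) :
    ∫ x, f x * (trig s c x * trig t d x) ∂torusMeasure =
      ∑ ξ ∈ s, ∑ η ∈ t, c ξ * d η * UnitAddTorus.mFourierCoeff f (-(ξ + η)) := by
  have : ∀ x, f x * (trig s c x * trig t d x) = ∑ ξ ∈ s, ∑ η ∈ t,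
      c ξ * d η * (f x * UnitAddTorus.mFourier (ξ + η) x) := by
    intro x
    simp only [trig]
    rw [Finset.sum_mul_sum, Finset.mul_sum]
    refine Finset.sum_congr rfl fun ξ _ => ?_
    rw [Finset.mul_sum]
    refine Finset.sum_congr rfl fun η _ => ?_
    rw [← mFourier_mul]; ring
  simp only [this]
  rw [integral_finsetSum]
  · refine Finset.sum_congr rfl fun ξ _ => ?_
    rw [integral_finsetSum]
    · refine Finset.sum_congr rfl fun η _ => ?_
      rw [integral_const_mul, integral_mul_mFourier]
    · exact fun η _ => (integrable_mul_continuous hf (by fun_prop)).const_mul _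
  · exact fun ξ _ => integrable_finsetSum _ fun η _ =>
      (integrable_mul_continuous hf (by fun_prop)).const_mul _

theorem mFourierCoeff_mFourier (ξ η : Freq) :
    UnitAddTorus.mFourierCoeff (fun x => UnitAddTorus.mFourier ξ x) η = if ξ = η then 1 else 0 := by
  have := orthonormal_iff_ite.1 (UnitAddTorus.orthonormal_mFourier (d := Fin 3)) η ξ
  simp only [UnitAddTorus.mFourierLp, ContinuousMap.inner_toLp] at this
  rw [UnitAddTorus.mFourierCoeff]
  simp only [eq_comm (a := ξ)]
  rw [← this]
  refine integral_congr_ae (ae_of_all _ fun x => ?_)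
  simp [UnitAddTorus.mFourier_neg, mul_comm]

theorem mFourierCoeff_trig (s : Finset Freq) (c : Freq → ℂ) (ξ : Freq) :
    UnitAddTorus.mFourierCoeff (trig s c) ξ = if ξ ∈ s then c ξ else 0 := by
  have h : UnitAddTorus.mFourierCoeff (trig s c) ξ =
      ∫ x, UnitAddTorus.mFourier (-ξ) x * trig s c x ∂torusMeasure := rfl
  rw [h, integral_mul_trig (integrable_of_continuous (by fun_prop))]
  have : ∀ η, UnitAddTorus.mFourierCoeff (fun x => UnitAddTorus.mFourier (-ξ) x) (-η) =
      if ξ = η then 1 else 0 := by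
    intro η; rw [mFourierCoeff_mFourier]; simp
  simp [this]

theorem integral_trig_mul_trig_mul_trig (s t r : Finset Freq) (c d e : Freq → ℂ) :
    ∫ x, trig r e x * (trig s c x * trig t d x) ∂torusMeasure =
      ∑ ξ ∈ s, ∑ η ∈ t, c ξ * d η * (if -(ξ + η) ∈ r then e (-(ξ + η)) else 0) := by
  rw [integral_mul_trig_mul_trig (integrable_of_continuous (by fun_prop))]
  simp only [mFourierCoeff_trig]

theorem mFourierCoeff_congr_ae {f g : T3 → ℂ} (h : f =ᵐ[torusMeasure] g) (ξ : Freq) :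
    UnitAddTorus.mFourierCoeff f ξ = UnitAddTorus.mFourierCoeff g ξ := by
  refine integral_congr_ae ?_
  filter_upwards [h] with x hx
  rw [hx]

theorem mFourierCoeff_sub {f g : T3 → ℂ} (hf : Integrable f torusMeasure)
    (hg : Integrable g torusMeasure) (ξ : Freq) :
    UnitAddTorus.mFourierCoeff (fun x => f x - g x) ξ =
      UnitAddTorus.mFourierCoeff f ξ - UnitAddTorus.mFourierCoeff g ξ := by
  have h : ∀ u : T3 → ℂ, UnitAddTorus.mFourierCoeff u ξ =
      ∫ x, u x * UnitAddTorus.mFourier (-ξ) x ∂torusMeasure := fun u => by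
    rw [integral_mul_mFourier, neg_neg]
  simp only [h, sub_mul]
  exact integral_sub (integrable_mul_continuous hf (by fun_prop))
    (integrable_mul_continuous hg (by fun_prop))

theorem mFourierCoeff_add {f g : T3 → ℂ} (hf : Integrable f torusMeasure)
    (hg : Integrable g torusMeasure) (ξ : Freq) :
    UnitAddTorus.mFourierCoeff (fun x => f x + g x) ξ =
      UnitAddTorus.mFourierCoeff f ξ + UnitAddTorus.mFourierCoeff g ξ := by
  have h : ∀ u : T3 → ℂ, UnitAddTorus.mFourierCoeff u ξ =
      ∫ x, u x * UnitAddTorus.mFourier (-ξ) x ∂torusMeasure := fun u => by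
    rw [integral_mul_mFourier, neg_neg]
  simp only [h, add_mul]
  exact integral_add (integrable_mul_continuous hf (by fun_prop))
    (integrable_mul_continuous hg (by fun_prop))

theorem mFourierCoeff_const_mul (a : ℂ) (f : T3 → ℂ) (ξ : Freq) :
    UnitAddTorus.mFourierCoeff (fun x => a * f x) ξ = a * UnitAddTorus.mFourierCoeff f ξ := by
  unfold UnitAddTorus.mFourierCoeff
  rw [← integral_const_mul]
  exact integral_congr_ae (ae_of_all _ fun x => by simp only [smul_eq_mul]; ring)

theorem hasSum_sq_mFourierCoeff {f : T3 → ℂ} (hf : MemLp f 2 torusMeasure) :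
    HasSum (fun ξ => ‖UnitAddTorus.mFourierCoeff f ξ‖ ^ 2) (∫ x, ‖f x‖ ^ 2 ∂torusMeasure) := by
  have h := UnitAddTorus.hasSum_sq_mFourierCoeff (hf.toLp f)
  have h1 : ∀ ξ, UnitAddTorus.mFourierCoeff (hf.toLp f) ξ = UnitAddTorus.mFourierCoeff f ξ :=
    mFourierCoeff_congr_ae hf.coeFn_toLp
  simp only [h1] at h
  convert h using 1
  refine integral_congr_ae ?_
  filter_upwards [hf.coeFn_toLp] with x hx
  rw [hx]

theorem hasSum_inner_mFourierCoeff {f g : T3 → ℂ} (hf : MemLp f 2 torusMeasure)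
    (hg : MemLp g 2 torusMeasure) :
    HasSum (fun ξ => (starRingEnd ℂ) (UnitAddTorus.mFourierCoeff f ξ) *
      UnitAddTorus.mFourierCoeff g ξ) (∫ x, (starRingEnd ℂ) (f x) * g x ∂torusMeasure) := by
  have h := UnitAddTorus.hasSum_prod_mFourierCoeff (hf.toLp f) (hg.toLp g)
  have h1 : ∀ ξ, UnitAddTorus.mFourierCoeff (hf.toLp f) ξ = UnitAddTorus.mFourierCoeff f ξ :=
    mFourierCoeff_congr_ae hf.coeFn_toLp
  have h2 : ∀ ξ, UnitAddTorus.mFourierCoeff (hg.toLp g) ξ = UnitAddTorus.mFourierCoeff g ξ :=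
    mFourierCoeff_congr_ae hg.coeFn_toLp
  simp only [h1, h2] at h
  convert h using 1
  refine integral_congr_ae ?_
  filter_upwards [hf.coeFn_toLp, hg.coeFn_toLp] with x hx hy
  rw [hx, hy]

theorem integral_sq_trig (s : Finset Freq) (c : Freq → ℂ) :
    ∫ x, ‖trig s c x‖ ^ 2 ∂torusMeasure = ∑ ξ ∈ s, ‖c ξ‖ ^ 2 := by
  have h := hasSum_sq_mFourierCoeff (memLp_of_continuous (continuous_trig s c) 2)
  simp only [mFourierCoeff_trig] at h
  refine h.unique ?_
  have : ∑ ξ ∈ s, ‖c ξ‖ ^ 2 = ∑ ξ ∈ s, ‖if ξ ∈ s then c ξ else 0‖ ^ 2 :=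
    Finset.sum_congr rfl fun ξ hξ => by rw [if_pos hξ]
  rw [this]
  exact hasSum_sum_of_ne_finset_zero fun ξ hξ => by simp [hξ]

/-! ### Fourier multipliers on L^r, uniformly in the scale. -/

/-- The frequency `ξ`, as a vector, at scale `L`. -/
noncomputable def scaled (L : ℝ) (ξ : Freq) : R3 := WithLp.toLp 2 fun i => (ξ i : ℝ) / L

theorem scaled_apply (L : ℝ) (ξ : Freq) (i : Fin 3) : scaled L ξ i = ξ i / L := rfl

theorem norm_scaled {L : ℝ} (hL : 0 < L) (ξ : Freq) : ‖scaled L ξ‖ = freqNorm ξ / L := by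
  rw [EuclideanSpace.norm_eq, freqNorm]
  have : ∀ i, ‖scaled L ξ i‖ ^ 2 = (ξ i : ℝ) ^ 2 / L ^ 2 := fun i => by
    simp [scaled, div_pow]
  simp only [this]
  rw [← Finset.sum_div, Real.sqrt_div' _ (by positivity), Real.sqrt_sq hL.le]

theorem mFourier_coe (ξ : Freq) (k : Fin 3 → ℝ) :
    UnitAddTorus.mFourier ξ (fun i => ((k i : ℝ) : UnitAddCircle)) =
      Complex.exp (2 * Real.pi * Complex.I * ((∑ i, (ξ i : ℝ) * k i : ℝ) : ℂ)) := by
  simp only [UnitAddTorus.mFourier, ContinuousMap.coe_mk, fourier_coe_apply]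
  rw [← Complex.exp_sum]
  congr 1
  push_cast
  rw [Finset.mul_sum]
  refine Finset.sum_congr rfl fun i _ => ?_
  ring

theorem eLpNorm_trig_translate (s : Finset Freq) (c : Freq → ℂ) (τ : T3) (r : ℝ≥0∞) :
    eLpNorm (trig s fun ξ => UnitAddTorus.mFourier ξ τ * c ξ) r torusMeasure =
      eLpNorm (trig s c) r torusMeasure := by
  have h : (trig s fun ξ => UnitAddTorus.mFourier ξ τ * c ξ) = trig s c ∘ (fun x => x + τ) := by
    funext x; exact trig_translate s c x τ
  rw [h]
  exact eLpNorm_comp_measurePreserving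
    (memLp_of_continuous (continuous_trig s c) 1).aestronglyMeasurable
    (measurePreserving_add_right torusMeasure τ)

/-- The trigonometric polynomial as an element of `L^r`. -/
noncomputable def trigLp (r : ℝ≥0∞) (s : Finset Freq) (c : Freq → ℂ) : Lp ℂ r torusMeasure :=
  (memLp_of_continuous (continuous_trig s c) r).toLp _

/-- Linearity in the coefficients, as an identity in L^r: it lets a Bochner integral over
translations be computed frequency by frequency. -/
theorem trigLp_eq_sum (r : ℝ≥0∞) [Fact (1 ≤ r)] (s : Finset Freq) (c : Freq → ℂ) :
    trigLp r s c = ∑ ξ ∈ s, c ξ • trigLp r {ξ} 1 := by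
  classical
  have key : ∀ t : Finset Freq, (memLp_of_continuous (continuous_trig t c) r).toLp _
      = ∑ ξ ∈ t, c ξ • trigLp r {ξ} 1 := by
    intro t
    induction t using Finset.induction_on with
    | empty =>
      rw [Finset.sum_empty]
      have : trig ∅ c = 0 := by funext x; simp [trig]
      simp only [this]
      exact MemLp.toLp_zero _
    | insert ξ t hξ ih =>
      rw [Finset.sum_insert hξ, ← ih, trigLp, ← MemLp.toLp_const_smul, ← MemLp.toLp_add]
      congr 1
      funext x
      simp [trig, Finset.sum_insert hξ]
  exact key s

theorem norm_trigLp (r : ℝ≥0∞) [Fact (1 ≤ r)] (s : Finset Freq) (c : Freq → ℂ) :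
    ‖trigLp r s c‖ = (eLpNorm (trig s c) r torusMeasure).toReal := by
  rw [trigLp, Lp.norm_toLp]

/-- A smooth compactly supported symbol, dilated to an arbitrary scale, is a Fourier multiplier
on `L^r`, with a bound that depends neither on the scale nor on `r`. -/
theorem exists_eLpNorm_multiplier_le {M : R3 → ℂ}
    (hM : ContDiff ℝ ((⊤ : ℕ∞) : WithTop ℕ∞) M) (hc : HasCompactSupport M) :
    ∃ A : ℝ, 0 ≤ A ∧ ∀ (L : ℝ) (r : ℝ≥0∞), 1 ≤ r → ∀ (s : Finset Freq) (c : Freq → ℂ),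
      eLpNorm (trig s fun ξ => M (scaled L ξ) * c ξ) r torusMeasure ≤
        ENNReal.ofReal A * eLpNorm (trig s c) r torusMeasure := by
  -- Fourier inversion writes M(ξ/L) as the integral of g(k) exp(2πi k·ξ/L), so the multiplier is an
  -- average of translations of the torus with density g. Translations preserve every L^r norm, and
  -- the constant is the L¹ norm of g.
  let φ : SchwartzMap R3 ℂ := hc.toSchwartzMap hM
  let g : SchwartzMap R3 ℂ := FourierTransform.fourier φ
  have hg : Integrable g := g.integrable
  have hinv : ∀ v : R3, M v = ∫ k : R3, Complex.exp (↑(2 * Real.pi * inner ℝ k v) * Complex.I) • g k := by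
    intro v
    have h1 : FourierTransformInv.fourierInv g = φ := FourierTransform.fourierInv_fourier_eq φ
    rw [← Real.fourierInv_eq', ← SchwartzMap.fourierInv_coe, h1]
    rfl
  refine ⟨∫ k, ‖g k‖, integral_nonneg fun _ => norm_nonneg _, fun L r hr s c => ?_⟩
  have : Fact (1 ≤ r) := ⟨hr⟩
  let τ : R3 → T3 := fun k i => ((k i / L : ℝ) : UnitAddCircle)
  have hτ : ∀ k ξ, UnitAddTorus.mFourier ξ (τ k) =
      Complex.exp (↑(2 * Real.pi * inner ℝ k (scaled L ξ)) * Complex.I) := by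
    intro k ξ
    rw [mFourier_coe ξ fun i => k i / L]
    congr 1
    have : ∑ i, (ξ i : ℝ) * (k i / L) = inner ℝ k (scaled L ξ) := by
      rw [PiLp.inner_apply]
      refine Finset.sum_congr rfl fun i _ => ?_
      simp [scaled]; ring
    rw [this]; push_cast; ring
  have hint : ∀ ξ, Integrable (fun k => g k * UnitAddTorus.mFourier ξ (τ k)) := by
    intro ξ
    refine hg.mul_bdd (c := 1) ?_ (ae_of_all _ fun k => (norm_mFourier_apply _ _).le)
    simp only [hτ]
    exact Continuous.aestronglyMeasurable (by fun_prop)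
  have hcoef : ∀ ξ, M (scaled L ξ) = ∫ k, g k * UnitAddTorus.mFourier ξ (τ k) := by
    intro ξ
    rw [hinv]
    refine integral_congr_ae (ae_of_all _ fun k => ?_)
    simp only [hτ, smul_eq_mul, mul_comm]
  -- The integrand stays in the span of finitely many characters, so the Bochner integral is
  -- available for r = ∞ as well.
  have hsum : trigLp r s (fun ξ => M (scaled L ξ) * c ξ) =
      ∫ k, g k • trigLp r s (fun ξ => UnitAddTorus.mFourier ξ (τ k) * c ξ) := by
    have : ∀ k, g k • trigLp r s (fun ξ => UnitAddTorus.mFourier ξ (τ k) * c ξ) =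
        ∑ ξ ∈ s, (g k * UnitAddTorus.mFourier ξ (τ k)) • (c ξ • trigLp r {ξ} 1) := by
      intro k
      rw [trigLp_eq_sum, Finset.smul_sum]
      refine Finset.sum_congr rfl fun ξ _ => ?_
      rw [smul_smul, smul_smul, mul_assoc]
    simp only [this]
    rw [integral_finsetSum _ fun ξ _ => (hint ξ).smul_const _, trigLp_eq_sum]
    refine Finset.sum_congr rfl fun ξ _ => ?_
    rw [integral_smul_const, ← hcoef, smul_smul]
  have hle : ‖trigLp r s (fun ξ => M (scaled L ξ) * c ξ)‖ ≤ (∫ k, ‖g k‖) * ‖trigLp r s c‖ := by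
    rw [hsum]
    refine (norm_integral_le_integral_norm _).trans (le_of_eq ?_)
    rw [← integral_mul_const]
    refine integral_congr_ae (ae_of_all _ fun k => ?_)
    simp only []
    rw [norm_smul, norm_trigLp, norm_trigLp, eLpNorm_trig_translate]
  rw [norm_trigLp, norm_trigLp] at hle
  have hfin : ∀ d : Freq → ℂ, eLpNorm (trig s d) r torusMeasure ≠ ∞ := fun d =>
    (memLp_of_continuous (continuous_trig s d) r).eLpNorm_ne_top
  rw [← ENNReal.ofReal_toReal (hfin _), ← ENNReal.ofReal_toReal (hfin c),
    ← ENNReal.ofReal_mul (integral_nonneg fun _ => norm_nonneg _)]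
  exact ENNReal.ofReal_le_ofReal hle

/-! ### Dirichlet kernels and their L^r norms. -/

/-- The Dirichlet kernel of an interval of integers. -/
noncomputable def dirichlet (a b : ℤ) (x : UnitAddCircle) : ℂ := ∑ m ∈ Finset.Icc a b, fourier m x

@[fun_prop]
theorem continuous_dirichlet (a b : ℤ) : Continuous (dirichlet a b) := by
  unfold dirichlet; fun_prop

theorem norm_fourier_apply (m : ℤ) (x : UnitAddCircle) : ‖fourier m x‖ = 1 := by
  simp only [fourier_apply, Circle.norm_coe]

theorem norm_dirichlet_le_card (a b : ℤ) (x : UnitAddCircle) :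
    ‖dirichlet a b x‖ ≤ (Finset.Icc a b).card := by
  refine (norm_sum_le _ _).trans ?_
  simp only [norm_fourier_apply, Finset.sum_const, nsmul_eq_mul, mul_one, le_refl]

theorem dirichlet_mul (a b : ℤ) (hab : a ≤ b) (x : UnitAddCircle) :
    dirichlet a b x * (fourier 1 x - 1) = fourier (b + 1) x - fourier a x := by
  induction b, hab using Int.leInduction with
  | base => simp [dirichlet, mul_sub]
  | succ b hab ih =>
    have h : dirichlet a (b + 1) x = dirichlet a b x + fourier (b + 1) x := by
      have : Finset.Icc a (b + 1) = insert (b + 1) (Finset.Icc a b) := by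
        ext m; simp; omega
      rw [dirichlet, this, Finset.sum_insert (by simp), add_comm]; rfl
    have h2 : (fourier (b + 1 + 1) x : ℂ) = fourier (b + 1) x * fourier 1 x := fourier_add
    rw [h, add_mul, ih, h2]; ring

/-- The left factor comes from |exp(2πiy) - 1| = 2 |sin πy| and Jordan's inequality sin x ≥ 2x/π on
[0, π/2]. -/
theorem norm_fourier_one_sub_one {y : ℝ} (hy : |y| ≤ 1 / 2) :
    4 * |y| ≤ ‖(fourier 1 (y : UnitAddCircle) : ℂ) - 1‖ := by
  have h1 : (fourier 1 (y : UnitAddCircle) : ℂ) = Complex.exp (Complex.I * (2 * Real.pi * y : ℝ)) := by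
    rw [fourier_coe_apply]; congr 1; push_cast; ring
  rw [h1, Complex.norm_exp_I_mul_ofReal_sub_one]
  have h2 : 2 * Real.pi * y / 2 = Real.pi * y := by ring
  rw [h2, norm_mul, Real.norm_eq_abs, Real.norm_eq_abs, abs_two]
  have h3 : |Real.sin (Real.pi * y)| = Real.sin (Real.pi * |y|) := by
    have hs : 0 ≤ Real.sin (Real.pi * |y|) :=
      Real.sin_nonneg_of_nonneg_of_le_pi (by positivity) (by nlinarith [Real.pi_pos])
    rcases abs_cases y with ⟨h, _⟩ | ⟨h, _⟩
    · rw [h] at hs ⊢; exact abs_of_nonneg hs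
    · rw [h] at hs ⊢
      rw [mul_neg, Real.sin_neg] at hs ⊢
      exact abs_of_nonpos (by linarith)
  have h4 := Real.mul_le_sin (x := Real.pi * |y|) (by positivity) (by nlinarith [Real.pi_pos])
  have h5 : 2 / Real.pi * (Real.pi * |y|) = 2 * |y| := by
    field_simp
  rw [h3]; linarith

/-- Two bounds are added: the number of terms, and |D(y)| |y| ≤ 1 from the telescoping geometric
sum. The outcome is a fixed decaying profile dilated by N. -/
theorem norm_dirichlet_le {a b : ℤ} {N : ℝ} (hN : 0 < N) (hab : ((Finset.Icc a b).card : ℝ) ≤ N)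
    {y : ℝ} (hy : |y| ≤ 1 / 2) :
    ‖dirichlet a b (y : UnitAddCircle)‖ ≤ 2 * N * (1 + ‖N * y‖)⁻¹ := by
  have h0 := (norm_dirichlet_le_card a b (y : UnitAddCircle)).trans hab
  have hpos : 0 < 1 + ‖N * y‖ := by positivity
  rw [← div_eq_mul_inv, le_div_iff₀ hpos, norm_mul, Real.norm_of_nonneg hN.le, Real.norm_eq_abs]
  have h1 : ‖dirichlet a b (y : UnitAddCircle)‖ * |y| ≤ 1 := by
    by_cases h : a ≤ b
    · have h2 := congrArg norm (dirichlet_mul a b h (y : UnitAddCircle))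
      rw [norm_mul] at h2
      have h3 := norm_fourier_one_sub_one hy
      have h4 : ‖(fourier (b + 1) (y : UnitAddCircle) : ℂ) - fourier a (y : UnitAddCircle)‖ ≤ 2 := by
        refine (norm_sub_le _ _).trans ?_
        rw [norm_fourier_apply, norm_fourier_apply]; norm_num
      nlinarith [norm_nonneg (dirichlet a b (y : UnitAddCircle))]
    · have : dirichlet a b (y : UnitAddCircle) = 0 := by
        simp [dirichlet, Finset.Icc_eq_empty h]
      simp [this]
  nlinarith

/-- The substitution z = N y turns the pointwise bound into N^(r-1) times the integral of (1 +
|z|)^(-r), which is finite because r > 1. -/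
theorem exists_integral_dirichlet_le {r : ℝ} (hr : 1 < r) :
    ∃ C : ℝ, 0 ≤ C ∧ ∀ (N : ℝ) (a b : ℤ), 0 < N → ((Finset.Icc a b).card : ℝ) ≤ N →
      ∫ x, ‖dirichlet a b x‖ ^ r ∂AddCircle.haarAddCircle ≤ C * N ^ (r - 1) := by
  have hint : Integrable (fun z : ℝ => (1 + ‖z‖) ^ (-r)) :=
    integrable_one_add_norm (by simpa using hr)
  refine ⟨2 ^ r * ∫ z : ℝ, (1 + ‖z‖) ^ (-r), mul_nonneg (by positivity)
    (integral_nonneg fun z => by positivity), fun N a b hN hab => ?_⟩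
  have h1 : ∫ x, ‖dirichlet a b x‖ ^ r ∂AddCircle.haarAddCircle =
      ∫ y in Ioc (-(1 / 2) : ℝ) (-(1 / 2) + 1), ‖dirichlet a b (y : UnitAddCircle)‖ ^ r := by
    rw [UnitAddCircle.integral_preimage (-(1 / 2)) fun x => ‖dirichlet a b x‖ ^ r,
      AddCircle.integral_haarAddCircle]
    simp
  have hint' : Integrable (fun y : ℝ => (2 * N) ^ r * (1 + ‖N * y‖) ^ (-r)) :=
    (hint.comp_mul_left' hN.ne').const_mul _
  have h2 : ∫ y in Ioc (-(1 / 2) : ℝ) (-(1 / 2) + 1), ‖dirichlet a b (y : UnitAddCircle)‖ ^ r ≤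
      ∫ y in Ioc (-(1 / 2) : ℝ) (-(1 / 2) + 1), (2 * N) ^ r * (1 + ‖N * y‖) ^ (-r) := by
    refine setIntegral_mono_on ?_ hint'.integrableOn measurableSet_Ioc fun y hy => ?_
    · refine (Continuous.integrableOn_Icc ?_).mono_set Ioc_subset_Icc_self
      refine Continuous.rpow_const ?_ fun _ => Or.inr (by linarith)
      exact ((continuous_dirichlet a b).comp (AddCircle.continuous_mk' 1)).norm
    · have := norm_dirichlet_le hN hab (y := y) (abs_le.2 ⟨hy.1.le, by linarith [hy.2]⟩)
      refine (Real.rpow_le_rpow (norm_nonneg _) this (by linarith)).trans (le_of_eq ?_)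
      rw [Real.mul_rpow (by positivity) (by positivity), Real.rpow_neg (by positivity),
        Real.inv_rpow (by positivity)]
  have h3 : ∫ y in Ioc (-(1 / 2) : ℝ) (-(1 / 2) + 1), (2 * N) ^ r * (1 + ‖N * y‖) ^ (-r) ≤
      ∫ y : ℝ, (2 * N) ^ r * (1 + ‖N * y‖) ^ (-r) :=
    setIntegral_le_integral hint' (ae_of_all _ fun y => by positivity)
  rw [h1]
  refine (h2.trans h3).trans (le_of_eq ?_)
  rw [integral_const_mul, Measure.integral_comp_mul_left (fun z => (1 + ‖z‖) ^ (-r)) N,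
    abs_of_pos (inv_pos.2 hN), Real.mul_rpow zero_le_two hN.le, Real.rpow_sub_one hN.ne', smul_eq_mul]
  ring

/-- A box in the lattice of frequencies. -/
noncomputable def latticeBox (a b : Freq) : Finset Freq := Fintype.piFinset fun i => Finset.Icc (a i) (b i)

theorem trig_latticeBox (a b : Freq) (x : T3) :
    trig (latticeBox a b) 1 x = ∏ i, dirichlet (a i) (b i) (x i) := by
  simp only [trig, latticeBox, dirichlet, Pi.one_apply, one_mul]
  rw [Finset.prod_univ_sum]
  rfl

/-- The polynomial of a box is a product of three one-dimensional kernels, each contributing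
N^(1-1/r). For r = ∞ the frequencies are counted instead; there `(∞⁻¹).toReal` is 0 and the exponent
is 3. -/
theorem exists_eLpNorm_trig_latticeBox_le {r : ℝ≥0∞} (hr : 1 < r) :
    ∃ C : ℝ, 0 ≤ C ∧ ∀ (N : ℝ) (a b : Freq), 0 < N →
      (∀ i, ((Finset.Icc (a i) (b i)).card : ℝ) ≤ N) →
      eLpNorm (trig (latticeBox a b) 1) r torusMeasure ≤
        ENNReal.ofReal (C * N ^ (3 - 3 * (r⁻¹).toReal)) := by
  rcases eq_or_ne r ∞ with rfl | hr'
  · refine ⟨1, zero_le_one, fun N a b hN hab => ?_⟩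
    rw [eLpNorm_exponent_top]
    refine eLpNormEssSup_le_of_ae_bound (ae_of_all _ fun x => ?_)
    rw [trig_latticeBox, norm_prod]
    have : N ^ (3 - 3 * ((∞ : ℝ≥0∞)⁻¹).toReal) = ∏ _i : Fin 3, N := by
      simp only [ENNReal.inv_top, ENNReal.toReal_zero, mul_zero, sub_zero, Finset.prod_const,
        Finset.card_univ, Fintype.card_fin]
      exact_mod_cast Real.rpow_natCast N 3
    rw [one_mul, this]
    exact Finset.prod_le_prod (fun _ _ => norm_nonneg _) fun i _ =>
      (norm_dirichlet_le_card _ _ _).trans (hab i)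
  · obtain ⟨ρ, rfl⟩ : ∃ ρ : NNReal, r = ρ := ⟨r.toNNReal, (ENNReal.coe_toNNReal hr').symm⟩
    have hρ : 1 < (ρ : ℝ) := by exact_mod_cast hr
    have hρ0 : (ρ : ℝ) ≠ 0 := by positivity
    obtain ⟨C, hC, h⟩ := exists_integral_dirichlet_le hρ
    refine ⟨(C ^ 3) ^ (ρ : ℝ)⁻¹, by positivity, fun N a b hN hab => ?_⟩
    rw [(memLp_of_continuous (continuous_trig _ _) _).eLpNorm_eq_integral_rpow_norm
      (by rintro h0; simp [h0] at hr) hr']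
    refine ENNReal.ofReal_le_ofReal ?_
    have h1 : ∫ x, ‖trig (latticeBox a b) 1 x‖ ^ (ρ : ℝ) ∂torusMeasure =
        ∏ i, ∫ x, ‖dirichlet (a i) (b i) x‖ ^ (ρ : ℝ) ∂AddCircle.haarAddCircle := by
      rw [← integral_fintype_prod_eq_prod (𝕜 := ℝ)
        (fun i x => ‖dirichlet (a i) (b i) x‖ ^ (ρ : ℝ))]
      refine integral_congr_ae (ae_of_all _ fun x => ?_)
      simp only []
      rw [trig_latticeBox, norm_prod, Real.finsetProd_rpow _ _ fun i _ => norm_nonneg _]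
    have h2 : ∫ x, ‖trig (latticeBox a b) 1 x‖ ^ (ρ : ℝ) ∂torusMeasure ≤
        (C * N ^ ((ρ : ℝ) - 1)) ^ 3 := by
      rw [h1]
      refine (Finset.prod_le_prod (fun i _ => integral_nonneg fun x => by positivity)
        fun i _ => h N (a i) (b i) hN (hab i)).trans (le_of_eq ?_)
      simp
    have h3 : (C ^ 3) ^ (ρ : ℝ)⁻¹ * N ^ (3 - 3 * ((ρ : ℝ≥0∞)⁻¹).toReal) =
        ((C * N ^ ((ρ : ℝ) - 1)) ^ 3) ^ (ρ : ℝ)⁻¹ := by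
      rw [mul_pow, Real.mul_rpow (by positivity) (by positivity), ← Real.rpow_natCast (N ^ _),
        ← Real.rpow_mul hN.le, ← Real.rpow_mul hN.le, ENNReal.toReal_inv]
      congr 2
      simp only [ENNReal.coe_toReal]
      field_simp
      push_cast; ring
    rw [h3]
    exact Real.rpow_le_rpow (integral_nonneg fun x => by positivity) h2 (by positivity)

/-! ### Lattice boxes and the number of their points. -/

theorem mem_latticeBox {a b ξ : Freq} : ξ ∈ latticeBox a b ↔ ∀ i, a i ≤ ξ i ∧ ξ i ≤ b i := by
  simp [latticeBox]

theorem card_latticeBox_le {a b : Freq} {N : ℝ}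
    (h : ∀ i, ((Finset.Icc (a i) (b i)).card : ℝ) ≤ N) : ((latticeBox a b).card : ℝ) ≤ N ^ 3 := by
  rw [latticeBox, Fintype.card_piFinset]
  push_cast
  refine (Finset.prod_le_prod (fun _ _ => by positivity) fun i _ => h i).trans (le_of_eq ?_)
  simp

/-- A set of frequencies that is a box with sides of at most `N` points. -/
def IsLatticeBox (S : Set Freq) (N : ℝ) : Prop :=
  ∃ a b : Freq, S = ↑(latticeBox a b) ∧ ∀ i, ((Finset.Icc (a i) (b i)).card : ℝ) ≤ N

theorem IsLatticeBox.mono {S : Set Freq} {N N' : ℝ} (h : IsLatticeBox S N) (hN : N ≤ N') :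
    IsLatticeBox S N' := by
  obtain ⟨a, b, hS, hc⟩ := h
  exact ⟨a, b, hS, fun i => (hc i).trans hN⟩

theorem IsLatticeBox.neg {S : Set Freq} {N : ℝ} (h : IsLatticeBox S N) : IsLatticeBox (-S) N := by
  obtain ⟨a, b, rfl, hc⟩ := h
  refine ⟨-b, -a, ?_, fun i => ?_⟩
  · ext ξ
    simp only [Set.mem_neg, Finset.mem_coe, mem_latticeBox, Pi.neg_apply]
    exact forall_congr' fun i => by omega
  · convert hc i using 2
    simp only [Pi.neg_apply, Int.card_Icc]
    omega

/-- Integer intervals satisfy [a, b] + [a', b'] = [a + a', b + b'] when both are nonempty, and the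
sum has one point fewer than the two together. This makes the block C a box. -/
theorem IsLatticeBox.add {S S' : Set Freq} {N N' : ℝ} (h : IsLatticeBox S N)
    (h' : IsLatticeBox S' N') (hN : 0 ≤ N) (hN' : 0 ≤ N') : IsLatticeBox (S + S') (N + N') := by
  obtain ⟨a, b, rfl, hc⟩ := h
  obtain ⟨a', b', rfl, hc'⟩ := h'
  by_cases hne : ∀ i, a i ≤ b i ∧ a' i ≤ b' i
  · refine ⟨a + a', b + b', ?_, fun i => ?_⟩
    · ext ξ
      simp only [Set.mem_add, Finset.mem_coe, mem_latticeBox, Pi.add_apply]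
      constructor
      · rintro ⟨η, hη, ζ, hζ, rfl⟩ i
        have := hη i; have := hζ i
        simp only [Pi.add_apply]; omega
      · intro h
        -- The smallest admissible first summand: at least a, and large enough for the remainder to
        -- be at most b'.
        refine ⟨fun i => max (a i) (ξ i - b' i), fun i => ?_,
          fun i => ξ i - max (a i) (ξ i - b' i), fun i => ?_, ?_⟩
        · have := h i; have := hne i; dsimp only; omega
        · have := h i; have := hne i; dsimp only; omega
        · funext i; simp
    · refine le_trans ?_ (add_le_add (hc i) (hc' i))
      have := hne i
      rw [← Nat.cast_add, Nat.cast_le]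
      simp only [Pi.add_apply, Int.card_Icc]
      omega
  -- If one box is empty, so is the sum; the corners 0 and -1 describe the empty box.
  · refine ⟨0, -1, ?_, fun i => ?_⟩
    · have : (↑(latticeBox 0 (-1)) : Set Freq) = ∅ := by
        ext ξ
        simp only [Finset.mem_coe, mem_latticeBox, Set.mem_empty_iff_false, iff_false]
        intro h
        have := h 0
        simp at this; omega
      rw [this, Set.eq_empty_iff_forall_notMem]
      rintro ξ ⟨η, hη, ζ, hζ, -⟩
      refine hne fun i => ?_
      have h1 := mem_latticeBox.1 (Finset.mem_coe.1 hη) i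
      have h2 := mem_latticeBox.1 (Finset.mem_coe.1 hζ) i
      omega
    · simp; linarith

theorem card_Icc_ceil_floor_le {x y : ℝ} (hxy : x ≤ y) :
    ((Finset.Icc ⌈x⌉ ⌊y⌋).card : ℝ) ≤ y - x + 1 := by
  rw [Int.card_Icc]
  have h1 := Int.floor_le y
  have h2 := Int.le_ceil x
  rcases le_or_gt 0 (⌊y⌋ + 1 - ⌈x⌉) with h | h
  · have : (((⌊y⌋ + 1 - ⌈x⌉).toNat : ℤ) : ℝ) = ((⌊y⌋ + 1 - ⌈x⌉ : ℤ) : ℝ) := by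
      rw [Int.toNat_of_nonneg h]
    push_cast at this ⊢
    linarith
  · rw [Int.toNat_of_nonpos h.le]; simp; linarith

theorem le_card_Icc_ceil_floor (x y : ℝ) :
    y - x - 1 ≤ ((Finset.Icc ⌈x⌉ ⌊y⌋).card : ℝ) := by
  rw [Int.card_Icc]
  have h1 := Int.lt_floor_add_one y
  have h2 := Int.ceil_lt_add_one x
  have h3 : ((⌊y⌋ + 1 - ⌈x⌉ : ℤ) : ℝ) ≤ (((⌊y⌋ + 1 - ⌈x⌉).toNat : ℤ) : ℝ) := by
    exact_mod_cast Int.self_le_toNat _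
  push_cast at h3 ⊢
  linarith

/-- The lattice points in a box with real vertices. -/
noncomputable def realBox (x y : Fin 3 → ℝ) : Finset Freq :=
  latticeBox (fun i => ⌈x i⌉) fun i => ⌊y i⌋

theorem mem_realBox {x y : Fin 3 → ℝ} {ξ : Freq} :
    ξ ∈ realBox x y ↔ ∀ i, x i ≤ ξ i ∧ (ξ i : ℝ) ≤ y i := by
  simp only [realBox, mem_latticeBox, Int.ceil_le, Int.le_floor]

theorem isLatticeBox_realBox {x y : Fin 3 → ℝ} {N : ℝ} (h : ∀ i, x i ≤ y i)
    (hN : ∀ i, y i - x i + 1 ≤ N) : IsLatticeBox ↑(realBox x y) N :=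
  ⟨_, _, rfl, fun i => (card_Icc_ceil_floor_le (h i)).trans (hN i)⟩

theorem card_realBox_le {x y : Fin 3 → ℝ} {N : ℝ} (h : ∀ i, x i ≤ y i)
    (hN : ∀ i, y i - x i + 1 ≤ N) : ((realBox x y).card : ℝ) ≤ N ^ 3 :=
  card_latticeBox_le fun i => (card_Icc_ceil_floor_le (h i)).trans (hN i)

theorem le_card_realBox {x y : Fin 3 → ℝ} {N : ℝ} (hN0 : 0 ≤ N) (hN : ∀ i, N ≤ y i - x i - 1) :
    N ^ 3 ≤ ((realBox x y).card : ℝ) := by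
  rw [realBox, latticeBox, Fintype.card_piFinset]
  push_cast
  refine le_trans (le_of_eq ?_) (Finset.prod_le_prod (fun _ _ => hN0) fun i _ =>
    (hN i).trans (le_card_Icc_ceil_floor _ _))
  simp

noncomputable def boxA (L : ℝ) : Finset Freq :=
  realBox ![9 / 10 * L, -(1 / 10 * L), -(1 / 10 * L)] ![11 / 10 * L, 1 / 10 * L, 1 / 10 * L]

noncomputable def boxB (M : ℝ) : Finset Freq :=
  realBox ![-(1 / 10 * M), -(1 / 10 * M), 9 / 10 * M] ![1 / 10 * M, 1 / 10 * M, 11 / 10 * M]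

theorem blockA_eq (L : ℝ) : blockA L = ↑(boxA L) := by
  ext ξ
  simp [blockA, boxA, mem_realBox, Fin.forall_fin_succ]

theorem blockB_eq (M : ℝ) : blockB M = ↑(boxB M) := by
  ext ξ
  simp [blockB, boxB, mem_realBox, Fin.forall_fin_succ]

theorem isLatticeBox_blockA {L : ℝ} (hL : 0 ≤ L) : IsLatticeBox (blockA L) (L + 1) := by
  rw [blockA_eq]
  refine isLatticeBox_realBox (fun i => ?_) fun i => ?_ <;> fin_cases i <;> simp <;> linarith

theorem isLatticeBox_blockB {M : ℝ} (hM : 0 ≤ M) : IsLatticeBox (blockB M) (M + 1) := by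
  rw [blockB_eq]
  refine isLatticeBox_realBox (fun i => ?_) fun i => ?_ <;> fin_cases i <;> simp <;> linarith

theorem card_boxA_le {L : ℝ} (hL : 0 ≤ L) : ((boxA L).card : ℝ) ≤ (L + 1) ^ 3 := by
  refine card_realBox_le (fun i => ?_) fun i => ?_ <;> fin_cases i <;> simp <;> linarith

theorem card_boxB_le {M : ℝ} (hM : 0 ≤ M) : ((boxB M).card : ℝ) ≤ (M + 1) ^ 3 := by
  refine card_realBox_le (fun i => ?_) fun i => ?_ <;> fin_cases i <;> simp <;> linarith

/-- Each side has length L/5, and L ≥ 10 pays for the point lost to rounding. -/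
theorem le_card_boxA {L : ℝ} (hL : 10 ≤ L) : (L / 10) ^ 3 ≤ ((boxA L).card : ℝ) := by
  refine le_card_realBox (by positivity) fun i => ?_
  fin_cases i <;> simp <;> linarith

theorem le_card_boxB {M : ℝ} (hM : 10 ≤ M) : (M / 10) ^ 3 ≤ ((boxB M).card : ℝ) := by
  refine le_card_realBox (by positivity) fun i => ?_
  fin_cases i <;> simp <;> linarith

/-! ### Symmetry, size and support of one piece of the datum. -/

theorem wavenumber_pos (n : ℤ) : 0 < wavenumber n := zpow_pos two_pos n

theorem one_le_wavenumber (n : ℕ) : 1 ≤ wavenumber n := by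
  simpa [wavenumber] using one_le_pow₀ (M₀ := ℝ) one_le_two

theorem wavenumber_add_one (n : ℤ) : wavenumber (n + 1) = 2 * wavenumber n := by
  rw [wavenumber, zpow_add_one₀ two_ne_zero, mul_comm]; rfl

theorem wavenumber_sub_one (n : ℤ) : wavenumber (n - 1) = wavenumber n / 2 := by
  have := wavenumber_add_one (n - 1)
  rw [sub_add_cancel] at this; linarith

theorem wavenumber_le {m n : ℤ} (h : m ≤ n) : wavenumber m ≤ wavenumber n :=
  zpow_le_zpow_right₀ one_le_two h

theorem wavenumber_natCast (n : ℕ) : wavenumber n = (2 : ℝ) ^ n := by simp [wavenumber]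

theorem mem_blockC {L : ℝ} {ξ : Freq} (h : ξ ∈ blockA L + blockB (L / 2)) :
    ((ξ 0 : ℝ) ∈ Icc (17 / 20 * L) (23 / 20 * L)) ∧ ((ξ 1 : ℝ) ∈ Icc (-(3 / 20 * L)) (3 / 20 * L)) ∧
      ((ξ 2 : ℝ) ∈ Icc (7 / 20 * L) (13 / 20 * L)) := by
  obtain ⟨η, ⟨h1, h2, h3⟩, ζ, ⟨h4, h5, h6⟩, rfl⟩ := h
  simp only [mem_Icc, Pi.add_apply] at *
  push_cast
  refine ⟨⟨?_, ?_⟩, ⟨?_, ?_⟩, ?_, ?_⟩ <;> linarith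

theorem ind_of_mem {S : Set Freq} {ξ : Freq} (h : ξ ∈ S) : ind S ξ = 1 := by simp [ind, h]

theorem ind_of_notMem {S : Set Freq} {ξ : Freq} (h : ξ ∉ S) : ind S ξ = 0 := by simp [ind, h]

theorem norm_ind_le (S : Set Freq) (ξ : Freq) : ‖ind S ξ‖ ≤ 1 := by
  by_cases h : ξ ∈ S
  · simp [ind_of_mem h]
  · simp [ind_of_notMem h]

theorem ind_neg (S : Set Freq) (ξ : Freq) : ind S (-ξ) = ind (-S) ξ := by
  by_cases h : -ξ ∈ S
  · rw [ind_of_mem h, ind_of_mem (Set.mem_neg.2 h)]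
  · rw [ind_of_notMem h, ind_of_notMem fun h' => h (Set.mem_neg.1 h')]

theorem conj_ind (S : Set Freq) (ξ : Freq) : (starRingEnd ℂ) (ind S ξ) = ind S ξ := by
  by_cases h : ξ ∈ S
  · simp [ind_of_mem h]
  · simp [ind_of_notMem h]

theorem freqNorm_sq (ξ : Freq) : freqNorm ξ ^ 2 = ∑ i, (ξ i : ℝ) ^ 2 :=
  Real.sq_sqrt (Finset.sum_nonneg fun _ _ => sq_nonneg _)

theorem freqNorm_nonneg (ξ : Freq) : 0 ≤ freqNorm ξ := Real.sqrt_nonneg _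

theorem freqNorm_neg (ξ : Freq) : freqNorm (-ξ) = freqNorm ξ := by simp [freqNorm]

theorem abs_le_freqNorm (ξ : Freq) (i : Fin 3) : |(ξ i : ℝ)| ≤ freqNorm ξ := by
  refine Real.abs_le_sqrt ?_
  exact Finset.single_le_sum (f := fun i => (ξ i : ℝ) ^ 2) (fun _ _ => sq_nonneg _) (Finset.mem_univ i)

theorem freqNorm_le_of_abs_le {ξ : Freq} {R : ℝ} (h : ∀ i, |(ξ i : ℝ)| ≤ R) :
    freqNorm ξ ≤ Real.sqrt 3 * R := by
  have hR : 0 ≤ R := (abs_nonneg _).trans (h 0)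
  rw [freqNorm]
  refine Real.sqrt_le_iff.2 ⟨by positivity, ?_⟩
  rw [mul_pow, Real.sq_sqrt (by norm_num)]
  have : ∀ i, (ξ i : ℝ) ^ 2 ≤ R ^ 2 := fun i => sq_le_sq' (abs_le.1 (h i)).1 (abs_le.1 (h i)).2
  refine (Finset.sum_le_sum fun i _ => this i).trans (le_of_eq ?_)
  simp

theorem freqNorm_pos {ξ : Freq} (h : ξ ≠ 0) : 0 < freqNorm ξ := by
  refine lt_of_le_of_ne (freqNorm_nonneg ξ) fun h0 => h ?_
  funext i
  have := abs_le_freqNorm ξ i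
  rw [← h0] at this
  simpa using this

theorem lerayVec_neg (k : Fin 3) (ξ : Freq) : lerayVec k (-ξ) = lerayVec k ξ := by
  ext i; simp [lerayVec, freqNorm_neg]

theorem norm_lerayVec_le (k i : Fin 3) (ξ : Freq) : ‖lerayVec k ξ i‖ ≤ 2 := by
  simp only [lerayVec]
  rw [Complex.norm_real, Real.norm_eq_abs]
  have h1 : |(if i = k then 1 else 0 : ℝ)| ≤ 1 := by split_ifs <;> simp
  have h2 : |(ξ i : ℝ) * ξ k / freqNorm ξ ^ 2| ≤ 1 := by
    rw [abs_div, abs_mul, abs_of_nonneg (sq_nonneg (freqNorm ξ))]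
    refine div_le_one_of_le₀ ?_ (sq_nonneg _)
    rw [sq]
    exact mul_le_mul (abs_le_freqNorm _ _) (abs_le_freqNorm _ _) (abs_nonneg _) (freqNorm_nonneg _)
  exact (abs_sub _ _).trans (by linarith)

theorem conj_lerayVec (k i : Fin 3) (ξ : Freq) :
    (starRingEnd ℂ) (lerayVec k ξ i) = lerayVec k ξ i := by
  simp only [lerayVec, Complex.conj_ofReal]

theorem sum_mul_lerayVec (k : Fin 3) (ξ : Freq) : ∑ i, (ξ i : ℂ) * lerayVec k ξ i = 0 := by
  by_cases h : ξ = 0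
  · simp [h]
  · have h0 : freqNorm ξ ^ 2 ≠ 0 := (pow_pos (freqNorm_pos h) 2).ne'
    have h1 : (∑ i, (ξ i : ℝ) * ((if i = k then 1 else 0) - (ξ i : ℝ) * (ξ k : ℝ) / freqNorm ξ ^ 2)) = 0 := by
      have h3 : ∀ i, (ξ i : ℝ) * ((if i = k then 1 else 0) - (ξ i : ℝ) * (ξ k : ℝ) / freqNorm ξ ^ 2) =
          (if i = k then (ξ i : ℝ) else 0) - (ξ i : ℝ) ^ 2 * (ξ k / freqNorm ξ ^ 2) := by
        intro i; split_ifs <;> ring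
      simp only [h3]
      rw [Finset.sum_sub_distrib, ← Finset.sum_mul, ← freqNorm_sq]
      simp only [Finset.sum_ite_eq', Finset.mem_univ, if_true]
      rw [mul_div_cancel₀ _ h0, sub_self]
    have := congrArg (fun x : ℝ => (x : ℂ)) h1
    simp only [lerayVec]
    push_cast at this ⊢
    exact this

theorem pieceCoeff_apply (α : ℝ) (n : ℕ) (ξ : Freq) (i : Fin 3) :
    pieceCoeff α n ξ i = ((wavenumber n ^ (2 * α - 4) : ℝ) : ℂ) *
      (ind (blockA (wavenumber n) ∪ -blockA (wavenumber n)) ξ * lerayVec 1 ξ i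
        + (Complex.I * ind (blockA (wavenumber n) + blockB (wavenumber n / 2)) ξ) *
            (lerayVec 1 ξ i - lerayVec 0 ξ i)
        - (Complex.I * ind (-(blockA (wavenumber n) + blockB (wavenumber n / 2))) ξ) *
            (lerayVec 1 ξ i - lerayVec 0 ξ i)
        + ind (blockB (wavenumber n / 2) ∪ -blockB (wavenumber n / 2)) ξ * lerayVec 0 ξ i) := by
  simp [pieceCoeff, wavenumber_sub_one]
  ring

theorem pieceCoeff_eq_zero_or (α : ℝ) (n : ℕ) (ξ : Freq) :
    pieceCoeff α n ξ = 0 ∨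
      ξ ∈ blockA (wavenumber n) ∨ -ξ ∈ blockA (wavenumber n) ∨
      ξ ∈ blockB (wavenumber n / 2) ∨ -ξ ∈ blockB (wavenumber n / 2) ∨
      ξ ∈ blockA (wavenumber n) + blockB (wavenumber n / 2) ∨
      -ξ ∈ blockA (wavenumber n) + blockB (wavenumber n / 2) := by
  by_contra h
  push Not at h
  obtain ⟨h0, h1, h2, h3, h4, h5, h6⟩ := h
  refine h0 (PiLp.ext fun i => ?_)
  rw [pieceCoeff_apply, ind_of_notMem, ind_of_notMem h5, ind_of_notMem, ind_of_notMem]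
  · simp
  · rintro (h | h)
    exacts [h3 h, h4 (Set.mem_neg.1 h)]
  · exact fun h => h6 (Set.mem_neg.1 h)
  · rintro (h | h)
    exacts [h1 h, h2 (Set.mem_neg.1 h)]

/-- The extreme values are 23/20 = 11/10 + 1/20, the first coordinate in C, and 9/20 = (9/10)/2, the
third coordinate in B. -/
theorem pieceCoeff_support {α : ℝ} {n : ℕ} {ξ : Freq} (h : pieceCoeff α n ξ ≠ 0) :
    (∀ i, |(ξ i : ℝ)| ≤ 23 / 20 * wavenumber n) ∧
      (9 / 20 * wavenumber n ≤ |(ξ 0 : ℝ)| ∨ 9 / 20 * wavenumber n ≤ |(ξ 2 : ℝ)|) := by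
  have hL := wavenumber_pos n
  set L := wavenumber n
  have habs : ∀ η : Freq, (η ∈ blockA L ∨ η ∈ blockB (L / 2) ∨ η ∈ blockA L + blockB (L / 2)) →
      (∀ i, |(η i : ℝ)| ≤ 23 / 20 * L) ∧
      (9 / 20 * L ≤ |(η 0 : ℝ)| ∨ 9 / 20 * L ≤ |(η 2 : ℝ)|) := by
    rintro η (h | h | h)
    · obtain ⟨⟨h1, h2⟩, ⟨h3, h4⟩, h5, h6⟩ := h
      refine ⟨fun i => abs_le.2 ?_, Or.inl (le_trans ?_ (le_abs_self _))⟩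
      · fin_cases i <;> simp <;> constructor <;> linarith
      · linarith
    · obtain ⟨⟨h1, h2⟩, ⟨h3, h4⟩, h5, h6⟩ := h
      refine ⟨fun i => abs_le.2 ?_, Or.inr (le_trans ?_ (le_abs_self _))⟩
      · fin_cases i <;> simp <;> constructor <;> linarith
      · linarith
    · obtain ⟨⟨h1, h2⟩, ⟨h3, h4⟩, h5, h6⟩ := mem_blockC h
      refine ⟨fun i => abs_le.2 ?_, Or.inl (le_trans ?_ (le_abs_self _))⟩
      · fin_cases i <;> simp <;> constructor <;> linarith
      · linarith
  have hneg : ∀ i, |((-ξ) i : ℝ)| = |(ξ i : ℝ)| := fun i => by simp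
  rcases pieceCoeff_eq_zero_or α n ξ with h0 | h1 | h1 | h1 | h1 | h1 | h1
  · exact absurd h0 h
  · exact habs ξ (Or.inl h1)
  · simpa only [hneg, Pi.neg_apply, Int.cast_neg, abs_neg] using habs (-ξ) (Or.inl h1)
  · exact habs ξ (Or.inr (Or.inl h1))
  · simpa only [hneg, Pi.neg_apply, Int.cast_neg, abs_neg] using habs (-ξ) (Or.inr (Or.inl h1))
  · exact habs ξ (Or.inr (Or.inr h1))
  · simpa only [hneg, Pi.neg_apply, Int.cast_neg, abs_neg] using habs (-ξ) (Or.inr (Or.inr h1))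

theorem pieceCoeff_freqNorm {α : ℝ} {n : ℕ} {ξ : Freq} (h : pieceCoeff α n ξ ≠ 0) :
    9 / 20 * wavenumber n ≤ freqNorm ξ ∧ freqNorm ξ ≤ 2 * wavenumber n := by
  obtain ⟨h1, h2⟩ := pieceCoeff_support h
  refine ⟨?_, (freqNorm_le_of_abs_le h1).trans ?_⟩
  · rcases h2 with h2 | h2
    · exact h2.trans (abs_le_freqNorm _ _)
    · exact h2.trans (abs_le_freqNorm _ _)
  -- The fraction is 2 divided by 23/20, so the bound becomes 2 L.
  · have h3 : Real.sqrt 3 ≤ 40 / 23 := Real.sqrt_le_iff.2 ⟨by norm_num, by norm_num⟩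
    have hL := wavenumber_pos n
    nlinarith

/-- A box that contains the support of the `n`-th piece of the datum. -/
noncomputable def pieceBox (n : ℕ) : Finset Freq :=
  realBox (fun _ => -(23 / 20 * wavenumber n)) fun _ => 23 / 20 * wavenumber n

theorem mem_pieceBox {α : ℝ} {n : ℕ} {ξ : Freq} (h : pieceCoeff α n ξ ≠ 0) : ξ ∈ pieceBox n :=
  mem_realBox.2 fun i => abs_le.1 ((pieceCoeff_support h).1 i)

theorem card_pieceBox_le (n : ℕ) : ((pieceBox n).card : ℝ) ≤ 64 * wavenumber n ^ 3 := by
  have h := one_le_wavenumber n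
  refine (card_realBox_le (N := 4 * wavenumber n) (fun i => ?_) fun i => ?_).trans (le_of_eq ?_)
  · linarith
  · linarith
  · ring

theorem norm_pieceCoeff_le (α : ℝ) (n : ℕ) (ξ : Freq) (i : Fin 3) :
    ‖pieceCoeff α n ξ i‖ ≤ 12 * wavenumber n ^ (2 * α - 4) := by
  have hL := wavenumber_pos n
  rw [pieceCoeff_apply, norm_mul, Complex.norm_real, Real.norm_of_nonneg (by positivity), mul_comm]
  refine mul_le_mul_of_nonneg_right ?_ (by positivity)
  have h1 := norm_lerayVec_le 1 i ξ
  have h0 := norm_lerayVec_le 0 i ξ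
  have h10 : ‖lerayVec 1 ξ i - lerayVec 0 ξ i‖ ≤ 4 := (norm_sub_le _ _).trans (by linarith)
  have hm : ∀ (S : Set Freq) (z : ℂ) (R : ℝ), ‖z‖ ≤ R → ‖ind S ξ * z‖ ≤ R := fun S z R hz => by
    rw [norm_mul]
    exact (mul_le_of_le_one_left (norm_nonneg _) (norm_ind_le S ξ)).trans hz
  have hI : ∀ (S : Set Freq) (z : ℂ) (R : ℝ), ‖z‖ ≤ R → ‖Complex.I * ind S ξ * z‖ ≤ R :=
    fun S z R hz => by
      rw [mul_assoc, norm_mul, Complex.norm_I, one_mul]; exact hm S z R hz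
  refine (norm_add_le _ _).trans ?_
  refine (add_le_add ((norm_sub_le _ _).trans (add_le_add ((norm_add_le _ _).trans
    (add_le_add (hm _ _ 2 h1) (hI _ _ 4 h10))) (hI _ _ 4 h10))) (hm _ _ 2 h0)).trans (by norm_num)

theorem pieceCoeff_neg (α : ℝ) (n : ℕ) (ξ : Freq) (i : Fin 3) :
    pieceCoeff α n (-ξ) i = (starRingEnd ℂ) (pieceCoeff α n ξ i) := by
  have hU : ∀ S : Set Freq, -(S ∪ -S) = S ∪ -S := fun S => by
    rw [Set.union_neg, neg_neg, Set.union_comm]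
  rw [pieceCoeff_apply, pieceCoeff_apply]
  simp only [lerayVec_neg, ind_neg, hU, neg_neg, map_mul, map_add, map_sub, conj_ind,
    conj_lerayVec, Complex.conj_ofReal, Complex.conj_I]
  ring

theorem sum_mul_pieceCoeff (α : ℝ) (n : ℕ) (ξ : Freq) :
    ∑ i, (ξ i : ℂ) * pieceCoeff α n ξ i = 0 := by
  have h0 := sum_mul_lerayVec 0 ξ
  have h1 := sum_mul_lerayVec 1 ξ
  simp only [pieceCoeff_apply, Fin.sum_univ_three] at *
  linear_combination ((wavenumber n ^ (2 * α - 4) : ℝ) : ℂ) *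
      (ind (blockA (wavenumber n) ∪ -blockA (wavenumber n)) ξ
        + (Complex.I * ind (blockA (wavenumber n) + blockB (wavenumber n / 2)) ξ)
        - (Complex.I * ind (-(blockA (wavenumber n) + blockB (wavenumber n / 2))) ξ)) * h1 +
      ((wavenumber n ^ (2 * α - 4) : ℝ) : ℂ) *
      (ind (blockB (wavenumber n / 2) ∪ -blockB (wavenumber n / 2)) ξ
        - (Complex.I * ind (blockA (wavenumber n) + blockB (wavenumber n / 2)) ξ)
        + (Complex.I * ind (-(blockA (wavenumber n) + blockB (wavenumber n / 2))) ξ)) * h0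

/-- The third coordinate separates the blocks: its absolute value is at most L/10 on A and at least
7L/20 on B, C and their reflections. -/
theorem pieceCoeff_of_mem_blockA {α : ℝ} {n : ℕ} {ξ : Freq}
    (h : ξ ∈ blockA (wavenumber n)) (i : Fin 3) :
    pieceCoeff α n ξ i = ((wavenumber n ^ (2 * α - 4) : ℝ) : ℂ) * lerayVec 1 ξ i := by
  have hL := wavenumber_pos n
  have h' := h
  obtain ⟨⟨h1, h2⟩, ⟨h3, h4⟩, h5, h6⟩ := h'
  rw [pieceCoeff_apply, ind_of_mem (Or.inl h), ind_of_notMem, ind_of_notMem, ind_of_notMem]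
  · simp
  · rintro (⟨-, -, h7, h8⟩ | ⟨-, -, h7, h8⟩)
    · linarith
    · simp only [Pi.neg_apply, Int.cast_neg] at h7 h8; linarith
  · intro h'
    obtain ⟨-, -, h7, h8⟩ := mem_blockC (Set.mem_neg.1 h')
    simp only [Pi.neg_apply, Int.cast_neg] at h7 h8; linarith
  · intro h'
    obtain ⟨-, -, h7, h8⟩ := mem_blockC h'
    linarith

/-- Here the first coordinate separates: at most L/20 in absolute value on B, at least 17L/20 on A,
C and their reflections. -/
theorem pieceCoeff_of_mem_blockB {α : ℝ} {n : ℕ} {ξ : Freq}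
    (h : ξ ∈ blockB (wavenumber n / 2)) (i : Fin 3) :
    pieceCoeff α n ξ i = ((wavenumber n ^ (2 * α - 4) : ℝ) : ℂ) * lerayVec 0 ξ i := by
  have hL := wavenumber_pos n
  have h' := h
  obtain ⟨⟨h1, h2⟩, ⟨h3, h4⟩, h5, h6⟩ := h'
  rw [pieceCoeff_apply, ind_of_notMem, ind_of_notMem, ind_of_notMem, ind_of_mem (Or.inl h)]
  · simp
  · intro h'
    obtain ⟨⟨h7, h8⟩, -, -⟩ := mem_blockC (Set.mem_neg.1 h')
    simp only [Pi.neg_apply, Int.cast_neg] at h7 h8; linarith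
  · intro h'
    obtain ⟨⟨h7, h8⟩, -, -⟩ := mem_blockC h'
    linarith
  · rintro (⟨⟨h7, h8⟩, -, -⟩ | ⟨⟨h7, h8⟩, -, -⟩)
    · linarith
    · simp only [Pi.neg_apply, Int.cast_neg] at h7 h8; linarith

theorem pieceCoeff_of_neg_mem_blockA {α : ℝ} {n : ℕ} {ξ : Freq}
    (h : -ξ ∈ blockA (wavenumber n)) (i : Fin 3) :
    pieceCoeff α n ξ i = ((wavenumber n ^ (2 * α - 4) : ℝ) : ℂ) * lerayVec 1 ξ i := by
  rw [← neg_neg ξ, pieceCoeff_neg, pieceCoeff_of_mem_blockA h, map_mul, conj_lerayVec,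
    Complex.conj_ofReal, neg_neg, lerayVec_neg]

theorem pieceCoeff_of_neg_mem_blockB {α : ℝ} {n : ℕ} {ξ : Freq}
    (h : -ξ ∈ blockB (wavenumber n / 2)) (i : Fin 3) :
    pieceCoeff α n ξ i = ((wavenumber n ^ (2 * α - 4) : ℝ) : ℂ) * lerayVec 0 ξ i := by
  rw [← neg_neg ξ, pieceCoeff_neg, pieceCoeff_of_mem_blockB h, map_mul, conj_lerayVec,
    Complex.conj_ofReal, neg_neg, lerayVec_neg]

/-! ### The datum -/

/-- The frequencies of a piece are comparable to its wavenumber, and q j ≥ j for a strictly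
increasing sequence. So the series of the datum is locally finite. -/
theorem finite_setOf_pieceCoeff_ne_zero (α : ℝ) {q : ℕ → ℕ} (hq : StrictMono q) (ξ : Freq) :
    {j | pieceCoeff α (q j) ξ ≠ 0}.Finite := by
  obtain ⟨N, hN⟩ := pow_unbounded_of_one_lt (3 * freqNorm ξ) one_lt_two
  refine (Set.finite_lt_nat N).subset fun j hj => ?_
  by_contra hjN
  have h1 := (pieceCoeff_freqNorm hj).1
  have h2 : (2 : ℝ) ^ N ≤ wavenumber (q j) := by
    rw [wavenumber_natCast]
    exact pow_le_pow_right₀ one_le_two ((not_lt.1 hjN).trans hq.le_apply)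
  have := freqNorm_nonneg ξ
  linarith

theorem hasSum_pieceCoeff (α : ℝ) {q : ℕ → ℕ} (hq : StrictMono q) (ξ : Freq) :
    HasSum (fun j => pieceCoeff α (q j) ξ) (datumCoeff α q ξ) :=
  (summable_of_hasFiniteSupport (finite_setOf_pieceCoeff_ne_zero α hq ξ)).hasSum

theorem hasSum_pieceCoeff_apply (α : ℝ) {q : ℕ → ℕ} (hq : StrictMono q) (ξ : Freq) (i : Fin 3) :
    HasSum (fun j => pieceCoeff α (q j) ξ i) (datumCoeff α q ξ i) := by
  simpa only [PiLp.proj_apply] using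
    (EuclideanSpace.proj i : C3 →L[ℂ] ℂ).hasSum (hasSum_pieceCoeff α hq ξ)

theorem datumCoeff_neg (α : ℝ) {q : ℕ → ℕ} (hq : StrictMono q) (ξ : Freq) (i : Fin 3) :
    datumCoeff α q (-ξ) i = (starRingEnd ℂ) (datumCoeff α q ξ i) := by
  refine (hasSum_pieceCoeff_apply α hq (-ξ) i).unique ?_
  simp only [pieceCoeff_neg]
  exact (Complex.conjCLE.toContinuousLinearMap).hasSum (hasSum_pieceCoeff_apply α hq ξ i)

theorem sum_mul_datumCoeff (α : ℝ) {q : ℕ → ℕ} (hq : StrictMono q) (ξ : Freq) :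
    ∑ i, (ξ i : ℂ) * datumCoeff α q ξ i = 0 := by
  have h : HasSum (fun j => ∑ i, (ξ i : ℂ) * pieceCoeff α (q j) ξ i)
      (∑ i, (ξ i : ℂ) * datumCoeff α q ξ i) :=
    hasSum_sum fun i _ => (hasSum_pieceCoeff_apply α hq ξ i).mul_left _
  simp only [sum_mul_pieceCoeff] at h
  exact h.unique hasSum_zero

theorem norm_trigLp_two (s : Finset Freq) (c : Freq → ℂ) :
    ‖trigLp 2 s c‖ ^ 2 = ∑ ξ ∈ s, ‖c ξ‖ ^ 2 := by
  rw [← integral_sq_trig, norm_trigLp,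
    (memLp_of_continuous (continuous_trig s c) 2).eLpNorm_eq_integral_rpow_norm two_ne_zero
      ENNReal.ofNat_ne_top, ENNReal.toReal_ofReal (by positivity)]
  simp only [ENNReal.toReal_ofNat, Real.rpow_ofNat]
  rw [← Real.rpow_natCast, ← Real.rpow_mul (by positivity)]
  norm_num

/-- There are O(L³) coefficients of size O(L^(2α-4)); the exponent is -4 + 3/2 = -5/2 beside 2α. -/
theorem norm_trigLp_pieceCoeff_le (α : ℝ) (n : ℕ) (i : Fin 3) :
    ‖trigLp 2 (pieceBox n) fun ξ => pieceCoeff α n ξ i‖ ≤ 96 * wavenumber n ^ (2 * α - 5 / 2) := by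
  have hL := wavenumber_pos n
  refine le_of_sq_le_sq ?_ (by positivity)
  rw [norm_trigLp_two]
  refine (Finset.sum_le_card_nsmul _ _ ((12 * wavenumber n ^ (2 * α - 4)) ^ 2) fun ξ _ =>
    pow_le_pow_left₀ (norm_nonneg _) (norm_pieceCoeff_le α n ξ i) 2).trans ?_
  rw [nsmul_eq_mul]
  refine (mul_le_mul_of_nonneg_right (card_pieceBox_le n) (by positivity)).trans (le_of_eq ?_)
  have h1 : wavenumber n ^ (2 * α - 5 / 2) =
      wavenumber n ^ (2 * α - 4) * wavenumber n ^ (3 / 2 : ℝ) := by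
    rw [← Real.rpow_add hL]; congr 1; ring
  have h2 : (wavenumber n ^ (3 / 2 : ℝ)) ^ 2 = wavenumber n ^ 3 := by
    rw [← Real.rpow_natCast, ← Real.rpow_natCast, ← Real.rpow_mul hL.le]; norm_num
  rw [h1, mul_pow, mul_pow, mul_pow, h2]
  ring

theorem wavenumber_rpow (n : ℕ) (s : ℝ) : wavenumber n ^ s = ((2 : ℝ) ^ s) ^ n := by
  rw [wavenumber_natCast, ← Real.rpow_natCast, ← Real.rpow_natCast, ← Real.rpow_mul two_pos.le,
    ← Real.rpow_mul two_pos.le, mul_comm]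

/-- The L² norms of the pieces are dominated by a geometric series because 2α - 5/2 < 0. The
coefficients of the limit are read off by continuity of the inner product with a character. -/
theorem exists_memLp_datum {α : ℝ} (hα : α < 5 / 4) {q : ℕ → ℕ} (hq : StrictMono q) (i : Fin 3) :
    ∃ F : T3 → ℂ, MemLp F 2 torusMeasure ∧
      ∀ ξ, UnitAddTorus.mFourierCoeff F ξ = datumCoeff α q ξ i := by
  have hs : Summable fun j => trigLp 2 (pieceBox (q j)) fun ξ => pieceCoeff α (q j) ξ i := by
    have h1 : (2 : ℝ) ^ (2 * α - 5 / 2) < 1 :=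
      Real.rpow_lt_one_of_one_lt_of_neg one_lt_two (by linarith)
    have h0 : 0 ≤ (2 : ℝ) ^ (2 * α - 5 / 2) := by positivity
    refine Summable.of_norm_bounded ((summable_geometric_of_lt_one h0 h1).mul_left 96) fun j => ?_
    refine (norm_trigLp_pieceCoeff_le α (q j) i).trans ?_
    rw [wavenumber_rpow]
    exact mul_le_mul_of_nonneg_left (pow_le_pow_of_le_one h0 h1.le hq.le_apply) (by norm_num)
  refine ⟨_, Lp.memLp (∑' j, trigLp 2 (pieceBox (q j)) fun ξ => pieceCoeff α (q j) ξ i),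
    fun ξ => ?_⟩
  have h2 : HasSum (fun j => inner ℂ (UnitAddTorus.mFourierBasis ξ)
      (trigLp 2 (pieceBox (q j)) fun ξ => pieceCoeff α (q j) ξ i)) _ :=
    (innerSL ℂ (UnitAddTorus.mFourierBasis ξ)).hasSum hs.hasSum
  have h3 : ∀ G : Lp ℂ 2 torusMeasure, inner ℂ (UnitAddTorus.mFourierBasis ξ) G =
      UnitAddTorus.mFourierCoeff G ξ := fun G => by
    rw [← UnitAddTorus.mFourierBasis_repr, HilbertBasis.repr_apply_apply]
  have h4 : ∀ j, inner ℂ (UnitAddTorus.mFourierBasis ξ)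
      (trigLp 2 (pieceBox (q j)) fun ξ => pieceCoeff α (q j) ξ i) = pieceCoeff α (q j) ξ i := by
    intro j
    rw [h3, trigLp, mFourierCoeff_congr_ae (MemLp.coeFn_toLp _), mFourierCoeff_trig]
    split_ifs with h
    · rfl
    · by_contra hne
      refine h (mem_pieceBox (α := α) fun h0 => hne ?_)
      rw [h0]; rfl
  simp only [h4] at h2
  rw [← h3]
  exact h2.unique (hasSum_pieceCoeff_apply α hq ξ i)

/-- The `i`-th component of a vector field, as a complex function. -/
def comp (f : T3 → R3) (i : Fin 3) (x : T3) : ℂ := ((f x i : ℝ) : ℂ)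

theorem coeff_apply (f : T3 → R3) (ξ : Freq) (i : Fin 3) :
    coeff f ξ i = UnitAddTorus.mFourierCoeff (comp f i) ξ := rfl

theorem memLp_comp {f : T3 → R3} (hf : MemLp f 2 torusMeasure) (i : Fin 3) :
    MemLp (comp f i) 2 torusMeasure :=
  (Complex.ofRealCLM.comp
    (EuclideanSpace.proj i : R3 →L[ℝ] ℝ)).comp_memLp' hf

theorem mFourierCoeff_conj (f : T3 → ℂ) (ξ : Freq) :
    UnitAddTorus.mFourierCoeff (fun x => (starRingEnd ℂ) (f x)) ξ =
      (starRingEnd ℂ) (UnitAddTorus.mFourierCoeff f (-ξ)) := by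
  unfold UnitAddTorus.mFourierCoeff
  rw [← integral_conj]
  refine integral_congr_ae (ae_of_all _ fun x => ?_)
  simp [UnitAddTorus.mFourier_neg]

theorem coeff_congr_ae {f g : T3 → R3} (h : f =ᵐ[torusMeasure] g) : coeff f = coeff g := by
  funext ξ
  ext i
  refine mFourierCoeff_congr_ae ?_ ξ
  filter_upwards [h] with x hx
  rw [hx]

/-- Taking the real part replaces the coefficient c(ξ) by the mean of c(ξ) and the conjugate of
c(-ξ), which is c(ξ) again by `datumCoeff_neg`. -/
theorem exists_datum {α : ℝ} (hα : α < 5 / 4) {q : ℕ → ℕ} (hq : StrictMono q) :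
    ∃ U : L2Field, ∀ ξ, coeff U ξ = datumCoeff α q ξ := by
  choose F hF hc using fun i => exists_memLp_datum hα hq (q := q) i
  have hmem : MemLp (fun x => (WithLp.toLp 2 fun i => (F i x).re : R3)) 2 torusMeasure := by
    have : (fun x => (WithLp.toLp 2 fun i => (F i x).re : R3)) =
        fun x => ∑ i, (F i x).re • EuclideanSpace.single i (1 : ℝ) := by
      funext x
      ext j
      simp [Finset.sum_apply, Pi.single_apply]
    rw [this]
    exact memLp_finsetSum _ fun i _ => (Complex.reCLM.smulRight
      (EuclideanSpace.single i (1 : ℝ))).comp_memLp' (hF i)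
  refine ⟨hmem.toLp _, fun ξ => ?_⟩
  rw [coeff_congr_ae hmem.coeFn_toLp]
  ext i
  rw [coeff_apply]
  have h1 : comp (fun x => (WithLp.toLp 2 fun i => (F i x).re : R3)) i =
      fun x => (1 / 2 : ℂ) * (F i x + (starRingEnd ℂ) (F i x)) := by
    funext x
    simp [comp, Complex.add_conj]
  have hint := (hF i).integrable one_le_two
  have h2 : UnitAddTorus.mFourierCoeff (fun x => F i x + (starRingEnd ℂ) (F i x)) ξ =
      UnitAddTorus.mFourierCoeff (F i) ξ +
        UnitAddTorus.mFourierCoeff (fun x => (starRingEnd ℂ) (F i x)) ξ :=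
    mFourierCoeff_add hint ((Complex.conjCLE.toContinuousLinearMap).integrable_comp hint) ξ
  rw [h1, mFourierCoeff_const_mul, h2, mFourierCoeff_conj, hc, hc, datumCoeff_neg α hq,
    Complex.conj_conj]
  ring

/-! ### Littlewood-Paley projections -/

theorem shellSymbol_eq_zero_of_ge {χ : ℝ → ℝ} (hχ : IsCutoff χ) {q : ℕ} {ξ : Freq}
    (h : wavenumber (q + 1) ≤ freqNorm ξ) : shellSymbol χ q ξ = 0 := by
  have hpos := wavenumber_pos q
  rw [wavenumber_add_one] at h
  unfold shellSymbol
  split_ifs with hq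
  · subst hq
    refine hχ.eq_zero _ ?_
    have : wavenumber ((0 : ℕ) : ℤ) = 1 := by simp [wavenumber]
    rw [this] at h
    linarith
  · rw [wavenumber_add_one, hχ.eq_zero, hχ.eq_zero, sub_zero]
    · rw [ge_iff_le, le_div_iff₀ hpos]; linarith
    · rw [ge_iff_le, le_div_iff₀ (by linarith)]; linarith

theorem shellSymbol_eq_zero_of_le {χ : ℝ → ℝ} (hχ : IsCutoff χ) {q : ℕ} (hq : q ≠ 0) {ξ : Freq}
    (h : freqNorm ξ ≤ wavenumber q / 2) : shellSymbol χ q ξ = 0 := by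
  have hpos := wavenumber_pos q
  rw [shellSymbol, if_neg hq, wavenumber_add_one, hχ.eq_one, hχ.eq_one, sub_self]
  · rw [div_le_iff₀ hpos]; linarith
  · rw [div_le_iff₀ (by linarith)]; linarith

theorem lpProj_apply (χ : ℝ → ℝ) (q : ℕ) (f : T3 → R3) {s : Finset Freq}
    (hs : ∀ ξ, shellSymbol χ q ξ ≠ 0 → ξ ∈ s) (x : T3) (i : Fin 3) :
    lpProj χ q f x i = trig s (fun ξ => shellSymbol χ q ξ * coeff f ξ i) x := by
  rw [lpProj, tsum_eq_sum (s := s)]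
  · rw [WithLp.ofLp_sum, Finset.sum_apply]
    refine Finset.sum_congr rfl fun ξ _ => ?_
    simp only [PiLp.smul_apply, smul_eq_mul]
    ring
  · intro ξ hξ
    have : shellSymbol χ q ξ = 0 := by_contra fun h => hξ (hs ξ h)
    simp [this]

/-- The lattice points of a cube. -/
noncomputable def cube (R : ℝ) : Finset Freq := realBox (fun _ => -R) fun _ => R

theorem mem_cube {R : ℝ} {ξ : Freq} : ξ ∈ cube R ↔ ∀ i, |(ξ i : ℝ)| ≤ R := by
  simp [cube, mem_realBox, abs_le]

theorem mem_cube_of_freqNorm_le {R : ℝ} {ξ : Freq} (h : freqNorm ξ ≤ R) : ξ ∈ cube R :=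
  mem_cube.2 fun i => (abs_le_freqNorm ξ i).trans h

theorem mem_cube_of_shellSymbol_ne_zero {χ : ℝ → ℝ} (hχ : IsCutoff χ) {q : ℕ} {ξ : Freq} {R : ℝ}
    (hR : wavenumber (q + 1) ≤ R) (h : shellSymbol χ q ξ ≠ 0) : ξ ∈ cube R := by
  refine mem_cube_of_freqNorm_le (le_trans ?_ hR)
  by_contra hlt
  exact h (shellSymbol_eq_zero_of_ge hχ (not_le.1 hlt).le)

theorem continuous_lpProj {χ : ℝ → ℝ} (hχ : IsCutoff χ) (q : ℕ) (f : T3 → R3) :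
    Continuous (lpProj χ q f) := by
  have h : ∀ i, Continuous fun x => lpProj χ q f x i := fun i => by
    simp only [lpProj_apply χ q f fun ξ => mem_cube_of_shellSymbol_ne_zero hχ le_rfl]
    fun_prop
  exact (PiLp.continuous_toLp 2 _).comp (continuous_pi h)

theorem eLpNorm_le_sum_components {f : T3 → C3} (hf : Continuous f) {r : ℝ≥0∞} (hr : 1 ≤ r) :
    eLpNorm f r torusMeasure ≤ ∑ i, eLpNorm (fun x => f x i) r torusMeasure := by
  have hc : ∀ i, Continuous fun x => f x i := fun i => by fun_prop
  have h2 := eLpNorm_sum_le (μ := torusMeasure) (p := r) (s := Finset.univ)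
    (f := fun i x => (‖f x i‖ : ℝ))
    (fun i _ => (memLp_of_continuous (hc i).norm r).aestronglyMeasurable) hr
  simp only [eLpNorm_norm] at h2
  refine le_trans (eLpNorm_mono fun x => ?_) h2
  rw [Finset.sum_apply, Real.norm_of_nonneg (Finset.sum_nonneg fun _ _ => norm_nonneg _),
    EuclideanSpace.norm_eq]
  refine Real.sqrt_le_iff.2 ⟨Finset.sum_nonneg fun _ _ => norm_nonneg _, ?_⟩
  exact Finset.sum_sq_le_sq_sum_of_nonneg fun i _ => norm_nonneg _

/-! ### Smooth symbols -/

/-- The norm is not smooth at the origin, but χ is constant near 0. -/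
theorem contDiff_radial {χ : ℝ → ℝ} (hχ : IsCutoff χ) (a : ℝ) :
    ContDiff ℝ ((⊤ : ℕ∞) : WithTop ℕ∞) fun y : R3 => ((χ (a * ‖y‖) : ℝ) : ℂ) := by
  rw [contDiff_iff_contDiffAt]
  intro y
  rcases eq_or_ne y 0 with rfl | hy
  · have : (fun y : R3 => ((χ (a * ‖y‖) : ℝ) : ℂ)) =ᶠ[𝓝 0] fun _ => 1 := by
      have h0 : ∀ᶠ y : R3 in 𝓝 0, a * ‖y‖ < 1 / 2 := by
        have : ContinuousAt (fun y : R3 => a * ‖y‖) 0 := by fun_prop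
        exact this.eventually_lt continuousAt_const (by simp)
      filter_upwards [h0] with y hy
      rw [hχ.eq_one _ hy.le, Complex.ofReal_one]
    exact contDiffAt_const.congr_of_eventuallyEq this
  · refine Complex.ofRealCLM.contDiff.contDiffAt.comp y ?_
    exact hχ.smooth.contDiffAt.comp y (contDiffAt_const.mul (contDiffAt_norm ℝ hy))

theorem hasCompactSupport_of_norm_ge {M : R3 → ℂ} {R : ℝ} (h : ∀ y, R ≤ ‖y‖ → M y = 0) :
    HasCompactSupport M := by
  refine HasCompactSupport.of_support_subset_isCompact (isCompact_closedBall 0 R) fun y hy => ?_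
  rw [mem_closedBall_zero_iff]
  by_contra hlt
  exact hy (h y (not_le.1 hlt).le)

/-- The Littlewood-Paley projections are bounded on `L^r`, uniformly. -/
theorem exists_eLpNorm_shell_le {χ : ℝ → ℝ} (hχ : IsCutoff χ) :
    ∃ A : ℝ, 0 ≤ A ∧ ∀ (q : ℕ) (r : ℝ≥0∞), 1 ≤ r → ∀ (s : Finset Freq) (c : Freq → ℂ),
      eLpNorm (trig s fun ξ => shellSymbol χ q ξ * c ξ) r torusMeasure ≤
        ENNReal.ofReal A * eLpNorm (trig s c) r torusMeasure := by
  obtain ⟨A, hA, h⟩ := exists_eLpNorm_multiplier_le (contDiff_radial hχ 1)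
    (hasCompactSupport_of_norm_ge (R := 1) fun y hy => by simp [hχ.eq_zero _ hy])
  -- For q ≥ 1 the symbol is a difference of two dilations of the one bump χ(|y|), hence the factor
  -- 2.
  refine ⟨2 * A, by positivity, fun q r hr s c => ?_⟩
  have hM : ∀ {L : ℝ}, 0 < L → ∀ ξ, ((χ (1 * ‖scaled L ξ‖) : ℝ) : ℂ) = χ (freqNorm ξ / L) :=
    fun hL ξ => by rw [one_mul, norm_scaled hL]
  by_cases hq : q = 0
  · simp only [shellSymbol, if_pos hq]
    have h1 := h 2 r hr s c
    simp only [hM two_pos] at h1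
    refine h1.trans (mul_le_mul_left (ENNReal.ofReal_le_ofReal (by linarith)) _)
  · have h1 := h (wavenumber (q + 1)) r hr s c
    have h2 := h (wavenumber q) r hr s c
    simp only [hM (wavenumber_pos _)] at h1 h2
    have h3 : (trig s fun ξ => shellSymbol χ q ξ * c ξ) =
        (trig s fun ξ => χ (freqNorm ξ / wavenumber (q + 1)) * c ξ) -
          trig s fun ξ => χ (freqNorm ξ / wavenumber q) * c ξ := by
      funext x
      rw [Pi.sub_apply, ← trig_sub]
      refine congrFun (trig_congr fun ξ _ => ?_) x
      rw [shellSymbol, if_neg hq]; push_cast; ring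
    rw [h3]
    refine (eLpNorm_sub_le (memLp_of_continuous (by fun_prop) r).aestronglyMeasurable
      (memLp_of_continuous (by fun_prop) r).aestronglyMeasurable hr).trans ?_
    refine (add_le_add h1 h2).trans (le_of_eq ?_)
    rw [← two_mul, ← mul_assoc, ENNReal.ofReal_mul two_pos.le, ENNReal.ofReal_ofNat]

/-- Symbols that are smooth away from the origin act boundedly on frequencies in an annulus. -/
theorem exists_eLpNorm_annular_le {χ : ℝ → ℝ} (hχ : IsCutoff χ) {G : R3 → ℂ}
    (hG : ∀ y, y ≠ 0 → ContDiffAt ℝ ((⊤ : ℕ∞) : WithTop ℕ∞) G y) :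
    ∃ A : ℝ, 0 ≤ A ∧ ∀ (L : ℝ), 0 < L → ∀ (r : ℝ≥0∞), 1 ≤ r → ∀ (s : Finset Freq) (c : Freq → ℂ),
      (∀ ξ ∈ s, c ξ ≠ 0 → L / 4 ≤ freqNorm ξ ∧ freqNorm ξ ≤ 2 * L) →
      eLpNorm (trig s fun ξ => G (scaled L ξ) * c ξ) r torusMeasure ≤
        ENNReal.ofReal A * eLpNorm (trig s c) r torusMeasure := by
  -- The difference of cutoffs is 1 for 1/4 ≤ |y| ≤ 2 and vanishes for |y| ≤ 1/8 and for |y| ≥ 4. It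
  -- removes the singularity of G at the origin without changing the symbol on the annulus that
  -- carries c.
  let M : R3 → ℂ := fun y => (((χ (1 / 4 * ‖y‖) : ℝ) : ℂ) - ((χ (4 * ‖y‖) : ℝ) : ℂ)) * G y
  have hM : ContDiff ℝ ((⊤ : ℕ∞) : WithTop ℕ∞) M := by
    rw [contDiff_iff_contDiffAt]
    intro y
    rcases eq_or_ne y 0 with rfl | hy
    · have : M =ᶠ[𝓝 0] fun _ => 0 := by
        have h0 : ∀ᶠ y : R3 in 𝓝 0, ‖y‖ < 1 / 8 := by
          have : ContinuousAt (fun y : R3 => ‖y‖) 0 := by fun_prop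
          exact this.eventually_lt continuousAt_const (by simp)
        filter_upwards [h0] with y hy
        simp only [M]
        rw [hχ.eq_one _ (by linarith), hχ.eq_one _ (by linarith), sub_self, zero_mul]
      exact contDiffAt_const.congr_of_eventuallyEq this
    · exact ((contDiff_radial hχ _).contDiffAt.sub
        (contDiff_radial hχ _).contDiffAt).mul (hG y hy)
  have hc : HasCompactSupport M := hasCompactSupport_of_norm_ge (R := 4) fun y hy => by
    simp only [M]
    rw [hχ.eq_zero _ (by linarith), hχ.eq_zero _ (by linarith), sub_self, zero_mul]
  obtain ⟨A, hA, h⟩ := exists_eLpNorm_multiplier_le hM hc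
  refine ⟨A, hA, fun L hL r hr s c hs => ?_⟩
  have : (trig s fun ξ => G (scaled L ξ) * c ξ) = trig s fun ξ => M (scaled L ξ) * c ξ := by
    refine trig_congr fun ξ hξ => ?_
    by_cases h0 : c ξ = 0
    · simp [h0]
    · obtain ⟨h1, h2⟩ := hs ξ hξ h0
      simp only [M]
      rw [norm_scaled hL, hχ.eq_one, hχ.eq_zero]
      · simp
      · rw [ge_iff_le, mul_div_assoc', le_div_iff₀ hL]; linarith
      · rw [mul_div_assoc', div_le_iff₀ hL]; linarith
  rw [this]
  exact h L r hr s c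

/-- The Leray symbol is homogeneous of degree 0: it takes the same value at ξ and at ξ/L, so one
constant serves all scales. -/
theorem exists_eLpNorm_lerayVec_le {χ : ℝ → ℝ} (hχ : IsCutoff χ) :
    ∃ A : ℝ, 0 ≤ A ∧ ∀ (k i : Fin 3) (L : ℝ), 0 < L → ∀ (r : ℝ≥0∞), 1 ≤ r →
      ∀ (s : Finset Freq) (c : Freq → ℂ),
      (∀ ξ ∈ s, c ξ ≠ 0 → L / 4 ≤ freqNorm ξ ∧ freqNorm ξ ≤ 2 * L) →
      eLpNorm (trig s fun ξ => lerayVec k ξ i * c ξ) r torusMeasure ≤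
        ENNReal.ofReal A * eLpNorm (trig s c) r torusMeasure := by
  let G : Fin 3 → Fin 3 → R3 → ℂ := fun k i y =>
    (((if i = k then 1 else 0) - y i * y k / ‖y‖ ^ 2 : ℝ) : ℂ)
  have hG : ∀ k i y, y ≠ 0 → ContDiffAt ℝ ((⊤ : ℕ∞) : WithTop ℕ∞) (G k i) y := by
    intro k i y hy
    refine Complex.ofRealCLM.contDiff.contDiffAt.comp y ?_
    have hp : ∀ j : Fin 3, ContDiffAt ℝ ((⊤ : ℕ∞) : WithTop ℕ∞) (fun y : R3 => y j) y := fun j =>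
      (EuclideanSpace.proj j : R3 →L[ℝ] ℝ).contDiff.contDiffAt
    exact contDiffAt_const.sub (((hp i).mul (hp k)).div ((contDiffAt_norm ℝ hy).pow 2)
      (pow_ne_zero 2 (norm_ne_zero_iff.2 hy)))
  choose A hA h using fun k i => exists_eLpNorm_annular_le hχ (hG k i)
  refine ⟨∑ k, ∑ i, A k i, Finset.sum_nonneg fun k _ => Finset.sum_nonneg fun i _ => hA k i,
    fun k i L hL r hr s c hs => ?_⟩
  have h1 : (trig s fun ξ => lerayVec k ξ i * c ξ) = trig s fun ξ => G k i (scaled L ξ) * c ξ := by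
    refine trig_congr fun ξ _ => ?_
    congr 1
    simp only [lerayVec, G, norm_scaled hL, scaled_apply]
    congr 2
    rcases eq_or_ne (freqNorm ξ) 0 with h0 | h0
    · simp [h0]
    · field_simp
  rw [h1]
  refine (h k i L hL r hr s c hs).trans (mul_le_mul_left (ENNReal.ofReal_le_ofReal ?_) _)
  exact (Finset.single_le_sum (f := A k) (fun i _ => hA k i) (Finset.mem_univ i)).trans
    (Finset.single_le_sum (f := fun k => ∑ i, A k i)
      (fun k _ => Finset.sum_nonneg fun i _ => hA k i) (Finset.mem_univ k))

/-! ### The L^r norms of the pieces and the Besov norm of the datum. -/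

theorem lerayBlock_bounds {L : ℝ} (hL : 0 < L) {S : Set Freq}
    (hS : S = blockA L ∨ S = blockB (L / 2) ∨ S = blockA L + blockB (L / 2)) {ξ : Freq}
    (hξ : ξ ∈ S) : L / 4 ≤ freqNorm ξ ∧ freqNorm ξ ≤ 2 * L := by
  have key : (∀ i, |(ξ i : ℝ)| ≤ 23 / 20 * L) ∧
      (9 / 20 * L ≤ |(ξ 0 : ℝ)| ∨ 9 / 20 * L ≤ |(ξ 2 : ℝ)|) := by
    rcases hS with rfl | rfl | rfl
    · obtain ⟨⟨h1, h2⟩, ⟨h3, h4⟩, h5, h6⟩ := hξ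
      refine ⟨fun i => abs_le.2 ?_, Or.inl (le_trans ?_ (le_abs_self _))⟩
      · fin_cases i <;> simp <;> constructor <;> linarith
      · linarith
    · obtain ⟨⟨h1, h2⟩, ⟨h3, h4⟩, h5, h6⟩ := hξ
      refine ⟨fun i => abs_le.2 ?_, Or.inr (le_trans ?_ (le_abs_self _))⟩
      · fin_cases i <;> simp <;> constructor <;> linarith
      · linarith
    · obtain ⟨⟨h1, h2⟩, ⟨h3, h4⟩, h5, h6⟩ := mem_blockC hξ
      refine ⟨fun i => abs_le.2 ?_, Or.inl (le_trans ?_ (le_abs_self _))⟩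
      · fin_cases i <;> simp <;> constructor <;> linarith
      · linarith
  have h3 : Real.sqrt 3 ≤ 40 / 23 := Real.sqrt_le_iff.2 ⟨by norm_num, by norm_num⟩
  refine ⟨?_, (freqNorm_le_of_abs_le key.1).trans (by nlinarith)⟩
  rcases key.2 with h | h
  · linarith [abs_le_freqNorm ξ 0]
  · linarith [abs_le_freqNorm ξ 2]

/-- The `L^r` norm of the part of a piece of the datum that is carried by one block. -/
theorem exists_eLpNorm_block_le {χ : ℝ → ℝ} (hχ : IsCutoff χ) {r : ℝ≥0∞} (hr : 1 < r) :
    ∃ C : ℝ, 0 ≤ C ∧ ∀ (k i : Fin 3) (L : ℝ), 1 ≤ L → ∀ S : Set Freq,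
      (S = blockA L ∨ S = blockB (L / 2) ∨ S = blockA L + blockB (L / 2)) →
      ∀ s : Finset Freq, (∀ ξ ∈ S, ξ ∈ s ∧ -ξ ∈ s) →
      eLpNorm (trig s fun ξ => lerayVec k ξ i * ind S ξ) r torusMeasure ≤
        ENNReal.ofReal (C * L ^ (3 - 3 * (r⁻¹).toReal)) ∧
      eLpNorm (trig s fun ξ => lerayVec k ξ i * ind (-S) ξ) r torusMeasure ≤
        ENNReal.ofReal (C * L ^ (3 - 3 * (r⁻¹).toReal)) := by
  obtain ⟨A, hA, h1⟩ := exists_eLpNorm_lerayVec_le hχ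
  obtain ⟨D, hD, h2⟩ := exists_eLpNorm_trig_latticeBox_le hr
  refine ⟨A * (D * 4 ^ (3 - 3 * (r⁻¹).toReal)), by positivity, fun k i L hL S hS s hs => ?_⟩
  have hL0 : 0 < L := by linarith
  -- The largest block is C, with sides of at most (L + 1) + (L/2 + 1) ≤ 4L points, as L ≥ 1.
  have hbox : IsLatticeBox S (4 * L) := by
    have hA' := isLatticeBox_blockA hL0.le
    have hB' := isLatticeBox_blockB (M := L / 2) (by linarith)
    rcases hS with rfl | rfl | rfl
    · exact hA'.mono (by linarith)
    · exact hB'.mono (by linarith)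
    · exact (hA'.add hB' (by linarith) (by linarith)).mono (by linarith)
  have key : ∀ S' : Set Freq, IsLatticeBox S' (4 * L) →
      (∀ ξ ∈ S', L / 4 ≤ freqNorm ξ ∧ freqNorm ξ ≤ 2 * L) → (∀ ξ ∈ S', ξ ∈ s) →
      eLpNorm (trig s fun ξ => lerayVec k ξ i * ind S' ξ) r torusMeasure ≤
        ENNReal.ofReal (A * (D * 4 ^ (3 - 3 * (r⁻¹).toReal)) * L ^ (3 - 3 * (r⁻¹).toReal)) := by
    rintro S' ⟨a, b, rfl, hc⟩ hn hs'
    refine (h1 k i L hL0 r hr.le s _ fun ξ _ h0 => hn ξ ?_).trans ?_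
    · by_contra h
      exact h0 (ind_of_notMem h)
    · have : trig s (ind ↑(latticeBox a b)) = trig (latticeBox a b) 1 := by
        rw [← trig_subset (s := latticeBox a b) (fun ξ hξ => hs' ξ hξ) fun ξ _ hξ =>
          ind_of_notMem hξ]
        exact trig_congr fun ξ hξ => ind_of_mem hξ
      rw [this]
      refine (mul_le_mul_right (h2 (4 * L) a b (by linarith) hc) _).trans (le_of_eq ?_)
      rw [← ENNReal.ofReal_mul hA, Real.mul_rpow (by norm_num) hL0.le]
      congr 1; ring
  refine ⟨key S hbox (fun ξ hξ => lerayBlock_bounds hL0 hS hξ) fun ξ hξ => (hs ξ hξ).1,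
    key (-S) hbox.neg (fun ξ hξ => ?_) fun ξ hξ => ?_⟩
  · rw [← freqNorm_neg]
    exact lerayBlock_bounds hL0 hS hξ
  · simpa using (hs (-ξ) hξ).2

theorem ind_union_neg {S : Set Freq} (h : ∀ ξ ∈ S, -ξ ∉ S) (ξ : Freq) :
    ind (S ∪ -S) ξ = ind S ξ + ind (-S) ξ := by
  by_cases h1 : ξ ∈ S
  · rw [ind_of_mem (Or.inl h1), ind_of_mem h1, ind_of_notMem fun h2 => h ξ h1 (Set.mem_neg.1 h2),
      add_zero]
  · by_cases h2 : ξ ∈ -S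
    · rw [ind_of_mem (Or.inr h2), ind_of_notMem h1, ind_of_mem h2, zero_add]
    · rw [ind_of_notMem h1, ind_of_notMem h2, ind_of_notMem, add_zero]
      rintro (h | h)
      exacts [h1 h, h2 h]

theorem neg_notMem_blockA {L : ℝ} (hL : 0 < L) : ∀ ξ ∈ blockA L, -ξ ∉ blockA L := by
  rintro ξ ⟨⟨h1, -⟩, -⟩ ⟨⟨h2, -⟩, -⟩
  simp only [Pi.neg_apply, Int.cast_neg] at h2
  linarith

theorem neg_notMem_blockB {L : ℝ} (hL : 0 < L) : ∀ ξ ∈ blockB L, -ξ ∉ blockB L := by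
  rintro ξ ⟨-, -, h1, -⟩ ⟨-, -, h2, -⟩
  simp only [Pi.neg_apply, Int.cast_neg] at h2
  linarith

theorem mem_pieceBox_of_mem_block {n : ℕ} {S : Set Freq}
    (hS : S = blockA (wavenumber n) ∨ S = blockB (wavenumber n / 2) ∨
      S = blockA (wavenumber n) + blockB (wavenumber n / 2)) {ξ : Freq} (hξ : ξ ∈ S) :
    ξ ∈ pieceBox n ∧ -ξ ∈ pieceBox n := by
  have hL := wavenumber_pos n
  have h : ∀ i, |(ξ i : ℝ)| ≤ 23 / 20 * wavenumber n := by
    intro i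
    rw [abs_le]
    rcases hS with rfl | rfl | rfl
    · obtain ⟨⟨h1, h2⟩, ⟨h3, h4⟩, h5, h6⟩ := hξ
      fin_cases i <;> simp <;> constructor <;> linarith
    · obtain ⟨⟨h1, h2⟩, ⟨h3, h4⟩, h5, h6⟩ := hξ
      fin_cases i <;> simp <;> constructor <;> linarith
    · obtain ⟨⟨h1, h2⟩, ⟨h3, h4⟩, h5, h6⟩ := mem_blockC hξ
      fin_cases i <;> simp <;> constructor <;> linarith
  refine ⟨mem_realBox.2 fun i => abs_le.1 (h i), mem_realBox.2 fun i => ?_⟩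
  have := abs_le.1 (h i)
  simp only [Pi.neg_apply, Int.cast_neg]
  constructor <;> linarith

theorem exists_eLpNorm_piece_le {χ : ℝ → ℝ} (hχ : IsCutoff χ) {r : ℝ≥0∞} (hr : 1 < r) (α : ℝ) :
    ∃ C : ℝ, 0 ≤ C ∧ ∀ (n : ℕ) (i : Fin 3) (s : Finset Freq), pieceBox n ⊆ s →
      eLpNorm (trig s fun ξ => pieceCoeff α n ξ i) r torusMeasure ≤
        ENNReal.ofReal (C * wavenumber n ^ (2 * α - 1 - 3 * (r⁻¹).toReal)) := by
  obtain ⟨C, hC, h⟩ := exists_eLpNorm_block_le hχ hr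
  refine ⟨8 * C, by positivity, fun n i s hs => ?_⟩
  have hL := wavenumber_pos n
  set L := wavenumber n with hLdef
  -- Four block terms, each accompanied by its reflection, make the factor 8. The vectors `z` and
  -- `z'` hold the unimodular coefficients on the block and on its reflection.
  let S : Fin 4 → Set Freq := ![blockA L, blockA L + blockB (L / 2), blockA L + blockB (L / 2),
    blockB (L / 2)]
  let k : Fin 4 → Fin 3 := ![1, 1, 0, 0]
  let z : Fin 4 → ℂ := ![1, Complex.I, -Complex.I, 1]
  let z' : Fin 4 → ℂ := ![1, -Complex.I, Complex.I, 1]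
  have hS : ∀ t, S t = blockA L ∨ S t = blockB (L / 2) ∨ S t = blockA L + blockB (L / 2) := by
    intro t; fin_cases t <;> simp [S]
  have hz : ∀ t, ‖z t‖ = 1 := by intro t; fin_cases t <;> simp [z]
  have hz' : ∀ t, ‖z' t‖ = 1 := by intro t; fin_cases t <;> simp [z']
  have hdec : (trig s fun ξ => pieceCoeff α n ξ i) = ((L ^ (2 * α - 4) : ℝ) : ℂ) •
      ∑ t, ((z t • trig s fun ξ => lerayVec (k t) ξ i * ind (S t) ξ) +
        z' t • trig s fun ξ => lerayVec (k t) ξ i * ind (-S t) ξ) := by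
    funext x
    simp only [Pi.smul_apply, Finset.sum_apply, Pi.add_apply, smul_eq_mul, ← trig_smul,
      ← trig_add, ← trig_sum]
    refine congrFun (trig_congr fun ξ _ => ?_) x
    rw [pieceCoeff_apply, ind_union_neg (neg_notMem_blockA hL),
      ind_union_neg (neg_notMem_blockB (half_pos hL)), Fin.sum_univ_four]
    simp only [z, z', S, k, Matrix.cons_val]
    ring
  have hb : ∀ t, _ := fun t => h (k t) i L (one_le_wavenumber n) (S t) (hS t) s fun ξ hξ =>
    ⟨hs (mem_pieceBox_of_mem_block (hS t) hξ).1, hs (mem_pieceBox_of_mem_block (hS t) hξ).2⟩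
  have hmeas : ∀ c : Freq → ℂ, AEStronglyMeasurable (trig s c) torusMeasure := fun c =>
    (memLp_of_continuous (continuous_trig s c) r).aestronglyMeasurable
  rw [hdec, eLpNorm_const_smul, ← ofReal_norm, Complex.norm_real,
    Real.norm_of_nonneg (by positivity)]
  have hsum : eLpNorm (∑ t, ((z t • trig s fun ξ => lerayVec (k t) ξ i * ind (S t) ξ) +
        z' t • trig s fun ξ => lerayVec (k t) ξ i * ind (-S t) ξ)) r torusMeasure ≤
      ∑ _t : Fin 4, (ENNReal.ofReal (C * L ^ (3 - 3 * (r⁻¹).toReal)) +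
        ENNReal.ofReal (C * L ^ (3 - 3 * (r⁻¹).toReal))) := by
    refine (eLpNorm_sum_le (fun t _ => ((hmeas _).const_smul _).add
      ((hmeas _).const_smul _)) hr.le).trans (Finset.sum_le_sum fun t _ => ?_)
    refine (eLpNorm_add_le ((hmeas _).const_smul _) ((hmeas _).const_smul _) hr.le).trans ?_
    rw [eLpNorm_const_smul, eLpNorm_const_smul, ← ofReal_norm, ← ofReal_norm, hz, hz',
      ENNReal.ofReal_one, one_mul, one_mul]
    exact add_le_add (hb t).1 (hb t).2
  refine (mul_le_mul_right hsum _).trans (le_of_eq ?_)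
  rw [Finset.sum_const, ← ENNReal.ofReal_add (by positivity) (by positivity),
    ← ENNReal.ofReal_nsmul, ← ENNReal.ofReal_mul (by positivity)]
  congr 1
  have : L ^ (2 * α - 1 - 3 * (r⁻¹).toReal) =
      L ^ (2 * α - 4) * L ^ (3 - 3 * (r⁻¹).toReal) := by
    rw [← Real.rpow_add hL]; congr 1; ring
  rw [this]
  simp
  ring

/-- The shell p meets only pieces with p - 1 ≤ q j ≤ p + 2. There are at most four, as q is
injective, and their wavenumbers agree with that of p up to a factor 4. -/
theorem exists_eLpNorm_lpProj_datum_le {χ : ℝ → ℝ} (hχ : IsCutoff χ) {r : ℝ≥0∞} (hr : 1 < r)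
    (α : ℝ) {q : ℕ → ℕ} (hq : StrictMono q) {U : T3 → R3}
    (hU : ∀ ξ, coeff U ξ = datumCoeff α q ξ) :
    ∃ C : ℝ, 0 ≤ C ∧ ∀ p : ℕ, eLpNorm (lpProj χ p U) r torusMeasure ≤
        ENNReal.ofReal (C * wavenumber p ^ (2 * α - 1 - 3 * (r⁻¹).toReal)) := by
  obtain ⟨A, hA, hshell⟩ := exists_eLpNorm_shell_le hχ
  obtain ⟨C, hC, hpiece⟩ := exists_eLpNorm_piece_le hχ hr α
  set e := 2 * α - 1 - 3 * (r⁻¹).toReal with he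
  refine ⟨3 * (A * (4 * (C * 4 ^ |e|))), by positivity, fun p => ?_⟩
  set R : ℝ := wavenumber (p + 5)
  have hRp : R = 32 * wavenumber p := by
    simp only [R, wavenumber, zpow_add₀ (two_ne_zero (α := ℝ))]; norm_num; ring
  have hp := wavenumber_pos p
  -- The range loses no index, because j ≤ q j ≤ p + 2.
  let J : Finset ℕ := {j ∈ Finset.range (p + 3) | p ≤ q j + 1 ∧ q j ≤ p + 2}
  have hJ : ∀ j ∈ J, p ≤ q j + 1 ∧ q j ≤ p + 2 := fun j hj => (Finset.mem_filter.1 hj).2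
  have hratio : ∀ j ∈ J, wavenumber (q j) ≤ 4 * wavenumber p ∧
      wavenumber p ≤ 4 * wavenumber (q j) := by
    intro j hj
    obtain ⟨h1, h2⟩ := hJ j hj
    rw [wavenumber_natCast, wavenumber_natCast]
    constructor
    · refine (pow_le_pow_right₀ one_le_two h2).trans (le_of_eq ?_)
      rw [pow_add]; ring
    · refine (pow_le_pow_right₀ one_le_two (h1.trans (by omega : q j + 1 ≤ q j + 2))).trans
        (le_of_eq ?_)
      rw [pow_add]; ring
  have hcard : J.card ≤ 4 := by
    have hinj : (J.image q).card = J.card := Finset.card_image_of_injective _ hq.injective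
    have hsub : J.image q ⊆ Finset.Icc (p - 1) (p + 2) := by
      intro n hn
      obtain ⟨j, hj, rfl⟩ := Finset.mem_image.1 hn
      have := hJ j hj
      rw [Finset.mem_Icc]; omega
    rw [← hinj]
    refine (Finset.card_le_card hsub).trans ?_
    simp; omega
  have hzero : ∀ ξ, shellSymbol χ p ξ ≠ 0 → ∀ j ∉ J, pieceCoeff α (q j) ξ = 0 := by
    intro ξ hξ j hj
    by_contra hne
    obtain ⟨h1, h2⟩ := pieceCoeff_freqNorm hne
    refine hj (Finset.mem_filter.2 ?_)
    have h3 : freqNorm ξ < 2 * wavenumber p := by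
      by_contra hlt
      refine hξ (shellSymbol_eq_zero_of_ge hχ ?_)
      rw [wavenumber_add_one]; exact not_lt.1 hlt
    have h4 : p ≠ 0 → wavenumber p / 2 < freqNorm ξ := fun hp0 => by
      by_contra hlt
      exact hξ (shellSymbol_eq_zero_of_le hχ hp0 (not_lt.1 hlt))
    have h5 : q j ≤ p + 2 := by
      by_contra hlt
      have : wavenumber ((p + 3 : ℕ) : ℤ) ≤ wavenumber (q j) := wavenumber_le (by omega)
      rw [wavenumber_natCast, pow_add, ← wavenumber_natCast] at this
      linarith
    have h6 : p ≤ q j + 1 := by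
      by_contra hlt
      have h7 := h4 (by omega)
      have : wavenumber ((q j + 2 : ℕ) : ℤ) ≤ wavenumber p := wavenumber_le (by omega)
      rw [wavenumber_natCast, pow_add, ← wavenumber_natCast] at this
      linarith
    have := hq.le_apply (x := j)
    exact ⟨Finset.mem_range.2 (by omega), h6, h5⟩
  have hcomp : ∀ i, eLpNorm (fun x => lpProj χ p U x i) r torusMeasure ≤
      ENNReal.ofReal (A * (4 * (C * 4 ^ |e|) * wavenumber p ^ e)) := by
    intro i
    have h1 : (fun x => lpProj χ p U x i) =
        trig (cube R) fun ξ => shellSymbol χ p ξ * ∑ j ∈ J, pieceCoeff α (q j) ξ i := by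
      funext x
      rw [lpProj_apply χ p U (s := cube R) fun ξ => mem_cube_of_shellSymbol_ne_zero hχ ?_]
      · refine congrFun (trig_congr fun ξ _ => ?_) x
        rcases eq_or_ne (shellSymbol χ p ξ) 0 with h0 | h0
        · simp [h0]
        · rw [hU]
          congr 1
          refine (hasSum_pieceCoeff_apply α hq ξ i).unique (hasSum_sum_of_ne_finset_zero ?_)
          intro j hj
          rw [hzero ξ h0 j hj]; rfl
      · rw [hRp, wavenumber_add_one]; linarith
    rw [h1]
    refine (hshell p r hr.le _ _).trans ?_
    rw [ENNReal.ofReal_mul hA]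
    refine mul_le_mul_right ?_ _
    have h2 : (trig (cube R) fun ξ => ∑ j ∈ J, pieceCoeff α (q j) ξ i) =
        ∑ j ∈ J, trig (cube R) fun ξ => pieceCoeff α (q j) ξ i := by
      funext x
      rw [trig_sum, Finset.sum_apply]
    rw [h2]
    refine (eLpNorm_sum_le (fun j _ => (memLp_of_continuous (by fun_prop) r).aestronglyMeasurable)
      hr.le).trans ?_
    refine (Finset.sum_le_card_nsmul J _ (ENNReal.ofReal (C * 4 ^ |e| * wavenumber p ^ e))
      fun j hj => (hpiece (q j) i (cube R) ?_).trans (ENNReal.ofReal_le_ofReal ?_)).trans ?_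
    · intro ξ hξ
      refine mem_cube.2 fun i => (abs_le.2 (mem_realBox.1 hξ i)).trans ?_
      have := (hratio j hj).1
      linarith
    · rw [mul_assoc]
      refine mul_le_mul_of_nonneg_left ?_ hC
      have hqj := wavenumber_pos (q j)
      obtain ⟨h3, h4⟩ := hratio j hj
      rcases le_total 0 e with h0 | h0
      · rw [abs_of_nonneg h0, ← Real.mul_rpow (by norm_num) hp.le]
        exact Real.rpow_le_rpow hqj.le h3 h0
      · rw [abs_of_nonpos h0, Real.rpow_neg (by norm_num), ← Real.inv_rpow (by norm_num),
          ← Real.mul_rpow (by norm_num) hp.le]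
        exact Real.rpow_le_rpow_of_nonpos (by positivity) (by linarith) h0
    · rw [← ENNReal.ofReal_nsmul]
      refine ENNReal.ofReal_le_ofReal ?_
      rw [nsmul_eq_mul]
      have : (J.card : ℝ) ≤ 4 := by exact_mod_cast hcard
      have h5 : 0 ≤ C * 4 ^ |e| * wavenumber p ^ e := by positivity
      nlinarith
  refine (eLpNorm_le_sum_components (continuous_lpProj hχ p U) hr.le).trans ?_
  refine (Finset.sum_le_sum fun i _ => hcomp i).trans (le_of_eq ?_)
  rw [Finset.sum_const, ← ENNReal.ofReal_nsmul]
  congr 1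
  simp
  ring

theorem besovNorm_datum_lt_top {χ : ℝ → ℝ} (hχ : IsCutoff χ) {r : ℝ≥0∞} (hr : 1 < r)
    (α : ℝ) {q : ℕ → ℕ} (hq : StrictMono q) {U : T3 → R3}
    (hU : ∀ ξ, coeff U ξ = datumCoeff α q ξ) :
    besovNorm χ (1 + 3 * (r⁻¹).toReal - 2 * α) r U < ∞ := by
  obtain ⟨C, hC, h⟩ := exists_eLpNorm_lpProj_datum_le hχ hr α hq hU
  refine lt_of_le_of_lt (iSup_le fun p => ?_) (ENNReal.ofReal_lt_top (r := C))
  refine (mul_le_mul_right (h p) _).trans (le_of_eq ?_)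
  have hp := wavenumber_pos p
  rw [← ENNReal.ofReal_mul (by positivity), mul_comm C, ← mul_assoc, ← Real.rpow_add hp]
  have : 1 + 3 * (r⁻¹).toReal - 2 * α + (2 * α - 1 - 3 * (r⁻¹).toReal) = 0 := by ring
  rw [this, Real.rpow_zero, one_mul]

/-! ### Multiples and differences of fields. -/

theorem coeff_const_smul (κ : ℝ) (f : T3 → R3) (ξ : Freq) (i : Fin 3) :
    coeff (κ • f) ξ i = κ * coeff f ξ i := by
  rw [coeff_apply, coeff_apply, ← mFourierCoeff_const_mul]
  congr 1
  funext x
  simp [comp]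

theorem coeff_smul (κ : ℝ) (f : L2Field) (ξ : Freq) (i : Fin 3) :
    coeff (κ • f : L2Field) ξ i = κ * coeff f ξ i := by
  rw [coeff_congr_ae (Lp.coeFn_smul κ f), coeff_const_smul]

theorem coeff_sub (f g : L2Field) (ξ : Freq) (i : Fin 3) :
    coeff (f - g : L2Field) ξ i = coeff f ξ i - coeff g ξ i := by
  rw [coeff_congr_ae (Lp.coeFn_sub f g), coeff_apply, coeff_apply, coeff_apply,
    ← mFourierCoeff_sub ((memLp_comp (Lp.memLp f) i).integrable one_le_two)
      ((memLp_comp (Lp.memLp g) i).integrable one_le_two)]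
  congr 1
  funext x
  simp [comp]

theorem besovNorm_smul (χ : ℝ → ℝ) (s : ℝ) (r : ℝ≥0∞) {κ : ℝ} (hκ : 0 ≤ κ) (f : L2Field) :
    besovNorm χ s r (κ • f : L2Field) = ENNReal.ofReal κ * besovNorm χ s r f := by
  have hp : ∀ p, lpProj χ p (κ • f : L2Field) = (κ : ℂ) • lpProj χ p f := by
    intro p
    funext x
    simp only [lpProj, Pi.smul_apply]
    have h : ∀ ξ, coeff (κ • f : L2Field) ξ = (κ : ℂ) • coeff f ξ := fun ξ => by
      ext i
      rw [coeff_smul, PiLp.smul_apply, smul_eq_mul]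
    simp only [h, smul_comm _ (κ : ℂ)]
    rw [tsum_const_smul'']
  unfold besovNorm
  rw [ENNReal.mul_iSup]
  refine iSup_congr fun p => ?_
  rw [hp, eLpNorm_const_smul, ← ofReal_norm, Complex.norm_real, Real.norm_of_nonneg hκ]
  ring

theorem exists_besovNorm_smul_lt {χ : ℝ → ℝ} {s : ℝ} {r : ℝ≥0∞} {f : L2Field}
    (hf : besovNorm χ s r f < ∞) {η : ℝ≥0∞} (hη : 0 < η) :
    ∃ κ : ℝ, 0 < κ ∧ besovNorm χ s r (κ • f : L2Field) < η := by
  have h : Tendsto (fun κ : ℝ => ENNReal.ofReal κ * besovNorm χ s r f) (𝓝[>] 0) (𝓝 0) := by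
    have h1 : Tendsto (fun κ : ℝ => ENNReal.ofReal κ) (𝓝[>] 0) (𝓝 0) := by
      have := (ENNReal.continuous_ofReal.tendsto 0).mono_left
        (nhdsWithin_le_nhds (s := Ioi (0 : ℝ)))
      rwa [ENNReal.ofReal_zero] at this
    have := ENNReal.Tendsto.mul_const h1 (Or.inr hf.ne)
    rwa [zero_mul] at this
  obtain ⟨κ, h1, h2⟩ := ((h.eventually_lt_const hη).and self_mem_nhdsWithin).exists
  exact ⟨κ, h2, by rwa [besovNorm_smul χ s r (le_of_lt h2)]⟩

/-! ### Real trigonometric vector fields -/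

theorem conj_trig {s : Finset Freq} {c : Freq → ℂ} (hs : ∀ ξ ∈ s, -ξ ∈ s)
    (hc : ∀ ξ, c (-ξ) = (starRingEnd ℂ) (c ξ)) (x : T3) :
    (starRingEnd ℂ) (trig s c x) = trig s c x := by
  simp only [trig, map_sum, map_mul, ← hc, ← UnitAddTorus.mFourier_neg]
  exact Finset.sum_nbij' (fun ξ => -ξ) (fun ξ => -ξ) hs hs (by simp) (by simp) (by simp)

/-- The real vector field with prescribed finitely many Fourier coefficients. -/
noncomputable def trigField (s : Finset Freq) (c : Freq → C3) (x : T3) : R3 :=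
  WithLp.toLp 2 fun i => (trig s (fun ξ => c ξ i) x).re

/-- Fourier coefficients of a real trigonometric field with frequencies in `s`. -/
structure IsRealCoeff (s : Finset Freq) (c : Freq → C3) : Prop where
  neg_mem : ∀ ξ ∈ s, -ξ ∈ s
  eq_zero : ∀ ξ ∉ s, c ξ = 0
  conj : ∀ ξ i, c (-ξ) i = (starRingEnd ℂ) (c ξ i)

theorem comp_trigField {s : Finset Freq} {c : Freq → C3} (h : IsRealCoeff s c) (i : Fin 3) :
    comp (trigField s c) i = trig s fun ξ => c ξ i := by
  funext x
  exact Complex.conj_eq_iff_re.1 (conj_trig h.neg_mem (fun ξ => h.conj ξ i) x)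

theorem coeff_trigField {s : Finset Freq} {c : Freq → C3} (h : IsRealCoeff s c) (ξ : Freq) :
    coeff (trigField s c) ξ = c ξ := by
  ext i
  rw [coeff_apply, comp_trigField h, mFourierCoeff_trig]
  split_ifs with hs
  · rfl
  · rw [h.eq_zero ξ hs]; rfl

theorem isSmooth_trigField (s : Finset Freq) (c : Freq → C3) : IsSmooth (trigField s c) := by
  unfold IsSmooth
  rw [contDiff_euclidean]
  intro i
  simp only [trigField, trig, mFourier_covering]
  refine Complex.reCLM.contDiff.comp (ContDiff.sum fun ξ _ => contDiff_const.mul ?_)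
  refine Complex.contDiff_exp.comp (contDiff_const.mul (Complex.ofRealCLM.contDiff.comp ?_))
  have : ContDiff ℝ ((⊤ : ℕ∞) : WithTop ℕ∞) fun x : Fin 3 → ℝ => ∑ i, (ξ i : ℝ) * x i := by
    fun_prop
  exact this

theorem mFourier_add_apply (ξ : Freq) (x y : T3) :
    UnitAddTorus.mFourier ξ (x + y) = UnitAddTorus.mFourier ξ x * UnitAddTorus.mFourier ξ y := by
  simp [UnitAddTorus.mFourier, fourier_apply, smul_add, AddCircle.toCircle_add,
    Finset.prod_mul_distrib]

theorem hasDerivAt_mFourier (ξ : Freq) (i : Fin 3) (x : T3) :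
    HasDerivAt (fun s : ℝ => UnitAddTorus.mFourier ξ (x + covering (Pi.single i s)))
      (Complex.I * ξ i * UnitAddTorus.mFourier ξ x) 0 := by
  have h1 : ∀ s : ℝ, UnitAddTorus.mFourier ξ (x + covering (Pi.single i s)) =
      UnitAddTorus.mFourier ξ x * Complex.exp (Complex.I * ξ i * s) := by
    intro s
    rw [mFourier_add_apply, mFourier_covering]
    congr 2
    have : ∑ k, (ξ k : ℝ) * (Pi.single i s : Fin 3 → ℝ) k = ξ i * s := by
      simp [Pi.single_apply]
    rw [this]; push_cast; ring
  simp only [h1]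
  have h2 : HasDerivAt (fun s : ℝ => Complex.I * ξ i * (s : ℂ)) (Complex.I * ξ i) 0 := by
    simpa using (Complex.ofRealCLM.hasDerivAt (x := (0 : ℝ))).const_mul (Complex.I * ξ i)
  have h3 := (h2.cexp).const_mul (UnitAddTorus.mFourier ξ x)
  refine h3.congr_deriv ?_
  simp; ring

theorem pderiv_trigField {s : Finset Freq} {c : Freq → C3} (h : IsRealCoeff s c) (i k : Fin 3)
    (x : T3) : ((pderiv i (trigField s c) x k : ℝ) : ℂ) =
      trig s (fun ξ => Complex.I * ξ i * c ξ k) x := by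
  have h1 : ∀ k, HasDerivAt (fun t : ℝ => trig s (fun ξ => c ξ k) (x + covering (Pi.single i t)))
      (trig s (fun ξ => Complex.I * ξ i * c ξ k) x) 0 := by
    intro k
    have := HasDerivAt.fun_sum (u := s) fun ξ _ =>
      (hasDerivAt_mFourier ξ i x).const_mul (c ξ k)
    exact this.congr_deriv (Finset.sum_congr rfl fun ξ _ => by ring)
  have h2 : HasDerivAt (fun t : ℝ => trigField s c (x + covering (Pi.single i t)))
      (WithLp.toLp 2 fun k => (trig s (fun ξ => Complex.I * ξ i * c ξ k) x).re) 0 := by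
    have := hasDerivAt_pi.2 fun k => (Complex.reCLM.hasFDerivAt.comp_hasDerivAt 0 (h1 k))
    exact ((PiLp.continuousLinearEquiv 2 ℝ
      (fun _ : Fin 3 => ℝ)).symm.toContinuousLinearMap.hasFDerivAt.comp_hasDerivAt 0 this)
  rw [pderiv, h2.deriv]
  refine Complex.conj_eq_iff_re.1 (conj_trig h.neg_mem (fun ξ => ?_) x)
  rw [h.conj]
  simp

theorem freqNorm_rpow_conj (s : ℝ) (ξ : Freq) {c : Freq → C3} {S : Finset Freq}
    (h : IsRealCoeff S c) (k : Fin 3) :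
    ((freqNorm (-ξ) ^ s : ℝ) : ℂ) * c (-ξ) k =
      (starRingEnd ℂ) (((freqNorm ξ ^ s : ℝ) : ℂ) * c ξ k) := by
  rw [h.conj, freqNorm_neg, map_mul, Complex.conj_ofReal]

theorem fracLaplacian_trigField (α : ℝ) {s : Finset Freq} {c : Freq → C3} (h : IsRealCoeff s c)
    (k : Fin 3) (x : T3) : ((fracLaplacian α (trigField s c) x k : ℝ) : ℂ) =
      trig s (fun ξ => ((freqNorm ξ ^ (2 * α) : ℝ) : ℂ) * c ξ k) x := by
  have h1 : fracLaplacian α (trigField s c) x k =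
      (trig s (fun ξ => ((freqNorm ξ ^ (2 * α) : ℝ) : ℂ) * c ξ k) x).re := by
    simp only [fracLaplacian, coeff_trigField h]
    rw [tsum_eq_sum (s := s)]
    · rfl
    · intro ξ hξ
      rw [h.eq_zero ξ hξ]; simp
  rw [h1]
  exact Complex.conj_eq_iff_re.1 (conj_trig h.neg_mem (fun ξ => freqNorm_rpow_conj _ ξ h k) x)

theorem integrable_comp {f : T3 → R3} (hf : MemLp f 2 torusMeasure) (i : Fin 3) :
    Integrable (comp f i) torusMeasure := (memLp_comp hf i).integrable one_le_two

/-- Pairing with a real trigonometric field. -/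
theorem integral_inner_of_comp {f φ : T3 → R3} (hf : MemLp f 2 torusMeasure) {ψ : Fin 3 → T3 → ℂ}
    (hψ : ∀ i, Continuous (ψ i)) (hφ : ∀ i x, ((φ x i : ℝ) : ℂ) = ψ i x) :
    ((∫ x, inner ℝ (f x) (φ x) ∂torusMeasure : ℝ) : ℂ) =
      ∑ i, ∫ x, comp f i x * ψ i x ∂torusMeasure := by
  rw [← integral_complex_ofReal, ← integral_finsetSum]
  · refine integral_congr_ae (ae_of_all _ fun x => ?_)
    simp only [PiLp.inner_apply, comp, ← hφ]
    push_cast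
    refine Finset.sum_congr rfl fun i _ => ?_
    simp [mul_comm]
  · exact fun i _ => integrable_mul_continuous (integrable_comp hf i) (hψ i)

theorem integral_flux_of_comp {f φ : T3 → R3} (hf : MemLp f 2 torusMeasure)
    {ψ : Fin 3 → Fin 3 → T3 → ℂ} (hψ : ∀ i k, Continuous (ψ i k))
    (hφ : ∀ i k x, ((pderiv i φ x k : ℝ) : ℂ) = ψ i k x) :
    ((∫ x, (∑ i, ∑ k, f x i * f x k * pderiv i φ x k) ∂torusMeasure : ℝ) : ℂ) =
      ∑ i, ∑ k, ∫ x, comp f i x * comp f k x * ψ i k x ∂torusMeasure := by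
  have hint : ∀ i k, Integrable (fun x => comp f i x * comp f k x * ψ i k x) torusMeasure :=
    fun i k => integrable_mul_continuous ((memLp_comp hf i).integrable_mul (memLp_comp hf k))
      (hψ i k)
  rw [← integral_complex_ofReal]
  simp only [← integral_finsetSum _ fun k _ => hint _ k]
  rw [← integral_finsetSum _ fun i _ => integrable_finsetSum _ fun k _ => hint i k]
  refine integral_congr_ae (ae_of_all _ fun x => ?_)
  simp only [comp, ← hφ]
  push_cast
  rfl

/-! ### The test field -/

/-- The number of representations of a frequency as a difference between the blocks `B` and `A`. -/
noncomputable def corr (L : ℝ) (ξ : Freq) : ℝ :=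
  ((boxB (L / 2) ×ˢ boxA L).filter fun p => p.1 - p.2 = ξ).card

/-- The Fourier coefficients of the stream function of the test field. -/
noncomputable def bump (L : ℝ) (ξ : Freq) : ℝ := (L ^ 3)⁻¹ * (corr L ξ + corr L (-ξ))

/-- The first two components of the rotated gradient. -/
def rot (y : Fin 3 → ℝ) : Fin 3 → ℝ := ![y 1, -y 0, 0]

/-- The Fourier coefficients of the test field. -/
noncomputable def testCoeff (L : ℝ) (ξ : Freq) : C3 :=
  WithLp.toLp 2 fun k => Complex.I * (rot (fun i => (ξ i : ℝ)) k : ℂ) * (bump L ξ : ℂ)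

theorem testCoeff_apply (L : ℝ) (ξ : Freq) (k : Fin 3) :
    testCoeff L ξ k = Complex.I * (rot (fun i => (ξ i : ℝ)) k : ℂ) * (bump L ξ : ℂ) := rfl

theorem corr_nonneg (L : ℝ) (ξ : Freq) : 0 ≤ corr L ξ := Nat.cast_nonneg _

theorem bump_neg (L : ℝ) (ξ : Freq) : bump L (-ξ) = bump L ξ := by
  rw [bump, bump, neg_neg, add_comm]

theorem bump_nonneg {L : ℝ} (hL : 0 ≤ L) (ξ : Freq) : 0 ≤ bump L ξ :=
  mul_nonneg (by positivity) (add_nonneg (corr_nonneg _ _) (corr_nonneg _ _))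

/-- The region that carries the test field. -/
def testRegion (L : ℝ) : Set Freq :=
  {ξ | (ξ 0 : ℝ) ∈ Icc (-(23 / 20 * L)) (-(17 / 20 * L)) ∧
    (ξ 1 : ℝ) ∈ Icc (-(3 / 20 * L)) (3 / 20 * L) ∧ (ξ 2 : ℝ) ∈ Icc (7 / 20 * L) (13 / 20 * L)}

theorem sub_mem_testRegion {L : ℝ} {η ζ : Freq} (hη : η ∈ blockB (L / 2)) (hζ : ζ ∈ blockA L) :
    η - ζ ∈ testRegion L := by
  obtain ⟨⟨h1, h2⟩, ⟨h3, h4⟩, h5, h6⟩ := hη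
  obtain ⟨⟨h7, h8⟩, ⟨h9, h10⟩, h11, h12⟩ := hζ
  simp only [testRegion, Set.mem_ofPred_eq, mem_Icc, Pi.sub_apply]
  push_cast
  refine ⟨⟨?_, ?_⟩, ⟨?_, ?_⟩, ?_, ?_⟩ <;> linarith

theorem mem_testRegion_of_corr_ne_zero {L : ℝ} {ξ : Freq} (h : corr L ξ ≠ 0) :
    ξ ∈ testRegion L := by
  rw [corr, Nat.cast_ne_zero, Finset.card_ne_zero] at h
  obtain ⟨p, hp⟩ := h
  rw [Finset.mem_filter, Finset.mem_product] at hp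
  obtain ⟨⟨h1, h2⟩, rfl⟩ := hp
  exact sub_mem_testRegion (by rw [blockB_eq]; exact h1) (by rw [blockA_eq]; exact h2)

theorem mem_testRegion_of_bump_ne_zero {L : ℝ} {ξ : Freq} (h : bump L ξ ≠ 0) :
    ξ ∈ testRegion L ∨ -ξ ∈ testRegion L := by
  by_contra hn
  push Not at hn
  refine h ?_
  have h1 : corr L ξ = 0 := by_contra fun h => hn.1 (mem_testRegion_of_corr_ne_zero h)
  have h2 : corr L (-ξ) = 0 := by_contra fun h => hn.2 (mem_testRegion_of_corr_ne_zero h)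
  rw [bump, h1, h2]; simp

theorem freqNorm_of_mem_testRegion {L : ℝ} (hL : 0 ≤ L) {ξ : Freq} (h : ξ ∈ testRegion L) :
    L / 4 ≤ freqNorm ξ ∧ freqNorm ξ ≤ 2 * L := by
  obtain ⟨⟨h1, h2⟩, ⟨h3, h4⟩, h5, h6⟩ := h
  have h7 : ∀ i, |(ξ i : ℝ)| ≤ 23 / 20 * L := by
    intro i
    rw [abs_le]
    fin_cases i <;> simp <;> constructor <;> linarith
  have h3 : Real.sqrt 3 ≤ 40 / 23 := Real.sqrt_le_iff.2 ⟨by norm_num, by norm_num⟩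
  refine ⟨?_, (freqNorm_le_of_abs_le h7).trans (by nlinarith)⟩
  have := abs_le_freqNorm ξ 2
  linarith [le_abs_self (ξ 2 : ℝ)]

theorem freqNorm_of_bump_ne_zero {L : ℝ} (hL : 0 ≤ L) {ξ : Freq} (h : bump L ξ ≠ 0) :
    L / 4 ≤ freqNorm ξ ∧ freqNorm ξ ≤ 2 * L := by
  rcases mem_testRegion_of_bump_ne_zero h with h | h
  · exact freqNorm_of_mem_testRegion hL h
  · rw [← freqNorm_neg]; exact freqNorm_of_mem_testRegion hL h

theorem isRealCoeff_testCoeff {L : ℝ} (hL : 0 ≤ L) : IsRealCoeff (cube (2 * L)) (testCoeff L) where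
  neg_mem ξ hξ := by
    rw [mem_cube] at hξ ⊢
    simpa using hξ
  eq_zero ξ hξ := by
    have : bump L ξ = 0 := by
      by_contra h
      exact hξ (mem_cube_of_freqNorm_le (freqNorm_of_bump_ne_zero hL h).2)
    ext k
    simp [testCoeff_apply, this]
  conj ξ k := by
    have : rot (fun i => (((-ξ) i : ℤ) : ℝ)) k = -rot (fun i => (ξ i : ℝ)) k := by
      fin_cases k <;> simp [rot]
    rw [testCoeff_apply, testCoeff_apply, bump_neg, this]
    simp

theorem isDivFree_testField {L : ℝ} (hL : 0 ≤ L) :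
    IsDivFree (trigField (cube (2 * L)) (testCoeff L)) := by
  intro ξ
  rw [coeff_trigField (isRealCoeff_testCoeff hL)]
  simp [Fin.sum_univ_three, testCoeff_apply, rot]
  ring

theorem card_boxA_le' {L : ℝ} (hL : 1 ≤ L) : ((boxA L).card : ℝ) ≤ 8 * L ^ 3 := by
  refine (card_boxA_le (by linarith)).trans ?_
  have : (L + 1) ^ 3 ≤ (2 * L) ^ 3 := pow_le_pow_left₀ (by linarith) (by linarith) 3
  linarith [show (2 * L) ^ 3 = 8 * L ^ 3 by ring]

theorem card_boxB_le' {L : ℝ} (hL : 1 ≤ L) : ((boxB (L / 2)).card : ℝ) ≤ 8 * L ^ 3 := by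
  refine (card_boxB_le (by linarith)).trans ?_
  have : (L / 2 + 1) ^ 3 ≤ (2 * L) ^ 3 := pow_le_pow_left₀ (by linarith) (by linarith) 3
  linarith [show (2 * L) ^ 3 = 8 * L ^ 3 by ring]

/-- The difference and the first component determine the pair, so the points of B bound the number
of representations. -/
theorem corr_le {L : ℝ} (hL : 1 ≤ L) (ξ : Freq) : corr L ξ ≤ 8 * L ^ 3 := by
  refine le_trans ?_ (card_boxB_le' hL)
  rw [corr, Nat.cast_le]
  refine Finset.card_le_card_of_injOn Prod.fst (fun p hp => ?_) fun p hp p' hp' h => ?_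
  · exact (Finset.mem_product.1 (Finset.mem_filter.1 hp).1).1
  · have h1 := (Finset.mem_filter.1 hp).2
    have h2 := (Finset.mem_filter.1 hp').2
    have : p.2 = p'.2 := by
      rw [← sub_right_inj (a := p.1), h1, h, h2]
    exact Prod.ext h this

theorem sum_corr_le {L : ℝ} (hL : 1 ≤ L) (s : Finset Freq) : ∑ ξ ∈ s, corr L ξ ≤ 64 * L ^ 6 := by
  have h1 : ∑ ξ ∈ s, corr L ξ ≤ ((boxB (L / 2) ×ˢ boxA L).card : ℝ) := by
    simp only [corr]
    rw [← Nat.cast_sum, Nat.cast_le]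
    rw [← Finset.card_biUnion fun ξ _ η _ hne => Finset.disjoint_left.2 fun p h2 h3 =>
      hne ((Finset.mem_filter.1 h2).2.symm.trans (Finset.mem_filter.1 h3).2)]
    exact Finset.card_le_card (Finset.biUnion_subset.2 fun ξ _ => Finset.filter_subset _ _)
  refine h1.trans ?_
  rw [Finset.card_product]
  push_cast
  refine (mul_le_mul (card_boxB_le' hL) (card_boxA_le' hL) (by positivity) (by positivity)).trans
    (le_of_eq (by ring))

theorem bump_le {L : ℝ} (hL : 1 ≤ L) (ξ : Freq) : bump L ξ ≤ 16 := by
  rw [bump, inv_mul_le_iff₀ (by positivity)]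
  linarith [corr_le hL ξ, corr_le hL (-ξ)]

theorem sum_bump_le {L : ℝ} (hL : 1 ≤ L) : ∑ ξ ∈ cube (2 * L), bump L ξ ≤ 128 * L ^ 3 := by
  have hneg : ∑ ξ ∈ cube (2 * L), corr L (-ξ) = ∑ ξ ∈ cube (2 * L), corr L ξ := by
    have h := (isRealCoeff_testCoeff (L := L) (by linarith)).neg_mem
    exact Finset.sum_nbij' (fun ξ => -ξ) (fun ξ => -ξ) h h (by simp) (by simp) (by simp)
  simp only [bump]
  rw [← Finset.mul_sum, inv_mul_le_iff₀ (by positivity), Finset.sum_add_distrib, hneg]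
  linarith [sum_corr_le hL (cube (2 * L)), show L ^ 3 * (128 * L ^ 3) = 128 * L ^ 6 by ring]

/-- This factorisation is the reason for weighting the test field by representation numbers: its L¹
norm is controlled by two L² norms, hence by numbers of lattice points. -/
theorem trig_corr {L : ℝ} {s : Finset Freq} (hs : ∀ ξ, corr L ξ ≠ 0 → ξ ∈ s) (x : T3) :
    trig s (fun ξ => (corr L ξ : ℂ)) x =
      trig (boxB (L / 2)) 1 x * (starRingEnd ℂ) (trig (boxA L) 1 x) := by
  have h1 : trig (boxB (L / 2)) 1 x * (starRingEnd ℂ) (trig (boxA L) 1 x) =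
      ∑ p ∈ boxB (L / 2) ×ˢ boxA L, UnitAddTorus.mFourier (p.1 - p.2) x := by
    simp only [trig, Pi.one_apply, one_mul, map_sum]
    rw [Finset.sum_mul_sum, Finset.sum_product]
    refine Finset.sum_congr rfl fun η _ => Finset.sum_congr rfl fun ζ _ => ?_
    rw [← UnitAddTorus.mFourier_neg, mFourier_mul, sub_eq_add_neg]
  rw [h1, ← Finset.sum_fiberwise_of_maps_to (t := s) (g := fun p : Freq × Freq => p.1 - p.2)]
  · refine Finset.sum_congr rfl fun ξ _ => ?_
    have h2 : ∑ p ∈ boxB (L / 2) ×ˢ boxA L with p.1 - p.2 = ξ, UnitAddTorus.mFourier (p.1 - p.2) x =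
        ∑ p ∈ boxB (L / 2) ×ˢ boxA L with p.1 - p.2 = ξ, UnitAddTorus.mFourier ξ x :=
      Finset.sum_congr rfl fun p hp => by rw [(Finset.mem_filter.1 hp).2]
    rw [h2, Finset.sum_const, nsmul_eq_mul]
    simp only [corr, Complex.ofReal_natCast]
  · intro p hp
    refine hs _ ?_
    rw [corr, Nat.cast_ne_zero, Finset.card_ne_zero]
    exact ⟨p, Finset.mem_filter.2 ⟨hp, rfl⟩⟩

theorem eLpNorm_trig_corr_le {L : ℝ} (hL : 1 ≤ L) {s : Finset Freq}
    (hs : ∀ ξ, corr L ξ ≠ 0 → ξ ∈ s) :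
    eLpNorm (trig s fun ξ => (corr L ξ : ℂ)) 1 torusMeasure ≤ ENNReal.ofReal (8 * L ^ 3) := by
  have h1 := (memLp_of_continuous (continuous_trig s fun ξ => (corr L ξ : ℂ)) 1)
  rw [eLpNorm_one_eq_lintegral_enorm,
    ← ofReal_integral_norm_eq_lintegral_enorm (memLp_one_iff_integrable.1 h1)]
  refine ENNReal.ofReal_le_ofReal ?_
  have hA := integral_sq_trig (boxA L) 1
  have hB := integral_sq_trig (boxB (L / 2)) 1
  simp only [Pi.one_apply, norm_one, one_pow, Finset.sum_const, nsmul_eq_mul, mul_one] at hA hB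
  have hi : ∀ t : Finset Freq, Integrable (fun x => ‖trig t 1 x‖ ^ 2) torusMeasure := fun t =>
    integrable_of_continuous (by fun_prop)
  have h2 : ∫ x, ‖trig s (fun ξ => (corr L ξ : ℂ)) x‖ ∂torusMeasure ≤
      ∫ x, (1 / 2 * ‖trig (boxB (L / 2)) 1 x‖ ^ 2 + 1 / 2 * ‖trig (boxA L) 1 x‖ ^ 2)
        ∂torusMeasure := by
    refine integral_mono (integrable_of_continuous (by fun_prop))
      (((hi _).const_mul _).add ((hi _).const_mul _)) fun x => ?_
    simp only []
    rw [trig_corr hs, norm_mul, RCLike.norm_conj]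
    nlinarith [sq_nonneg (‖trig (boxB (L / 2)) 1 x‖ - ‖trig (boxA L) 1 x‖)]
  rw [integral_add ((hi _).const_mul _) ((hi _).const_mul _), integral_const_mul,
    integral_const_mul, hA, hB] at h2
  linarith [card_boxA_le' hL, card_boxB_le' hL]

/-- The factor L⁻³ normalises the O(L³) bound for the correlation, and the reflected half is its
complex conjugate, with the same L¹ norm. -/
theorem eLpNorm_trig_bump_le {L : ℝ} (hL : 1 ≤ L) :
    eLpNorm (trig (cube (2 * L)) fun ξ => (bump L ξ : ℂ)) 1 torusMeasure ≤ ENNReal.ofReal 16 := by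
  have hL0 : 0 ≤ L := by linarith
  have hs : ∀ ξ, corr L ξ ≠ 0 → ξ ∈ cube (2 * L) := fun ξ h => mem_cube_of_freqNorm_le
    (freqNorm_of_mem_testRegion hL0 (mem_testRegion_of_corr_ne_zero h)).2
  have hdec : (trig (cube (2 * L)) fun ξ => (bump L ξ : ℂ)) = (((L ^ 3)⁻¹ : ℝ) : ℂ) •
      ((trig (cube (2 * L)) fun ξ => (corr L ξ : ℂ)) +
        fun x => (starRingEnd ℂ) (trig (cube (2 * L)) (fun ξ => (corr L ξ : ℂ)) x)) := by
    funext x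
    have h1 : (starRingEnd ℂ) (trig (cube (2 * L)) (fun ξ => (corr L ξ : ℂ)) x) =
        trig (cube (2 * L)) (fun ξ => (corr L (-ξ) : ℂ)) x := by
      simp only [trig, map_sum, map_mul, Complex.conj_ofReal, ← UnitAddTorus.mFourier_neg]
      have h := (isRealCoeff_testCoeff hL0).neg_mem
      exact Finset.sum_nbij' (fun ξ => -ξ) (fun ξ => -ξ) h h (by simp) (by simp) (by simp)
    rw [Pi.smul_apply, Pi.add_apply, h1, ← trig_add, smul_eq_mul, ← trig_smul]
    refine congrFun (trig_congr fun ξ _ => ?_) x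
    rw [bump]; push_cast; ring
  have hm : AEStronglyMeasurable (trig (cube (2 * L)) fun ξ => (corr L ξ : ℂ)) torusMeasure :=
    (memLp_of_continuous (by fun_prop) 1).aestronglyMeasurable
  have hm' : AEStronglyMeasurable (fun x => (starRingEnd ℂ)
      (trig (cube (2 * L)) (fun ξ => (corr L ξ : ℂ)) x)) torusMeasure :=
    (memLp_of_continuous (by fun_prop) 1).aestronglyMeasurable
  have hconj : eLpNorm (fun x => (starRingEnd ℂ)
      (trig (cube (2 * L)) (fun ξ => (corr L ξ : ℂ)) x)) 1 torusMeasure =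
      eLpNorm (trig (cube (2 * L)) fun ξ => (corr L ξ : ℂ)) 1 torusMeasure :=
    eLpNorm_congr_norm_ae (ae_of_all _ fun x => RCLike.norm_conj _)
  rw [hdec, eLpNorm_const_smul, ← ofReal_norm, Complex.norm_real,
    Real.norm_of_nonneg (by positivity)]
  refine (mul_le_mul_right (eLpNorm_add_le hm hm' le_rfl) _).trans ?_
  rw [hconj]
  refine (mul_le_mul_right (add_le_add (eLpNorm_trig_corr_le hL hs)
    (eLpNorm_trig_corr_le hL hs)) _).trans (le_of_eq ?_)
  rw [← ENNReal.ofReal_add (by positivity) (by positivity), ← ENNReal.ofReal_mul (by positivity)]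
  congr 1
  field_simp
  norm_num

theorem abs_rot_le (ξ : Freq) (k : Fin 3) : |rot (fun i => (ξ i : ℝ)) k| ≤ freqNorm ξ := by
  fin_cases k
  · exact abs_le_freqNorm ξ 1
  · have : rot (fun i => (ξ i : ℝ)) 1 = -(ξ 0 : ℝ) := rfl
    simpa [this] using abs_le_freqNorm ξ 0
  · simpa [rot] using freqNorm_nonneg ξ

theorem norm_testCoeff_le {L : ℝ} (hL : 0 ≤ L) (ξ : Freq) (k : Fin 3) :
    ‖testCoeff L ξ k‖ ≤ 2 * L * bump L ξ := by
  by_cases h : bump L ξ = 0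
  · simp [testCoeff_apply, h]
  · rw [testCoeff_apply, norm_mul, norm_mul, Complex.norm_I, one_mul, Complex.norm_real,
      Complex.norm_real, Real.norm_of_nonneg (bump_nonneg hL ξ)]
    exact mul_le_mul_of_nonneg_right ((abs_rot_le ξ k).trans (freqNorm_of_bump_ne_zero hL h).2)
      (bump_nonneg hL ξ)

theorem norm_deriv_testCoeff_le {L : ℝ} (hL : 0 ≤ L) (ξ : Freq) (i k : Fin 3) :
    ‖Complex.I * ξ i * testCoeff L ξ k‖ ≤ 4 * L ^ 2 * bump L ξ := by
  by_cases h : bump L ξ = 0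
  · simp [testCoeff_apply, h]
  · rw [norm_mul, norm_mul, Complex.norm_I, one_mul, Complex.norm_intCast]
    refine (mul_le_mul ((abs_le_freqNorm ξ i).trans (freqNorm_of_bump_ne_zero hL h).2)
      (norm_testCoeff_le hL ξ k) (norm_nonneg _) (by positivity)).trans (le_of_eq (by ring))

/-- A sup bound for the gradient of the test field. It is needed against the product of two
high-frequency parts, which is controlled only in L¹. -/
theorem sum_norm_deriv_testCoeff_le {L : ℝ} (hL : 1 ≤ L) (i k : Fin 3) :
    ∑ ξ ∈ cube (2 * L), ‖Complex.I * ξ i * testCoeff L ξ k‖ ≤ 512 * L ^ 5 := by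
  refine (Finset.sum_le_sum fun ξ _ => norm_deriv_testCoeff_le (by linarith) ξ i k).trans ?_
  rw [← Finset.mul_sum]
  refine (mul_le_mul_of_nonneg_left (sum_bump_le hL) (by positivity)).trans (le_of_eq (by ring))

theorem sum_sq_norm_testCoeff_le {L : ℝ} (hL : 1 ≤ L) (k : Fin 3) :
    ∑ ξ ∈ cube (2 * L), ‖testCoeff L ξ k‖ ^ 2 ≤ 8192 * L ^ 5 := by
  have h : ∀ ξ, ‖testCoeff L ξ k‖ ^ 2 ≤ 64 * L ^ 2 * bump L ξ := fun ξ => by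
    have h1 := norm_testCoeff_le (by linarith : 0 ≤ L) ξ k
    have h2 := bump_le hL ξ
    have h3 := bump_nonneg (by linarith : 0 ≤ L) ξ
    refine (pow_le_pow_left₀ (norm_nonneg _) h1 2).trans ?_
    have : (2 * L * bump L ξ) ^ 2 = 4 * L ^ 2 * (bump L ξ * bump L ξ) := by ring
    rw [this]
    have h4 : bump L ξ * bump L ξ ≤ 16 * bump L ξ := mul_le_mul_of_nonneg_right h2 h3
    nlinarith [sq_nonneg L]
  refine (Finset.sum_le_sum fun ξ _ => h ξ).trans ?_
  rw [← Finset.mul_sum]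
  refine (mul_le_mul_of_nonneg_left (sum_bump_le hL) (by positivity)).trans (le_of_eq (by ring))

theorem contDiffAt_rot (k : Fin 3) (y : R3) :
    ContDiffAt ℝ ((⊤ : ℕ∞) : WithTop ℕ∞) (fun y : R3 => rot y k) y := by
  have hp : ∀ j : Fin 3, ContDiffAt ℝ ((⊤ : ℕ∞) : WithTop ℕ∞) (fun y : R3 => y j) y := fun j =>
    (EuclideanSpace.proj j : R3 →L[ℝ] ℝ).contDiff.contDiffAt
  fin_cases k
  · exact hp 1
  · exact (hp 0).neg
  · exact contDiffAt_const

theorem rot_scaled (L : ℝ) (ξ : Freq) (k : Fin 3) :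
    rot (scaled L ξ) k = rot (fun i => (ξ i : ℝ)) k / L := by
  fin_cases k <;> simp [rot, scaled_apply, neg_div]

/-- The gradient of the test field in `L¹`. -/
theorem exists_eLpNorm_deriv_testCoeff_le {χ : ℝ → ℝ} (hχ : IsCutoff χ) :
    ∃ C : ℝ, 0 ≤ C ∧ ∀ (L : ℝ), 1 ≤ L → ∀ i k : Fin 3,
      eLpNorm (trig (cube (2 * L)) fun ξ => Complex.I * ξ i * testCoeff L ξ k) 1 torusMeasure ≤
        ENNReal.ofReal (C * L ^ 2) := by
  -- Differentiation and the rotated gradient together give a symbol homogeneous of degree 2, which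
  -- produces the factor L².
  let G : Fin 3 → Fin 3 → R3 → ℂ := fun i k y => ((-(y i * rot y k) : ℝ) : ℂ)
  have hG : ∀ i k y, y ≠ 0 → ContDiffAt ℝ ((⊤ : ℕ∞) : WithTop ℕ∞) (G i k) y := by
    intro i k y _
    refine Complex.ofRealCLM.contDiff.contDiffAt.comp y ?_
    exact ((EuclideanSpace.proj i : R3 →L[ℝ] ℝ).contDiff.contDiffAt.mul (contDiffAt_rot k y)).neg
  choose A hA h using fun i k => exists_eLpNorm_annular_le hχ (hG i k)
  refine ⟨(∑ i, ∑ k, A i k) * 16, mul_nonneg (Finset.sum_nonneg fun i _ =>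
    Finset.sum_nonneg fun k _ => hA i k) (by norm_num), fun L hL i k => ?_⟩
  have hL0 : 0 < L := by linarith
  have h1 : (trig (cube (2 * L)) fun ξ => Complex.I * ξ i * testCoeff L ξ k) =
      ((L ^ 2 : ℝ) : ℂ) • trig (cube (2 * L)) fun ξ => G i k (scaled L ξ) * bump L ξ := by
    funext x
    rw [Pi.smul_apply, smul_eq_mul, ← trig_smul]
    refine congrFun (trig_congr fun ξ _ => ?_) x
    simp only [G, rot_scaled, scaled_apply, testCoeff_apply]
    have hLc : (L : ℂ) ≠ 0 := by exact_mod_cast hL0.ne'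
    push_cast
    field_simp
    rw [Complex.I_sq]; ring
  rw [h1, eLpNorm_const_smul, ← ofReal_norm, Complex.norm_real, Real.norm_of_nonneg (by positivity)]
  have h2 := h i k L hL0 1 le_rfl (cube (2 * L)) (fun ξ => (bump L ξ : ℂ)) fun ξ _ h0 =>
    freqNorm_of_bump_ne_zero hL0.le (by exact_mod_cast h0)
  have hle : A i k ≤ ∑ i, ∑ k, A i k :=
    (Finset.single_le_sum (f := A i) (fun k _ => hA i k) (Finset.mem_univ k)).trans
      (Finset.single_le_sum (f := fun i => ∑ k, A i k)
        (fun i _ => Finset.sum_nonneg fun k _ => hA i k) (Finset.mem_univ i))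
  refine (mul_le_mul_right (h2.trans (mul_le_mul' (ENNReal.ofReal_le_ofReal hle)
    (eLpNorm_trig_bump_le hL))) _).trans (le_of_eq ?_)
  have hs : 0 ≤ ∑ i, ∑ k, A i k := (hA i k).trans hle
  rw [← ENNReal.ofReal_mul hs, ← ENNReal.ofReal_mul (by positivity)]
  congr 1; ring

/-- The fractional Laplacian of the test field in `L¹`. -/
theorem exists_eLpNorm_fracLaplacian_testCoeff_le {χ : ℝ → ℝ} (hχ : IsCutoff χ) (α : ℝ) :
    ∃ C : ℝ, 0 ≤ C ∧ ∀ (L : ℝ), 1 ≤ L → ∀ k : Fin 3,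
      eLpNorm (trig (cube (2 * L)) fun ξ => ((freqNorm ξ ^ (2 * α) : ℝ) : ℂ) * testCoeff L ξ k)
        1 torusMeasure ≤ ENNReal.ofReal (C * L ^ (2 * α + 1)) := by
  -- The symbol is homogeneous of degree 2α + 1 and smooth only away from the origin, which the
  -- annular multiplier bound permits.
  let G : Fin 3 → R3 → ℂ := fun k y => Complex.I * ((‖y‖ ^ (2 * α) * rot y k : ℝ) : ℂ)
  have hG : ∀ k y, y ≠ 0 → ContDiffAt ℝ ((⊤ : ℕ∞) : WithTop ℕ∞) (G k) y := by
    intro k y hy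
    refine contDiffAt_const.mul (Complex.ofRealCLM.contDiff.contDiffAt.comp y ?_)
    exact ((contDiffAt_norm ℝ hy).rpow_const_of_ne (norm_ne_zero_iff.2 hy)).mul (contDiffAt_rot k y)
  choose A hA h using fun k => exists_eLpNorm_annular_le hχ (hG k)
  refine ⟨(∑ k, A k) * 16, mul_nonneg (Finset.sum_nonneg fun k _ => hA k) (by norm_num),
    fun L hL k => ?_⟩
  have hL0 : 0 < L := by linarith
  have h1 : (trig (cube (2 * L)) fun ξ => ((freqNorm ξ ^ (2 * α) : ℝ) : ℂ) * testCoeff L ξ k) =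
      ((L ^ (2 * α + 1) : ℝ) : ℂ) • trig (cube (2 * L)) fun ξ => G k (scaled L ξ) * bump L ξ := by
    funext x
    rw [Pi.smul_apply, smul_eq_mul, ← trig_smul]
    refine congrFun (trig_congr fun ξ _ => ?_) x
    simp only [G, rot_scaled, norm_scaled hL0, testCoeff_apply]
    rw [Real.div_rpow (freqNorm_nonneg ξ) hL0.le, Real.rpow_add_one hL0.ne']
    have hLc : (L : ℂ) ≠ 0 := by exact_mod_cast hL0.ne'
    have hLc' : ((L ^ (2 * α) : ℝ) : ℂ) ≠ 0 := by exact_mod_cast (Real.rpow_pos_of_pos hL0 _).ne'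
    rw [Complex.ofReal_mul, Complex.ofReal_mul, Complex.ofReal_div, Complex.ofReal_div]
    field_simp
  rw [h1, eLpNorm_const_smul, ← ofReal_norm, Complex.norm_real, Real.norm_of_nonneg (by positivity)]
  have h2 := h k L hL0 1 le_rfl (cube (2 * L)) (fun ξ => (bump L ξ : ℂ)) fun ξ _ h0 =>
    freqNorm_of_bump_ne_zero hL0.le (by exact_mod_cast h0)
  have hle : A k ≤ ∑ k, A k := Finset.single_le_sum (fun k _ => hA k) (Finset.mem_univ k)
  refine (mul_le_mul_right (h2.trans (mul_le_mul' (ENNReal.ofReal_le_ofReal hle)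
    (eLpNorm_trig_bump_le hL))) _).trans (le_of_eq ?_)
  have hs : 0 ≤ ∑ k, A k := (hA k).trans hle
  rw [← ENNReal.ofReal_mul hs, ← ENNReal.ofReal_mul (by positivity)]
  congr 1; ring

/-! ### The energy flux of the datum through one shell -/

/-- The `j`-th shell is far from all other shells. -/
def IsSeparated (q : ℕ → ℕ) (j : ℕ) : Prop :=
  (∀ i < j, q i + 8 ≤ q j) ∧ ∀ i > j, q j + 8 ≤ q i

theorem wavenumber_mul_le {m n : ℕ} (h : m + 8 ≤ n) : 256 * wavenumber m ≤ wavenumber n := by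
  rw [wavenumber_natCast, wavenumber_natCast]
  refine le_trans (le_of_eq ?_) (pow_le_pow_right₀ one_le_two h)
  rw [pow_add]; ring

/-- The separation by 8 gives a factor 2⁸ = 256. Later pieces live above (9/20)·256 L > 100 L, and
earlier ones have coordinates below (23/20) L/256 < L/200. So below 100 L the datum is the j-th
piece plus a cluster around the origin. -/
theorem datumCoeff_cases {α : ℝ} {q : ℕ → ℕ} (hq : StrictMono q) {j : ℕ} (hj : IsSeparated q j)
    {ξ : Freq} (hξ : freqNorm ξ < 100 * wavenumber (q j)) (h : datumCoeff α q ξ ≠ 0) :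
    (pieceCoeff α (q j) ξ ≠ 0 ∧ datumCoeff α q ξ = pieceCoeff α (q j) ξ) ∨
      ∀ i, |(ξ i : ℝ)| ≤ wavenumber (q j) / 200 := by
  have hL := wavenumber_pos (q j)
  have hgt : ∀ i > j, pieceCoeff α (q i) ξ = 0 := fun i hi => by
    by_contra hne
    have h1 := (pieceCoeff_freqNorm hne).1
    have h2 := wavenumber_mul_le (hj.2 i hi)
    linarith
  have hlt : ∀ i < j, pieceCoeff α (q i) ξ ≠ 0 → ∀ k, |(ξ k : ℝ)| ≤ wavenumber (q j) / 200 := by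
    intro i hi hne k
    have h1 := (pieceCoeff_support hne).1 k
    have h2 := wavenumber_mul_le (hj.1 i hi)
    linarith
  by_cases hp : pieceCoeff α (q j) ξ = 0
  · right
    by_contra hn
    refine h ((hasSum_pieceCoeff α hq ξ).unique ?_)
    have : (fun i => pieceCoeff α (q i) ξ) = fun _ => 0 := by
      funext i
      rcases lt_trichotomy i j with hi | rfl | hi
      · by_contra hne
        exact hn (hlt i hi hne)
      · exact hp
      · exact hgt i hi
    rw [this]
    exact hasSum_zero
  · left
    refine ⟨hp, (hasSum_pieceCoeff α hq ξ).unique (hasSum_single j fun i hi => ?_)⟩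
    by_contra hne
    rcases lt_or_gt_of_ne hi with hi | hi
    · have h1 := hlt i hi hne
      rcases (pieceCoeff_support hp).2 with h2 | h2
      · linarith [h1 0]
      · linarith [h1 2]
    · exact hne (hgt i hi)

/-- The frequency is near a given point of the plane spanned by the coordinates `0` and `2`. -/
def IsNear (a b L : ℝ) (ξ : Freq) : Prop :=
  (a * L - 3 / 20 * L ≤ ξ 0 ∧ (ξ 0 : ℝ) ≤ a * L + 3 / 20 * L) ∧
    b * L - 3 / 20 * L ≤ ξ 2 ∧ (ξ 2 : ℝ) ≤ b * L + 3 / 20 * L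

/-- In the plane of the coordinates 0 and 2, in units of L, the spectrum clusters at ±(1, 0), ±(0,
1/2), ±(1, 1/2) and the origin. Block membership is kept only for A and B, the blocks whose
interaction counts. -/
theorem datumCoeff_location {α : ℝ} {q : ℕ → ℕ} (hq : StrictMono q) {j : ℕ}
    (hj : IsSeparated q j) {ξ : Freq} (hξ : freqNorm ξ < 100 * wavenumber (q j))
    (h : datumCoeff α q ξ ≠ 0) :
    (ξ ∈ blockA (wavenumber (q j)) ∧ IsNear 1 0 (wavenumber (q j)) ξ) ∨
    (-ξ ∈ blockA (wavenumber (q j)) ∧ IsNear (-1) 0 (wavenumber (q j)) ξ) ∨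
    (ξ ∈ blockB (wavenumber (q j) / 2) ∧ IsNear 0 (1 / 2) (wavenumber (q j)) ξ) ∨
    (-ξ ∈ blockB (wavenumber (q j) / 2) ∧ IsNear 0 (-(1 / 2)) (wavenumber (q j)) ξ) ∨
    IsNear 1 (1 / 2) (wavenumber (q j)) ξ ∨ IsNear (-1) (-(1 / 2)) (wavenumber (q j)) ξ ∨
    IsNear 0 0 (wavenumber (q j)) ξ := by
  have hL := wavenumber_pos (q j)
  rcases datumCoeff_cases hq hj hξ h with ⟨hp, -⟩ | h1
  · rcases pieceCoeff_eq_zero_or α (q j) ξ with h0 | h1 | h1 | h1 | h1 | h1 | h1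
    · exact absurd h0 hp
    · left
      refine ⟨h1, ?_⟩
      obtain ⟨⟨h1, h2⟩, ⟨h3, h4⟩, h5, h6⟩ := h1
      unfold IsNear
      refine ⟨⟨?_, ?_⟩, ?_, ?_⟩ <;> linarith
    · right; left
      refine ⟨h1, ?_⟩
      obtain ⟨⟨h1, h2⟩, ⟨h3, h4⟩, h5, h6⟩ := h1
      simp only [Pi.neg_apply, Int.cast_neg] at *
      unfold IsNear
      refine ⟨⟨?_, ?_⟩, ?_, ?_⟩ <;> linarith
    · right; right; left
      refine ⟨h1, ?_⟩
      obtain ⟨⟨h1, h2⟩, ⟨h3, h4⟩, h5, h6⟩ := h1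
      unfold IsNear
      refine ⟨⟨?_, ?_⟩, ?_, ?_⟩ <;> linarith
    · right; right; right; left
      refine ⟨h1, ?_⟩
      obtain ⟨⟨h1, h2⟩, ⟨h3, h4⟩, h5, h6⟩ := h1
      simp only [Pi.neg_apply, Int.cast_neg] at *
      unfold IsNear
      refine ⟨⟨?_, ?_⟩, ?_, ?_⟩ <;> linarith
    · right; right; right; right; left
      obtain ⟨⟨h1, h2⟩, ⟨h3, h4⟩, h5, h6⟩ := mem_blockC h1
      unfold IsNear
      refine ⟨⟨?_, ?_⟩, ?_, ?_⟩ <;> linarith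
    · right; right; right; right; right; left
      obtain ⟨⟨h1, h2⟩, ⟨h3, h4⟩, h5, h6⟩ := mem_blockC h1
      simp only [Pi.neg_apply, Int.cast_neg] at *
      unfold IsNear
      refine ⟨⟨?_, ?_⟩, ?_, ?_⟩ <;> linarith
  · right; right; right; right; right; right
    have h2 := abs_le.1 (h1 0)
    have h3 := abs_le.1 (h1 2)
    unfold IsNear
    refine ⟨⟨?_, ?_⟩, ?_, ?_⟩ <;> linarith [h2.1, h2.2, h3.1, h3.2]

theorem testRegion_isNear {L : ℝ} {ξ : Freq} (h : ξ ∈ testRegion L ∨ -ξ ∈ testRegion L) :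
    IsNear (-1) (1 / 2) L ξ ∨ IsNear 1 (-(1 / 2)) L ξ := by
  rcases h with ⟨⟨h1, h2⟩, -, h3, h4⟩ | ⟨⟨h1, h2⟩, -, h3, h4⟩
  · left
    unfold IsNear
    refine ⟨⟨?_, ?_⟩, ?_, ?_⟩ <;> linarith
  · right
    simp only [Pi.neg_apply, Int.cast_neg] at *
    unfold IsNear
    refine ⟨⟨?_, ?_⟩, ?_, ?_⟩ <;> linarith

/-- The points ±(-1, 1/2) are not among the seven clusters, since C supplies only ±(1, 1/2). This
makes the viscous term blind to the datum. -/
theorem datumCoeff_eq_zero_of_mem_testRegion {α : ℝ} {q : ℕ → ℕ} (hq : StrictMono q) {j : ℕ}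
    (hj : IsSeparated q j) {ξ : Freq}
    (h : ξ ∈ testRegion (wavenumber (q j)) ∨ -ξ ∈ testRegion (wavenumber (q j))) :
    datumCoeff α q ξ = 0 := by
  have hL := wavenumber_pos (q j)
  by_contra hne
  have hξ : freqNorm ξ < 100 * wavenumber (q j) := by
    have : freqNorm ξ ≤ 2 * wavenumber (q j) := by
      rcases h with h | h
      · exact (freqNorm_of_mem_testRegion hL.le h).2
      · rw [← freqNorm_neg]; exact (freqNorm_of_mem_testRegion hL.le h).2
    linarith
  have h1 := datumCoeff_location hq hj hξ hne
  have h2 := testRegion_isNear h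
  simp only [IsNear] at h1 h2
  rcases h1 with ⟨-, h1⟩ | ⟨-, h1⟩ | ⟨-, h1⟩ | ⟨-, h1⟩ | h1 | h1 | h1 <;>
  rcases h2 with h2 | h2 <;>
  linarith [h1.1.1, h1.1.2, h1.2.1, h1.2.2, h2.1.1, h2.1.2, h2.2.1, h2.2.2]

/-- Three tolerances of 3/20 add up to 9/20, less than the spacing 1/2 of the centres, so the
centres themselves must add up. Among the 49 pairs only (0, 1/2) + (-1, 0) and its reflection, in
either order, give ±(-1, 1/2). -/
theorem near_pair {PA PA' PB PB' QA QA' QB QB' : Prop} {L x0 x2 y0 y2 : ℝ} (hL : 0 < L)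
    {N : ℝ → ℝ → ℝ → ℝ → Prop} (hN : ∀ a b u v, N a b u v →
      (a * L - 3 / 20 * L ≤ u ∧ u ≤ a * L + 3 / 20 * L) ∧
        b * L - 3 / 20 * L ≤ v ∧ v ≤ b * L + 3 / 20 * L)
    (h1 : (PA ∧ N 1 0 x0 x2) ∨ (PA' ∧ N (-1) 0 x0 x2) ∨ (PB ∧ N 0 (1 / 2) x0 x2) ∨
      (PB' ∧ N 0 (-(1 / 2)) x0 x2) ∨ N 1 (1 / 2) x0 x2 ∨ N (-1) (-(1 / 2)) x0 x2 ∨ N 0 0 x0 x2)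
    (h2 : (QA ∧ N 1 0 y0 y2) ∨ (QA' ∧ N (-1) 0 y0 y2) ∨ (QB ∧ N 0 (1 / 2) y0 y2) ∨
      (QB' ∧ N 0 (-(1 / 2)) y0 y2) ∨ N 1 (1 / 2) y0 y2 ∨ N (-1) (-(1 / 2)) y0 y2 ∨ N 0 0 y0 y2)
    (h3 : N (-1) (1 / 2) (x0 + y0) (x2 + y2) ∨ N 1 (-(1 / 2)) (x0 + y0) (x2 + y2)) :
    (PB ∧ QA') ∨ (PB' ∧ QA) ∨ (QB ∧ PA') ∨ (QB' ∧ PA) := by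
  have key : ∀ {a b c d e f : ℝ}, N a b x0 x2 → N c d y0 y2 → N e f (x0 + y0) (x2 + y2) →
      |a + c - e| ≤ 9 / 20 ∧ |b + d - f| ≤ 9 / 20 := by
    intro a b c d e f h1 h2 h3
    obtain ⟨⟨a1, a2⟩, a3, a4⟩ := hN _ _ _ _ h1
    obtain ⟨⟨b1, b2⟩, b3, b4⟩ := hN _ _ _ _ h2
    obtain ⟨⟨c1, c2⟩, c3, c4⟩ := hN _ _ _ _ h3
    constructor <;> rw [abs_le] <;> constructor <;> refine le_of_mul_le_mul_right ?_ hL <;>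
      linarith only [a1, a2, a3, a4, b1, b2, b3, b4, c1, c2, c3, c4]
  rcases h1 with ⟨m1, h1⟩ | ⟨m1, h1⟩ | ⟨m1, h1⟩ | ⟨m1, h1⟩ | h1 | h1 | h1 <;>
  rcases h2 with ⟨m2, h2⟩ | ⟨m2, h2⟩ | ⟨m2, h2⟩ | ⟨m2, h2⟩ | h2 | h2 | h2 <;>
  first
  | exact Or.inl ⟨m1, m2⟩
  | exact Or.inr (Or.inl ⟨m1, m2⟩)
  | exact Or.inr (Or.inr (Or.inl ⟨m2, m1⟩))
  | exact Or.inr (Or.inr (Or.inr ⟨m2, m1⟩))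
  | (exfalso
     rcases h3 with h3 | h3 <;> have k := key h1 h2 h3 <;> clear key h1 h2 h3 <;> norm_num at k)

/-- The only interactions of the datum that reach the test region are those between the blocks
`A` and `B` of the same shell. -/
theorem interaction_cases {α : ℝ} {q : ℕ → ℕ} (hq : StrictMono q) {j : ℕ}
    (hj : IsSeparated q j) {η ζ : Freq} (hη : freqNorm η < 100 * wavenumber (q j))
    (hζ : freqNorm ζ < 100 * wavenumber (q j)) (hη0 : datumCoeff α q η ≠ 0)
    (hζ0 : datumCoeff α q ζ ≠ 0) (h : bump (wavenumber (q j)) (η + ζ) ≠ 0) :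
    (η ∈ blockB (wavenumber (q j) / 2) ∧ -ζ ∈ blockA (wavenumber (q j))) ∨
    (-η ∈ blockB (wavenumber (q j) / 2) ∧ ζ ∈ blockA (wavenumber (q j))) ∨
    (ζ ∈ blockB (wavenumber (q j) / 2) ∧ -η ∈ blockA (wavenumber (q j))) ∨
    (-ζ ∈ blockB (wavenumber (q j) / 2) ∧ η ∈ blockA (wavenumber (q j))) := by
  have h3 := testRegion_isNear (mem_testRegion_of_bump_ne_zero h)
  simp only [IsNear, Pi.add_apply, Int.cast_add] at h3
  exact near_pair (wavenumber_pos (q j)) (fun _ _ _ _ h => h)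
    (datumCoeff_location hq hj hη hη0) (datumCoeff_location hq hj hζ hζ0) h3

theorem abs_mul_le_of_le {x y a b : ℝ} (hx : |x| ≤ a) (hy : |y| ≤ b) : |x * y| ≤ a * b := by
  rw [abs_mul]
  exact mul_le_mul hx hy (abs_nonneg _) ((abs_nonneg _).trans hx)

theorem abs_div_le_of_le {x e a m : ℝ} (hm : 0 < m) (he : m ≤ e) (ha : 0 ≤ a)
    (hx : |x| ≤ a * m) : |x / e| ≤ a := by
  rw [abs_div, abs_of_pos (hm.trans_le he), div_le_iff₀ (hm.trans_le he)]
  exact hx.trans (mul_le_mul_of_nonneg_left he ha)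

/-- The symbol of one interaction between the blocks `B` and `-A`. -/
theorem interaction_lower_bound {L x0 x1 x2 y0 y1 y2 : ℝ} (hL : 0 < L)
    (hx0 : |x0| ≤ L / 20) (hx1 : |x1| ≤ L / 20) (hx2 : 9 / 20 * L ≤ x2) (hx2' : x2 ≤ 11 / 20 * L)
    (hy0 : y0 ≤ -(9 / 10 * L)) (hy0' : -(11 / 10 * L) ≤ y0) (hy1 : |y1| ≤ L / 10)
    (hy2 : |y2| ≤ L / 10) :
    3 / 5 * L ^ 2 ≤
      (y0 - (x0 * y0 + x1 * y1 + x2 * y2) * x0 / (x0 ^ 2 + x1 ^ 2 + x2 ^ 2)) *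
        (x0 + y0 - y1 * (x0 * y1 - x1 * y0) / (y0 ^ 2 + y1 ^ 2 + y2 ^ 2)) -
      (x1 - (x0 * y0 + x1 * y1 + x2 * y2) * y1 / (y0 ^ 2 + y1 ^ 2 + y2 ^ 2)) *
        (x1 + y1 + x0 * (x1 * y0 - x0 * y1) / (x0 ^ 2 + x1 ^ 2 + x2 ^ 2)) := by
  have hy0a : |y0| ≤ 11 / 10 * L := abs_le.2 ⟨by linarith, by linarith⟩
  have hx2a : |x2| ≤ 11 / 20 * L := abs_le.2 ⟨by linarith, by linarith⟩
  have he : 81 / 400 * L ^ 2 ≤ x0 ^ 2 + x1 ^ 2 + x2 ^ 2 := by nlinarith [sq_nonneg x0, sq_nonneg x1]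
  have hf : 81 / 100 * L ^ 2 ≤ y0 ^ 2 + y1 ^ 2 + y2 ^ 2 := by nlinarith [sq_nonneg y1, sq_nonneg y2]
  have hL2 : 0 < L ^ 2 := by positivity
  have hdot : |x0 * y0 + x1 * y1 + x2 * y2| ≤ 23 / 200 * L ^ 2 := by
    refine (abs_add_three _ _ _).trans ?_
    linarith [abs_mul_le_of_le hx0 hy0a, abs_mul_le_of_le hx1 hy1, abs_mul_le_of_le hx2a hy2,
      show L / 20 * (11 / 10 * L) + L / 20 * (L / 10) + 11 / 20 * L * (L / 10) =
        23 / 200 * L ^ 2 by ring]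
  have hcross : |x0 * y1 - x1 * y0| ≤ 3 / 50 * L ^ 2 := by
    refine (abs_sub _ _).trans ?_
    linarith [abs_mul_le_of_le hx0 hy1, abs_mul_le_of_le hx1 hy0a,
      show L / 20 * (L / 10) + L / 20 * (11 / 10 * L) = 3 / 50 * L ^ 2 by ring]
  have hcross' : |x1 * y0 - x0 * y1| ≤ 3 / 50 * L ^ 2 := by rwa [abs_sub_comm]
  have hL3 : 0 < L ^ 3 := by positivity
  have t1 : |(x0 * y0 + x1 * y1 + x2 * y2) * x0 / (x0 ^ 2 + x1 ^ 2 + x2 ^ 2)| ≤ 3 / 100 * L := by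
    refine abs_div_le_of_le (by positivity) he (by positivity)
      ((abs_mul_le_of_le hdot hx0).trans ?_)
    nlinarith
  have t2 : |y1 * (x0 * y1 - x1 * y0) / (y0 ^ 2 + y1 ^ 2 + y2 ^ 2)| ≤ 1 / 100 * L := by
    refine abs_div_le_of_le (by positivity) hf (by positivity)
      ((abs_mul_le_of_le hy1 hcross).trans ?_)
    nlinarith
  have t3 : |(x0 * y0 + x1 * y1 + x2 * y2) * y1 / (y0 ^ 2 + y1 ^ 2 + y2 ^ 2)| ≤ 1 / 50 * L := by
    refine abs_div_le_of_le (by positivity) hf (by positivity)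
      ((abs_mul_le_of_le hdot hy1).trans ?_)
    nlinarith
  have t4 : |x0 * (x1 * y0 - x0 * y1) / (x0 ^ 2 + x1 ^ 2 + x2 ^ 2)| ≤ 1 / 50 * L := by
    refine abs_div_le_of_le (by positivity) he (by positivity)
      ((abs_mul_le_of_le hx0 hcross').trans ?_)
    nlinarith
  set s1 := (x0 * y0 + x1 * y1 + x2 * y2) * x0 / (x0 ^ 2 + x1 ^ 2 + x2 ^ 2)
  set s2 := y1 * (x0 * y1 - x1 * y0) / (y0 ^ 2 + y1 ^ 2 + y2 ^ 2)
  set s3 := (x0 * y0 + x1 * y1 + x2 * y2) * y1 / (y0 ^ 2 + y1 ^ 2 + y2 ^ 2)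
  set s4 := x0 * (x1 * y0 - x0 * y1) / (x0 ^ 2 + x1 ^ 2 + x2 ^ 2)
  rw [abs_le] at t1 t2 t3 t4 hx0 hx1 hy1
  -- The main product is close to y0², and s1, …, s4 are the corrections due to the Leray
  -- projections. The margins give 0.87 · 0.84 - 0.07 · 0.17 > 3/5.
  have b1 : 87 / 100 * L ≤ -(y0 - s1) := by linarith [t1.1]
  have b2 : 84 / 100 * L ≤ -(x0 + y0 - s2) := by linarith [t2.1, hx0.2]
  have b3 : |x1 - s3| ≤ 7 / 100 * L :=
    abs_le.2 ⟨by linarith [t3.2, hx1.1], by linarith [t3.1, hx1.2]⟩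
  have b4 : |x1 + y1 + s4| ≤ 17 / 100 * L :=
    abs_le.2 ⟨by linarith [t4.1, hx1.1, hy1.1], by linarith [t4.2, hx1.2, hy1.2]⟩
  have m1 : 87 / 100 * L * (84 / 100 * L) ≤ -(y0 - s1) * -(x0 + y0 - s2) :=
    mul_le_mul b1 b2 (by positivity) (by linarith)
  have m2 := (abs_le.1 (abs_mul_le_of_le b3 b4)).2
  rw [neg_mul_neg] at m1
  nlinarith

/-- The contribution of a pair of frequencies to the energy flux. -/
noncomputable def interaction (L : ℝ) (v : Freq → C3) (η ζ : Freq) : ℂ :=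
  -((∑ i, (ζ i : ℂ) * v η i) * (∑ k, (rot (fun i => ((η + ζ) i : ℝ)) k : ℂ) * v ζ k)) *
    bump L (η + ζ)

/-- The part of the symbol that is a real number. -/
noncomputable def lerayReal (k : Fin 3) (ξ : Freq) (i : Fin 3) : ℝ :=
  (if i = k then 1 else 0) - (ξ i : ℝ) * (ξ k : ℝ) / freqNorm ξ ^ 2

theorem lerayVec_apply (k : Fin 3) (ξ : Freq) (i : Fin 3) :
    lerayVec k ξ i = (lerayReal k ξ i : ℂ) := rfl

/-- When v η transports v ζ, the symbol is about ζ₀², of order L². The opposite order carries a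
factor close to η₁ and is a small error. The symbol is quadratic, so reflecting both frequencies
reduces the second case to the first. -/
theorem interaction_AB {L a : ℝ} (hL : 0 < L) {v : Freq → C3} {η ζ : Freq}
    (hη : ∀ i, v η i = (a : ℂ) * lerayVec 0 η i) (hζ : ∀ i, v ζ i = (a : ℂ) * lerayVec 1 ζ i)
    (h : (η ∈ blockB (L / 2) ∧ -ζ ∈ blockA L) ∨ (-η ∈ blockB (L / 2) ∧ ζ ∈ blockA L)) :
    3 / 5 * (a ^ 2 * L ^ 2 * bump L (η + ζ)) ≤
      (interaction L v η ζ + interaction L v ζ η).re := by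
  have heq : interaction L v η ζ + interaction L v ζ η =
      ((a ^ 2 * bump L (η + ζ) *
        (((ζ 0 : ℝ) - ((η 0 : ℝ) * ζ 0 + η 1 * ζ 1 + η 2 * ζ 2) * η 0 /
            ((η 0 : ℝ) ^ 2 + (η 1 : ℝ) ^ 2 + (η 2 : ℝ) ^ 2)) *
          ((η 0 : ℝ) + ζ 0 - ζ 1 * (η 0 * ζ 1 - η 1 * ζ 0) /
            ((ζ 0 : ℝ) ^ 2 + (ζ 1 : ℝ) ^ 2 + (ζ 2 : ℝ) ^ 2)) -
        ((η 1 : ℝ) - ((η 0 : ℝ) * ζ 0 + η 1 * ζ 1 + η 2 * ζ 2) * ζ 1 /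
            ((ζ 0 : ℝ) ^ 2 + (ζ 1 : ℝ) ^ 2 + (ζ 2 : ℝ) ^ 2)) *
          ((η 1 : ℝ) + ζ 1 + η 0 * (η 1 * ζ 0 - η 0 * ζ 1) /
            ((η 0 : ℝ) ^ 2 + (η 1 : ℝ) ^ 2 + (η 2 : ℝ) ^ 2))) : ℝ) : ℂ) := by
    have he : freqNorm η ^ 2 = (η 0 : ℝ) ^ 2 + (η 1 : ℝ) ^ 2 + (η 2 : ℝ) ^ 2 := by
      rw [freqNorm_sq, Fin.sum_univ_three]
    have hf : freqNorm ζ ^ 2 = (ζ 0 : ℝ) ^ 2 + (ζ 1 : ℝ) ^ 2 + (ζ 2 : ℝ) ^ 2 := by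
      rw [freqNorm_sq, Fin.sum_univ_three]
    simp only [interaction, hη, hζ, lerayVec_apply, lerayReal, he, hf, add_comm ζ η,
      Fin.sum_univ_three, rot, Pi.add_apply, Matrix.cons_val]
    simp only [Fin.isValue, if_true, if_false, Fin.reduceEq, zero_ne_one, one_ne_zero]
    push_cast
    ring
  rw [heq, Complex.ofReal_re]
  have hb := bump_nonneg hL.le (η + ζ)
  have key : 3 / 5 * L ^ 2 ≤
        (((ζ 0 : ℝ) - ((η 0 : ℝ) * ζ 0 + η 1 * ζ 1 + η 2 * ζ 2) * η 0 /
            ((η 0 : ℝ) ^ 2 + (η 1 : ℝ) ^ 2 + (η 2 : ℝ) ^ 2)) *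
          ((η 0 : ℝ) + ζ 0 - ζ 1 * (η 0 * ζ 1 - η 1 * ζ 0) /
            ((ζ 0 : ℝ) ^ 2 + (ζ 1 : ℝ) ^ 2 + (ζ 2 : ℝ) ^ 2)) -
        ((η 1 : ℝ) - ((η 0 : ℝ) * ζ 0 + η 1 * ζ 1 + η 2 * ζ 2) * ζ 1 /
            ((ζ 0 : ℝ) ^ 2 + (ζ 1 : ℝ) ^ 2 + (ζ 2 : ℝ) ^ 2)) *
          ((η 1 : ℝ) + ζ 1 + η 0 * (η 1 * ζ 0 - η 0 * ζ 1) /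
            ((η 0 : ℝ) ^ 2 + (η 1 : ℝ) ^ 2 + (η 2 : ℝ) ^ 2))) := by
    rcases h with ⟨⟨⟨h1, h2⟩, ⟨h3, h4⟩, h5, h6⟩, ⟨h7, h8⟩, ⟨h9, h10⟩, h11, h12⟩ |
      ⟨⟨⟨h1, h2⟩, ⟨h3, h4⟩, h5, h6⟩, ⟨h7, h8⟩, ⟨h9, h10⟩, h11, h12⟩
    · simp only [Pi.neg_apply, Int.cast_neg] at *
      exact interaction_lower_bound (x0 := (η 0 : ℝ)) (x1 := (η 1 : ℝ)) (x2 := (η 2 : ℝ))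
        (y0 := (ζ 0 : ℝ)) (y1 := (ζ 1 : ℝ)) (y2 := (ζ 2 : ℝ)) hL
        (abs_le.2 ⟨by linarith, by linarith⟩) (abs_le.2 ⟨by linarith, by linarith⟩)
        (by linarith) (by linarith) (by linarith) (by linarith)
        (abs_le.2 ⟨by linarith, by linarith⟩) (abs_le.2 ⟨by linarith, by linarith⟩)
    · simp only [Pi.neg_apply, Int.cast_neg] at *
      refine (interaction_lower_bound (x0 := -(η 0 : ℝ)) (x1 := -(η 1 : ℝ)) (x2 := -(η 2 : ℝ))
        (y0 := -(ζ 0 : ℝ)) (y1 := -(ζ 1 : ℝ)) (y2 := -(ζ 2 : ℝ)) hL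
        (abs_le.2 ⟨by linarith, by linarith⟩) (abs_le.2 ⟨by linarith, by linarith⟩)
        (by linarith) (by linarith) (by linarith) (by linarith)
        (abs_le.2 ⟨by linarith, by linarith⟩) (abs_le.2 ⟨by linarith, by linarith⟩)).trans
        (le_of_eq ?_)
      simp only [neg_sq]
      ring
  have := mul_le_mul_of_nonneg_left key (mul_nonneg (sq_nonneg a) hb)
  refine le_trans (le_of_eq (by ring)) this

/-- The amplitude of the datum in the shell of length `L`. -/
noncomputable def amplitude (α L : ℝ) : ℝ := L ^ (2 * α - 4)

theorem datumCoeff_eq_pieceCoeff {α : ℝ} {q : ℕ → ℕ} (hq : StrictMono q) {j : ℕ}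
    (hj : IsSeparated q j) {ξ : Freq} (hξ : freqNorm ξ < 100 * wavenumber (q j))
    (h : wavenumber (q j) / 200 < |(ξ 0 : ℝ)| ∨ wavenumber (q j) / 200 < |(ξ 2 : ℝ)|) :
    datumCoeff α q ξ = pieceCoeff α (q j) ξ := by
  have hlow : ¬ ∀ i, |(ξ i : ℝ)| ≤ wavenumber (q j) / 200 := fun h' => by
    rcases h with h | h
    · exact absurd (h' 0) (not_le.2 h)
    · exact absurd (h' 2) (not_le.2 h)
  have hL := wavenumber_pos (q j)
  refine (hasSum_pieceCoeff α hq ξ).unique (hasSum_single j fun i hi => ?_)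
  by_contra hne
  rcases lt_or_gt_of_ne hi with hi | hi
  · refine hlow fun k => ?_
    have h1 := (pieceCoeff_support hne).1 k
    have h2 := wavenumber_mul_le (hj.1 i hi)
    linarith
  · have h1 := (pieceCoeff_freqNorm hne).1
    have h2 := wavenumber_mul_le (hj.2 i hi)
    linarith

theorem datumCoeff_of_blockA {α : ℝ} {q : ℕ → ℕ} (hq : StrictMono q) {j : ℕ}
    (hj : IsSeparated q j) {ξ : Freq} (hξ : freqNorm ξ < 100 * wavenumber (q j))
    (h : ξ ∈ blockA (wavenumber (q j)) ∨ -ξ ∈ blockA (wavenumber (q j))) (i : Fin 3) :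
    datumCoeff α q ξ i = ((amplitude α (wavenumber (q j)) : ℝ) : ℂ) * lerayVec 1 ξ i := by
  have hL := wavenumber_pos (q j)
  rw [datumCoeff_eq_pieceCoeff hq hj hξ]
  · rcases h with h | h
    · exact pieceCoeff_of_mem_blockA h i
    · exact pieceCoeff_of_neg_mem_blockA h i
  · left
    rcases h with ⟨⟨h1, -⟩, -⟩ | ⟨⟨h1, -⟩, -⟩
    · linarith [le_abs_self (ξ 0 : ℝ)]
    · simp only [Pi.neg_apply, Int.cast_neg] at h1
      linarith [neg_le_abs (ξ 0 : ℝ)]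

theorem datumCoeff_of_blockB {α : ℝ} {q : ℕ → ℕ} (hq : StrictMono q) {j : ℕ}
    (hj : IsSeparated q j) {ξ : Freq} (hξ : freqNorm ξ < 100 * wavenumber (q j))
    (h : ξ ∈ blockB (wavenumber (q j) / 2) ∨ -ξ ∈ blockB (wavenumber (q j) / 2)) (i : Fin 3) :
    datumCoeff α q ξ i = ((amplitude α (wavenumber (q j)) : ℝ) : ℂ) * lerayVec 0 ξ i := by
  have hL := wavenumber_pos (q j)
  rw [datumCoeff_eq_pieceCoeff hq hj hξ]
  · rcases h with h | h
    · exact pieceCoeff_of_mem_blockB h i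
    · exact pieceCoeff_of_neg_mem_blockB h i
  · right
    rcases h with ⟨-, -, h1, -⟩ | ⟨-, -, h1, -⟩
    · linarith [le_abs_self (ξ 2 : ℝ)]
    · simp only [Pi.neg_apply, Int.cast_neg] at h1
      linarith [neg_le_abs (ξ 2 : ℝ)]

/-- Positivity of every symmetrised pair permits discarding all pairs except those in B × (-A) from
the flux. -/
theorem interaction_nonneg {α : ℝ} {q : ℕ → ℕ} (hq : StrictMono q) {j : ℕ}
    (hj : IsSeparated q j) {η ζ : Freq} (hη : freqNorm η < 100 * wavenumber (q j))
    (hζ : freqNorm ζ < 100 * wavenumber (q j)) :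
    0 ≤ (interaction (wavenumber (q j)) (datumCoeff α q) η ζ +
      interaction (wavenumber (q j)) (datumCoeff α q) ζ η).re := by
  have hL := wavenumber_pos (q j)
  have hb : 0 ≤ 3 / 5 * (amplitude α (wavenumber (q j)) ^ 2 * wavenumber (q j) ^ 2 *
      bump (wavenumber (q j)) (η + ζ)) := by
    have := bump_nonneg hL.le (η + ζ)
    positivity
  by_cases h0 : bump (wavenumber (q j)) (η + ζ) = 0
  · simp [interaction, h0, add_comm ζ η]
  by_cases h1 : datumCoeff α q η = 0
  · simp [interaction, h1]
  by_cases h2 : datumCoeff α q ζ = 0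
  · simp [interaction, h2]
  rcases interaction_cases hq hj hη hζ h1 h2 h0 with h | h | h | h
  · exact hb.trans (interaction_AB hL (datumCoeff_of_blockB hq hj hη (Or.inl h.1))
      (datumCoeff_of_blockA hq hj hζ (Or.inr h.2)) (Or.inl h))
  · exact hb.trans (interaction_AB hL (datumCoeff_of_blockB hq hj hη (Or.inr h.1))
      (datumCoeff_of_blockA hq hj hζ (Or.inl h.2)) (Or.inr h))
  · rw [add_comm η ζ] at hb
    rw [add_comm (interaction _ _ _ _)]
    exact hb.trans (interaction_AB hL (datumCoeff_of_blockB hq hj hζ (Or.inl h.1))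
      (datumCoeff_of_blockA hq hj hη (Or.inr h.2)) (Or.inl h))
  · rw [add_comm η ζ] at hb
    rw [add_comm (interaction _ _ _ _)]
    exact hb.trans (interaction_AB hL (datumCoeff_of_blockB hq hj hζ (Or.inr h.1))
      (datumCoeff_of_blockA hq hj hη (Or.inl h.2)) (Or.inr h))

/-! ### Summation of the interactions. -/

/-- The sum is the additive energy, the sum of the squares of `corr`. Cauchy-Schwarz applies, with
total mass |A| |B| of order L⁶ on at most 125 L³ frequencies. The bound L ≥ 20 gives L/2 ≥ 10, as
counting in B requires. -/
theorem sum_corr_sub_ge {L : ℝ} (hL : 20 ≤ L) :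
    L ^ 9 / (125 * (200 : ℝ) ^ 6) ≤ ∑ p ∈ boxB (L / 2) ×ˢ boxA L, corr L (p.1 - p.2) := by
  have hL0 : 0 < L := by linarith
  have hmaps : ∀ p ∈ boxB (L / 2) ×ˢ boxA L, p.1 - p.2 ∈ cube (2 * L) := by
    intro p hp
    obtain ⟨h1, h2⟩ := Finset.mem_product.1 hp
    refine mem_cube_of_freqNorm_le (freqNorm_of_mem_testRegion hL0.le (sub_mem_testRegion ?_ ?_)).2
    · rw [blockB_eq]; exact h1
    · rw [blockA_eq]; exact h2
  have h1 : ∑ p ∈ boxB (L / 2) ×ˢ boxA L, corr L (p.1 - p.2) =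
      ∑ ξ ∈ cube (2 * L), corr L ξ ^ 2 := by
    rw [← Finset.sum_fiberwise_of_maps_to hmaps]
    refine Finset.sum_congr rfl fun ξ _ => ?_
    have : ∑ p ∈ boxB (L / 2) ×ˢ boxA L with p.1 - p.2 = ξ, corr L (p.1 - p.2) =
        ∑ p ∈ boxB (L / 2) ×ˢ boxA L with p.1 - p.2 = ξ, corr L ξ :=
      Finset.sum_congr rfl fun p hp => by rw [(Finset.mem_filter.1 hp).2]
    rw [this, Finset.sum_const, nsmul_eq_mul, sq]
    rfl
  have h2 : ∑ ξ ∈ cube (2 * L), corr L ξ = ((boxB (L / 2)).card : ℝ) * (boxA L).card := by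
    rw [← Nat.cast_mul, ← Finset.card_product, Finset.card_eq_sum_card_fiberwise hmaps]
    push_cast
    rfl
  have h3 : (L / 20) ^ 3 * (L / 10) ^ 3 ≤ ∑ ξ ∈ cube (2 * L), corr L ξ := by
    rw [h2]
    refine mul_le_mul ?_ (le_card_boxA (by linarith)) (by positivity) (by positivity)
    have := le_card_boxB (M := L / 2) (by linarith)
    rwa [div_div, show (2 : ℝ) * 10 = 20 by norm_num] at this
  have h4 : ((cube (2 * L)).card : ℝ) ≤ 125 * L ^ 3 := by
    refine (card_realBox_le (N := 5 * L) (fun i => ?_) fun i => ?_).trans (le_of_eq ?_)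
    · linarith
    · linarith
    · ring
  have h5 := sq_sum_le_card_mul_sum_sq (s := cube (2 * L)) (f := corr L)
  have h6 : ((L / 20) ^ 3 * (L / 10) ^ 3) ^ 2 ≤ (∑ ξ ∈ cube (2 * L), corr L ξ) ^ 2 :=
    pow_le_pow_left₀ (by positivity) h3 2
  have h7 : 0 ≤ ∑ ξ ∈ cube (2 * L), corr L ξ ^ 2 := Finset.sum_nonneg fun _ _ => sq_nonneg _
  have h8 := h6.trans (h5.trans (mul_le_mul_of_nonneg_right h4 h7))
  rw [h1, div_le_iff₀ (by positivity)]
  have h9 : ((L / 20) ^ 3 * (L / 10) ^ 3) ^ 2 = L ^ 9 / 200 ^ 6 * L ^ 3 := by ring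
  rw [h9] at h8
  have h10 : L ^ 9 / 200 ^ 6 ≤ 125 * ∑ ξ ∈ cube (2 * L), corr L ξ ^ 2 :=
    le_of_mul_le_mul_right (h8.trans (le_of_eq (by ring))) (by positivity : 0 < L ^ 3)
  rw [div_le_iff₀ (by positivity)] at h10
  linarith

theorem sum_bump_sub_ge {L : ℝ} (hL : 20 ≤ L) :
    L ^ 6 / (125 * (200 : ℝ) ^ 6) ≤ ∑ p ∈ boxB (L / 2) ×ˢ boxA L, bump L (p.1 - p.2) := by
  have hL0 : 0 < L := by linarith
  have h : ∑ p ∈ boxB (L / 2) ×ˢ boxA L, (L ^ 3)⁻¹ * corr L (p.1 - p.2) ≤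
      ∑ p ∈ boxB (L / 2) ×ˢ boxA L, bump L (p.1 - p.2) := by
    refine Finset.sum_le_sum fun p _ => ?_
    rw [bump]
    exact mul_le_mul_of_nonneg_left (le_add_of_nonneg_right (corr_nonneg _ _)) (by positivity)
  refine le_trans ?_ h
  rw [← Finset.mul_sum]
  refine le_trans (le_of_eq ?_)
    (mul_le_mul_of_nonneg_left (sum_corr_sub_ge hL) (by positivity))
  field_simp

theorem freqNorm_of_mem_cube {R : ℝ} {ξ : Freq} (h : ξ ∈ cube R) : freqNorm ξ ≤ 2 * R := by
  have h1 := mem_cube.1 h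
  have hR := (abs_nonneg _).trans (h1 0)
  refine (freqNorm_le_of_abs_le h1).trans (mul_le_mul_of_nonneg_right ?_ hR)
  exact Real.sqrt_le_iff.2 ⟨by norm_num, by norm_num⟩

/-- The exponent is (4α - 8) + 2 + 6, from amplitude, symbol and weights. The constant 3/5 is halved
because symmetrisation doubles the sum. -/
theorem sum_interaction_ge {α : ℝ} {q : ℕ → ℕ} (hq : StrictMono q) {j : ℕ}
    (hj : IsSeparated q j) (hL : 20 ≤ wavenumber (q j)) :
    3 / 10 / (125 * (200 : ℝ) ^ 6) * wavenumber (q j) ^ (4 * α) ≤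
      (∑ η ∈ cube (2 * wavenumber (q j)), ∑ ζ ∈ cube (2 * wavenumber (q j)),
        interaction (wavenumber (q j)) (datumCoeff α q) η ζ).re := by
  set L := wavenumber (q j) with hLdef
  have hL0 : 0 < L := by linarith
  set S := cube (2 * L)
  set I := interaction L (datumCoeff α q)
  have hS : ∀ ξ ∈ S, freqNorm ξ < 100 * L := fun ξ hξ => by
    have := freqNorm_of_mem_cube hξ
    linarith
  have hSneg : ∀ ξ ∈ S, -ξ ∈ S := (isRealCoeff_testCoeff hL0.le).neg_mem
  have hsym : 2 * (∑ η ∈ S, ∑ ζ ∈ S, I η ζ).re = ∑ p ∈ S ×ˢ S, (I p.1 p.2 + I p.2 p.1).re := by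
    rw [← Complex.re_sum, Finset.sum_add_distrib, Finset.sum_product, Finset.sum_product_right,
      Complex.add_re]
    ring
  have hBS : ∀ η ∈ boxB (L / 2), η ∈ S := fun η hη => by
    refine mem_cube_of_freqNorm_le (lerayBlock_bounds hL0 (Or.inr (Or.inl rfl)) ?_).2
    rw [blockB_eq]; exact hη
  have hAS : ∀ η ∈ boxA L, η ∈ S := fun η hη => by
    refine mem_cube_of_freqNorm_le (lerayBlock_bounds hL0 (Or.inl rfl) ?_).2
    rw [blockA_eq]; exact hη
  have hsub : (boxB (L / 2) ×ˢ boxA L).image (fun p => (p.1, -p.2)) ⊆ S ×ˢ S := by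
    intro p hp
    obtain ⟨p', hp', rfl⟩ := Finset.mem_image.1 hp
    obtain ⟨h1, h2⟩ := Finset.mem_product.1 hp'
    exact Finset.mem_product.2 ⟨hBS _ h1, hSneg _ (hAS _ h2)⟩
  have h1 : ∑ p ∈ boxB (L / 2) ×ˢ boxA L, (I p.1 (-p.2) + I (-p.2) p.1).re ≤
      ∑ p ∈ S ×ˢ S, (I p.1 p.2 + I p.2 p.1).re := by
    have h2 := Finset.sum_le_sum_of_subset_of_nonneg (f := fun p : Freq × Freq =>
      (I p.1 p.2 + I p.2 p.1).re) hsub fun p hp _ =>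
        interaction_nonneg hq hj (hS _ (Finset.mem_product.1 hp).1)
          (hS _ (Finset.mem_product.1 hp).2)
    rwa [Finset.sum_image (fun p _ p' _ h => by
      rw [Prod.mk.injEq, neg_inj] at h; exact Prod.ext h.1 h.2)] at h2
  have h2 : ∑ p ∈ boxB (L / 2) ×ˢ boxA L,
      3 / 5 * (amplitude α L ^ 2 * L ^ 2 * bump L (p.1 - p.2)) ≤
      ∑ p ∈ boxB (L / 2) ×ˢ boxA L, (I p.1 (-p.2) + I (-p.2) p.1).re := by
    refine Finset.sum_le_sum fun p hp => ?_
    obtain ⟨hB, hA⟩ := Finset.mem_product.1 hp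
    have hB' : p.1 ∈ blockB (L / 2) := by rw [blockB_eq]; exact hB
    have hA' : - -p.2 ∈ blockA L := by rw [neg_neg, blockA_eq]; exact hA
    have := interaction_AB hL0 (datumCoeff_of_blockB (α := α) hq hj (hS _ (hBS _ hB)) (Or.inl hB'))
      (datumCoeff_of_blockA hq hj (hS _ (hSneg _ (hAS _ hA))) (Or.inr hA')) (Or.inl ⟨hB', hA'⟩)
    rwa [← sub_eq_add_neg] at this
  rw [← Finset.mul_sum, ← Finset.mul_sum] at h2
  have h3 := mul_le_mul_of_nonneg_left (sum_bump_sub_ge hL)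
    (by positivity : 0 ≤ 3 / 5 * (amplitude α L ^ 2 * L ^ 2))
  have h4 : amplitude α L ^ 2 * L ^ 2 * L ^ 6 = L ^ (4 * α) := by
    rw [amplitude, ← Real.rpow_natCast, ← Real.rpow_mul hL0.le, ← Real.rpow_natCast,
      ← Real.rpow_natCast, ← Real.rpow_add hL0, ← Real.rpow_add hL0]
    congr 1; push_cast; ring
  have h5 : 3 / 5 * (amplitude α L ^ 2 * L ^ 2) * (L ^ 6 / (125 * (200 : ℝ) ^ 6)) =
      3 / 5 / (125 * (200 : ℝ) ^ 6) * L ^ (4 * α) := by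
    rw [← h4]; ring
  rw [h5] at h3
  have h6 : 3 / 5 / (125 * (200 : ℝ) ^ 6) * L ^ (4 * α) ≤ 2 * (∑ η ∈ S, ∑ ζ ∈ S, I η ζ).re := by
    rw [hsym]
    refine h3.trans (le_trans (le_of_eq (by ring)) (h2.trans h1))
  linarith

theorem sum_sum_comm_sum_sum {ι κ M : Type*} [AddCommMonoid M] (s : Finset ι) (t : Finset κ)
    (f : ι → ι → κ → κ → M) :
    ∑ i ∈ s, ∑ k ∈ s, ∑ η ∈ t, ∑ ζ ∈ t, f i k η ζ =
      ∑ η ∈ t, ∑ ζ ∈ t, ∑ i ∈ s, ∑ k ∈ s, f i k η ζ := by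
  calc _ = ∑ p ∈ s ×ˢ s, ∑ r ∈ t ×ˢ t, f p.1 p.2 r.1 r.2 := by simp only [Finset.sum_product]
    _ = ∑ r ∈ t ×ˢ t, ∑ p ∈ s ×ˢ s, f p.1 p.2 r.1 r.2 := Finset.sum_comm
    _ = _ := by simp only [Finset.sum_product]

/-- The energy flux of the datum through the `j`-th shell. -/
theorem flux_datum_ge {α : ℝ} {q : ℕ → ℕ} (hq : StrictMono q) {j : ℕ}
    (hj : IsSeparated q j) (hL : 20 ≤ wavenumber (q j)) :
    3 / 10 / (125 * (200 : ℝ) ^ 6) * wavenumber (q j) ^ (4 * α) ≤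
      (∑ i, ∑ k, ∫ x, trig (cube (2 * wavenumber (q j)))
          (fun ξ => Complex.I * ξ i * testCoeff (wavenumber (q j)) ξ k) x *
        (trig (cube (2 * wavenumber (q j))) (fun ξ => datumCoeff α q ξ i) x *
          trig (cube (2 * wavenumber (q j))) (fun ξ => datumCoeff α q ξ k) x) ∂torusMeasure).re := by
  refine (sum_interaction_ge hq hj hL).trans (le_of_eq (congrArg _ ?_))
  set L := wavenumber (q j)
  have hL0 : 0 ≤ L := by linarith
  -- Only triples of total frequency zero survive integration, so the test field enters at -(η + ζ).
  have h1 : ∀ i k, ∀ ξ : Freq, (if -ξ ∈ cube (2 * L) then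
      Complex.I * ((-ξ) i : ℤ) * testCoeff L (-ξ) k else 0) =
      -((ξ i : ℂ) * (rot (fun i => (ξ i : ℝ)) k : ℂ) * bump L ξ) := by
    intro i k ξ
    have h2 : (if -ξ ∈ cube (2 * L) then Complex.I * ((-ξ) i : ℤ) * testCoeff L (-ξ) k else 0) =
        Complex.I * ((-ξ) i : ℤ) * testCoeff L (-ξ) k := by
      split_ifs with h
      · rfl
      · rw [(isRealCoeff_testCoeff hL0).eq_zero _ h]; simp
    rw [h2, (isRealCoeff_testCoeff hL0).conj, testCoeff_apply]
    simp only [Pi.neg_apply, Int.cast_neg, map_mul, Complex.conj_I, Complex.conj_ofReal]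
    linear_combination ((ξ i : ℂ) * (rot (fun i => (ξ i : ℝ)) k : ℂ) * bump L ξ) * Complex.I_sq
  simp only [integral_trig_mul_trig_mul_trig, h1]
  rw [sum_sum_comm_sum_sum]
  refine Finset.sum_congr rfl fun η _ => ?_
  refine Finset.sum_congr rfl fun ζ _ => ?_
  -- Since the datum is divergence free at η, the factor (η + ζ)·v η equals ζ·v η, the form used in
  -- `interaction`.
  have hdiv := sum_mul_datumCoeff α hq η
  simp only [interaction, Fin.sum_univ_three, Pi.add_apply, Int.cast_add] at hdiv ⊢
  linear_combination ((rot (fun i => ((η i : ℝ) + ζ i)) 0 : ℂ) * datumCoeff α q ζ 0 +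
    (rot (fun i => ((η i : ℝ) + ζ i)) 1 : ℂ) * datumCoeff α q ζ 1 +
    (rot (fun i => ((η i : ℝ) + ζ i)) 2 : ℂ) * datumCoeff α q ζ 2) * bump L (η + ζ) * hdiv

/-! ### Low-pass filters and the paraproduct decomposition. -/

/-- Haar measure charges every nonempty open set, so an essential bound of a continuous function
holds everywhere. -/
theorem norm_le_of_eLpNorm_top_le {E : Type*} [NormedAddCommGroup E] {f : T3 → E}
    (hf : Continuous f) {C : ℝ} (hC : 0 ≤ C)
    (h : eLpNorm f ∞ torusMeasure ≤ ENNReal.ofReal C) (x : T3) : ‖f x‖ ≤ C := by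
  have h1 : ∀ᵐ x ∂torusMeasure, ‖f x‖ ≤ C := by
    rw [eLpNorm_exponent_top] at h
    filter_upwards [enorm_ae_le_eLpNormEssSup f torusMeasure] with x hx
    have := hx.trans h
    rwa [← ofReal_norm, ENNReal.ofReal_le_ofReal_iff hC] at this
  have hopen : IsOpen {x | ¬ ‖f x‖ ≤ C} := by
    simp only [not_le]
    exact isOpen_lt continuous_const hf.norm
  have h2 := hopen.measure_eq_zero_iff torusMeasure |>.1 (ae_iff.1 h1)
  by_contra hx
  have : x ∈ {x | ¬ ‖f x‖ ≤ C} := hx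
  rw [h2] at this
  exact this

/-- The sum telescopes, the symbol χ(|ξ|/2) of the shell 0 being its starting term. -/
theorem sum_shellSymbol (χ : ℝ → ℝ) (m : ℕ) (ξ : Freq) :
    ∑ p ∈ Finset.range (m + 1), shellSymbol χ p ξ = χ (freqNorm ξ / wavenumber (m + 1)) := by
  induction m with
  | zero => simp [shellSymbol, wavenumber]
  | succ m ih =>
    rw [Finset.sum_range_succ, ih, shellSymbol, if_neg (Nat.succ_ne_zero m)]
    push_cast
    ring

/-- The trigonometric polynomial that the smooth low-pass filter of the shells `0, …, m` produces
from the Fourier coefficients `c`. -/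
noncomputable def lowPass (χ : ℝ → ℝ) (m : ℕ) (c : Freq → ℂ) : T3 → ℂ :=
  trig (cube (wavenumber (m + 1))) fun ξ => (χ (freqNorm ξ / wavenumber (m + 1)) : ℂ) * c ξ

theorem continuous_lowPass (χ : ℝ → ℝ) (m : ℕ) (c : Freq → ℂ) : Continuous (lowPass χ m c) :=
  continuous_trig _ _

theorem lowPass_coeff {χ : ℝ → ℝ} (hχ : IsCutoff χ) (m : ℕ) (f : T3 → R3) (i : Fin 3) (x : T3) :
    lowPass χ m (fun ξ => coeff f ξ i) x = ∑ p ∈ Finset.range (m + 1), lpProj χ p f x i := by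
  have h : ∀ p ∈ Finset.range (m + 1), lpProj χ p f x i =
      trig (cube (wavenumber (m + 1))) (fun ξ => shellSymbol χ p ξ * coeff f ξ i) x := by
    intro p hp
    refine lpProj_apply χ p f (fun ξ hξ => mem_cube_of_shellSymbol_ne_zero hχ ?_ hξ) x i
    refine wavenumber_le ?_
    have := Finset.mem_range.1 hp
    omega
  rw [Finset.sum_congr rfl h, ← trig_sum, lowPass]
  congr 1
  funext ξ
  rw [← Finset.sum_mul, ← sum_shellSymbol χ m ξ]
  push_cast
  rfl

theorem lowPass_sub (χ : ℝ → ℝ) (m : ℕ) (c d : Freq → ℂ) (x : T3) :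
    lowPass χ m (fun ξ => c ξ - d ξ) x = lowPass χ m c x - lowPass χ m d x := by
  rw [lowPass, lowPass, lowPass, ← trig_sub]
  simp only [mul_sub]

theorem lowPass_const_mul (χ : ℝ → ℝ) (m : ℕ) (a : ℂ) (c : Freq → ℂ) (x : T3) :
    lowPass χ m (fun ξ => a * c ξ) x = a * lowPass χ m c x := by
  rw [lowPass, lowPass, ← trig_smul]
  congr 1
  funext ξ
  ring

/-- For s ≥ 1 each term is at most half of the next. It is applied with s = 2α - 1, where α ≥ 1 is
what is needed. -/
theorem sum_wavenumber_rpow_le {s : ℝ} (hs : 1 ≤ s) (m : ℕ) :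
    ∑ p ∈ Finset.range (m + 1), wavenumber p ^ s ≤ 2 * wavenumber m ^ s := by
  induction m with
  | zero => simp [wavenumber]
  | succ m ih =>
    rw [Finset.sum_range_succ]
    have h1 : 2 * wavenumber m ^ s ≤ wavenumber (m + 1 : ℕ) ^ s := by
      rw [wavenumber_rpow, wavenumber_rpow, pow_succ, mul_comm]
      refine mul_le_mul_of_nonneg_left ?_ (by positivity)
      calc (2 : ℝ) = 2 ^ (1 : ℝ) := (Real.rpow_one 2).symm
        _ ≤ 2 ^ s := Real.rpow_le_rpow_of_exponent_le one_le_two hs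
    linarith

theorem norm_lowPass_le {χ : ℝ → ℝ} (hχ : IsCutoff χ) {f : T3 → R3} {Y s : ℝ} (hY : 0 ≤ Y)
    (hs : 1 ≤ s) (h : ∀ p : ℕ, eLpNorm (lpProj χ p f) ∞ torusMeasure ≤
      ENNReal.ofReal (Y * wavenumber p ^ s)) (m : ℕ) (i : Fin 3) (x : T3) :
    ‖lowPass χ m (fun ξ => coeff f ξ i) x‖ ≤ 2 * Y * wavenumber m ^ s := by
  have h1 : ∀ p : ℕ, ‖lpProj χ p f x i‖ ≤ Y * wavenumber p ^ s := fun p =>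
    (PiLp.norm_apply_le _ i).trans (norm_le_of_eLpNorm_top_le (continuous_lpProj hχ p f)
      (mul_nonneg hY (Real.rpow_nonneg (wavenumber_pos _).le _)) (h p) x)
  rw [lowPass_coeff hχ]
  refine (norm_sum_le _ _).trans ((Finset.sum_le_sum fun p _ => h1 p).trans ?_)
  rw [← Finset.mul_sum]
  have := mul_le_mul_of_nonneg_left (sum_wavenumber_rpow_le hs m) hY
  linarith

theorem eLpNorm_lpProj_le_of_besovNorm_le {χ : ℝ → ℝ} {s : ℝ} {r : ℝ≥0∞} {f : T3 → R3} {δ : ℝ}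
    (h : besovNorm χ s r f ≤ ENNReal.ofReal δ) (p : ℕ) :
    eLpNorm (lpProj χ p f) r torusMeasure ≤ ENNReal.ofReal (δ * wavenumber p ^ (-s)) := by
  have h1 : ENNReal.ofReal (wavenumber p ^ s) * eLpNorm (lpProj χ p f) r torusMeasure ≤
      ENNReal.ofReal δ := (le_iSup (fun q : ℕ => ENNReal.ofReal (wavenumber q ^ s) *
        eLpNorm (lpProj χ q f) r torusMeasure) p).trans h
  have hpos : 0 < wavenumber p ^ s := Real.rpow_pos_of_pos (wavenumber_pos _) _
  rw [mul_comm, ← ENNReal.le_div_iff_mul_le (Or.inl (ENNReal.ofReal_pos.2 hpos).ne')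
    (Or.inl ENNReal.ofReal_ne_top), ← ENNReal.ofReal_div_of_pos hpos] at h1
  rwa [Real.rpow_neg (wavenumber_pos _).le, ← div_eq_mul_inv]

/-- The filter equals 1 up to 4L, which covers `cube (2 * L)`, and it ends before 100 L. The
spectrum of the datum has a gap in between. -/
theorem lowPass_datum {χ : ℝ → ℝ} (hχ : IsCutoff χ) {α : ℝ} {q : ℕ → ℕ} (hq : StrictMono q) {j : ℕ}
    (hj : IsSeparated q j) {m : ℕ} (h1 : 8 * wavenumber (q j) ≤ wavenumber (m + 1))
    (h2 : wavenumber (m + 1) ≤ 100 * wavenumber (q j)) (i : Fin 3) :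
    lowPass χ m (fun ξ => datumCoeff α q ξ i) =
      trig (cube (2 * wavenumber (q j))) fun ξ => datumCoeff α q ξ i := by
  have hL := wavenumber_pos (q j)
  have hW := wavenumber_pos ((m : ℤ) + 1)
  have hsub : cube (2 * wavenumber (q j)) ⊆ cube (wavenumber (m + 1)) := fun ξ hξ =>
    mem_cube.2 fun k => (mem_cube.1 hξ k).trans (by linarith)
  rw [lowPass, ← trig_subset hsub]
  · refine trig_congr fun ξ hξ => ?_
    rw [hχ.eq_one, Complex.ofReal_one, one_mul]
    rw [div_le_iff₀ hW]
    have := freqNorm_of_mem_cube hξ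
    linarith
  · intro ξ _ hξ
    rcases le_or_gt (wavenumber (m + 1)) (freqNorm ξ) with h | h
    · rw [hχ.eq_zero _ ((one_le_div hW).2 h), Complex.ofReal_zero, zero_mul]
    · by_contra hne
      have hne' : datumCoeff α q ξ ≠ 0 := fun h0 => hne (by simp [h0])
      apply hξ
      rcases datumCoeff_cases hq hj (h.trans_le h2) hne' with h' | h'
      · exact mem_cube_of_freqNorm_le (pieceCoeff_freqNorm h'.1).2
      · exact mem_cube.2 fun k => (h' k).trans (by linarith)

theorem mFourierCoeff_sub_lowPass {χ : ℝ → ℝ} (hχ : IsCutoff χ) (m : ℕ) {f : T3 → ℂ}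
    (hf : Integrable f torusMeasure) (ξ : Freq) :
    UnitAddTorus.mFourierCoeff
        (fun x => f x - lowPass χ m (UnitAddTorus.mFourierCoeff f) x) ξ =
      ((1 - χ (freqNorm ξ / wavenumber (m + 1)) : ℝ) : ℂ) * UnitAddTorus.mFourierCoeff f ξ := by
  rw [mFourierCoeff_sub hf (integrable_of_continuous (continuous_lowPass _ _ _)), lowPass,
    mFourierCoeff_trig]
  push_cast
  split_ifs with h
  · ring
  · have : wavenumber (m + 1) ≤ freqNorm ξ := by
      by_contra h'
      exact h (mem_cube_of_freqNorm_le (not_le.1 h').le)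
    rw [hχ.eq_zero _ ((one_le_div (wavenumber_pos _)).2 this)]
    simp

theorem integral_sub_lowPass_mul {χ : ℝ → ℝ} (hχ : IsCutoff χ) (m : ℕ) {f : T3 → ℂ}
    (hf : Integrable f torusMeasure) {s t : Finset Freq} (c d : Freq → ℂ)
    (h : ∀ ξ ∈ s, ∀ η ∈ t, freqNorm (ξ + η) ≤ wavenumber (m + 1) / 2) :
    ∫ x, (f x - lowPass χ m (UnitAddTorus.mFourierCoeff f) x) * (trig s c x * trig t d x)
      ∂torusMeasure = 0 := by
  refine (integral_mul_trig_mul_trig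
    (hf.sub (integrable_of_continuous (continuous_lowPass _ _ _))) s t c d).trans ?_
  refine Finset.sum_eq_zero fun ξ hξ => Finset.sum_eq_zero fun η hη => ?_
  have h0 := mFourierCoeff_sub_lowPass hχ m hf (-(ξ + η))
  rw [freqNorm_neg, hχ.eq_one] at h0
  · simp only [sub_self, Complex.ofReal_zero, zero_mul] at h0
    exact mul_eq_zero_of_right _ h0
  · rw [div_le_iff₀ (wavenumber_pos _)]
    have := h ξ hξ η hη
    linarith

/-- The paraproduct decomposition of a trilinear form whose last argument has low frequencies. -/
theorem integral_mul_mul_trig_eq {χ : ℝ → ℝ} (hχ : IsCutoff χ) (n : ℕ) {f g : T3 → ℂ}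
    (hf : MemLp f 2 torusMeasure) (hg : MemLp g 2 torusMeasure) (e : Freq → ℂ) :
    ∫ x, f x * g x * trig (cube (2 * wavenumber n)) e x ∂torusMeasure =
      ∫ x, (lowPass χ (n + 3) (UnitAddTorus.mFourierCoeff f) x *
          lowPass χ (n + 5) (UnitAddTorus.mFourierCoeff g) x +
        (lowPass χ (n + 5) (UnitAddTorus.mFourierCoeff f) x -
          lowPass χ (n + 3) (UnitAddTorus.mFourierCoeff f) x) *
          lowPass χ (n + 3) (UnitAddTorus.mFourierCoeff g) x) *
        trig (cube (2 * wavenumber n)) e x ∂torusMeasure +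
      ∫ x, (f x - lowPass χ (n + 3) (UnitAddTorus.mFourierCoeff f) x) *
        (g x - lowPass χ (n + 3) (UnitAddTorus.mFourierCoeff g) x) *
        trig (cube (2 * wavenumber n)) e x ∂torusMeasure := by
  have hL := wavenumber_pos n
  have hw4 : wavenumber ((n + 3 : ℕ) + 1) = 16 * wavenumber n := by
    simp only [wavenumber]; push_cast
    rw [show (n : ℤ) + 3 + 1 = n + 4 by ring, zpow_add₀ two_ne_zero]; norm_num; ring
  have hw6 : wavenumber ((n + 5 : ℕ) + 1) = 64 * wavenumber n := by
    simp only [wavenumber]; push_cast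
    rw [show (n : ℤ) + 5 + 1 = n + 6 by ring, zpow_add₀ two_ne_zero]; norm_num; ring
  -- A filtered factor times the test polynomial has coordinates up to 16L + 2L, hence length below
  -- 32L since 18√3 < 32. The second filter, with parameter n + 5, is the identity up to 32L.
  have hfreq : ∀ ξ ∈ cube (wavenumber ((n + 3 : ℕ) + 1)), ∀ η ∈ cube (2 * wavenumber n),
      freqNorm (ξ + η) ≤ wavenumber ((n + 5 : ℕ) + 1) / 2 := by
    intro ξ hξ η hη
    rw [hw4] at hξ
    rw [hw6]
    have h1 : ∀ i, |((ξ + η) i : ℝ)| ≤ 18 * wavenumber n := fun i => by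
      have h2 := mem_cube.1 hξ i
      have h3 := mem_cube.1 hη i
      have h4 := abs_add_le (ξ i : ℝ) (η i)
      simp only [Pi.add_apply, Int.cast_add]
      linarith
    have h5 : Real.sqrt 3 ≤ 7 / 4 := Real.sqrt_le_iff.2 ⟨by norm_num, by norm_num⟩
    have h6 := freqNorm_le_of_abs_le h1
    have h7 := mul_le_mul_of_nonneg_right h5 (by linarith : 0 ≤ 18 * wavenumber n)
    linarith
  set h := trig (cube (2 * wavenumber n)) e
  have hh : Continuous h := continuous_trig _ _
  set a := lowPass χ (n + 3) (UnitAddTorus.mFourierCoeff f)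
  set a' := lowPass χ (n + 5) (UnitAddTorus.mFourierCoeff f)
  set c := lowPass χ (n + 3) (UnitAddTorus.mFourierCoeff g)
  set c' := lowPass χ (n + 5) (UnitAddTorus.mFourierCoeff g)
  have ha : Continuous a := continuous_lowPass _ _ _
  have ha' : Continuous a' := continuous_lowPass _ _ _
  have hc : Continuous c := continuous_lowPass _ _ _
  have hc' : Continuous c' := continuous_lowPass _ _ _
  have hf1 := hf.integrable one_le_two
  have hg1 := hg.integrable one_le_two
  have z1 : ∫ x, (f x - a' x) * (c x * h x) ∂torusMeasure = 0 :=
    integral_sub_lowPass_mul hχ (n + 5) hf1 _ _ hfreq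
  have z2 : ∫ x, (g x - c' x) * (a x * h x) ∂torusMeasure = 0 :=
    integral_sub_lowPass_mul hχ (n + 5) hg1 _ _ hfreq
  have i1 : Integrable (fun x => (f x - a' x) * (c x * h x)) torusMeasure :=
    integrable_mul_continuous (hf1.sub (integrable_of_continuous ha')) (hc.mul hh)
  have i2 : Integrable (fun x => (g x - c' x) * (a x * h x)) torusMeasure :=
    integrable_mul_continuous (hg1.sub (integrable_of_continuous hc')) (ha.mul hh)
  have i3 : Integrable (fun x => (a x * c' x + (a' x - a x) * c x) * h x) torusMeasure :=
    integrable_of_continuous (((ha.mul hc').add ((ha'.sub ha).mul hc)).mul hh)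
  have i4 : Integrable (fun x => (f x - a x) * (g x - c x) * h x) torusMeasure :=
    integrable_mul_continuous ((hf.sub (memLp_of_continuous ha 2)).integrable_mul
      (hg.sub (memLp_of_continuous hc 2))) hh
  -- In the mixed terms the unfiltered factor may be cut at 64L, because the remainder is orthogonal
  -- to everything below 32L. Unbounded frequencies survive only in the product of the two high
  -- parts.
  have heq : (fun x => f x * g x * h x) = fun x => ((f x - a' x) * (c x * h x) +
      (g x - c' x) * (a x * h x)) + ((a x * c' x + (a' x - a x) * c x) * h x +
        (f x - a x) * (g x - c x) * h x) := by
    funext x; ring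
  rw [heq]
  refine (integral_add (i1.add i2) (i3.add i4)).trans ?_
  refine (congrArg₂ (· + ·) (integral_add i1 i2) (integral_add i3 i4)).trans ?_
  rw [z1, z2, add_zero, zero_add]

/-- The symbol 1 - χ vanishes up to half the cutoff frequency W and is at most 1, so it is bounded
by |ξ|/(W/2). Parseval does the rest. -/
theorem integral_norm_sq_sub_lowPass_le {χ : ℝ → ℝ} (hχ : IsCutoff χ) (m : ℕ) (u : L2Field)
    (hu : sobolevSq 1 u ≠ ∞) (i : Fin 3) :
    ∫ x, ‖comp u i x - lowPass χ m (UnitAddTorus.mFourierCoeff (comp u i)) x‖ ^ 2 ∂torusMeasure ≤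
      (wavenumber (m + 1) / 2)⁻¹ ^ 2 * (sobolevSq 1 u).toReal := by
  have hf := memLp_comp (Lp.memLp u) i
  have hW := wavenumber_pos ((m : ℤ) + 1)
  have h1 := hasSum_sq_mFourierCoeff
    (hf.sub (memLp_of_continuous (continuous_lowPass χ m (UnitAddTorus.mFourierCoeff (comp u i))) 2))
  have h2 := ENNReal.hasSum_toReal hu
  rw [← ENNReal.tsum_toReal_eq fun ξ => ENNReal.ne_top_of_tsum_ne_top hu ξ] at h2
  refine hasSum_le (fun ξ => ?_) h1 (h2.mul_left _)
  have h3 : UnitAddTorus.mFourierCoeff (comp u i - lowPass χ m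
      (UnitAddTorus.mFourierCoeff (comp u i))) ξ = _ :=
    mFourierCoeff_sub_lowPass hχ m (hf.integrable one_le_two) ξ
  rw [h3, ← coeff_apply]
  have h4 : ‖coeff u ξ i‖ ≤ ‖coeff u ξ‖ := PiLp.norm_apply_le _ i
  rw [ENNReal.toReal_mul, ENNReal.toReal_ofReal (Real.rpow_nonneg (freqNorm_nonneg _) _),
    ENNReal.toReal_pow, toReal_enorm, norm_mul, Complex.norm_real, Real.norm_eq_abs,
    show (2 * 1 : ℝ) = (2 : ℕ) by norm_num, Real.rpow_natCast, ← mul_assoc, ← mul_pow, ← mul_pow]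
  refine pow_le_pow_left₀ (by positivity) ?_ 2
  refine mul_le_mul ?_ h4 (norm_nonneg _) (mul_nonneg (by positivity) (freqNorm_nonneg _))
  have h5 := hχ.range (freqNorm ξ / wavenumber (m + 1))
  rcases le_or_gt (freqNorm ξ / wavenumber (m + 1)) (1 / 2) with h | h
  · rw [hχ.eq_one _ h]
    simp only [sub_self, abs_zero]
    exact mul_nonneg (by positivity) (freqNorm_nonneg _)
  · have h6 : 1 ≤ (wavenumber (m + 1) / 2)⁻¹ * freqNorm ξ := by
      rw [lt_div_iff₀ hW] at h
      rw [inv_mul_eq_div, one_le_div (by positivity)]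
      linarith
    refine le_trans ?_ h6
    rw [abs_le]
    constructor <;> linarith [h5.1, h5.2]

theorem norm_integral_mul_le_of_eLpNorm_one {g h : T3 → ℂ} {M B : ℝ} (hB : 0 ≤ B)
    (hM : ∀ x, ‖g x‖ ≤ M) (hh : Continuous h)
    (hhB : eLpNorm h 1 torusMeasure ≤ ENNReal.ofReal B) :
    ‖∫ x, g x * h x ∂torusMeasure‖ ≤ M * B := by
  have hM0 : 0 ≤ M := (norm_nonneg _).trans (hM 0)
  have hi := integrable_of_continuous hh
  have h1 : ∫ x, ‖h x‖ ∂torusMeasure ≤ B := by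
    rw [integral_norm_eq_lintegral_enorm hi.aestronglyMeasurable, ← eLpNorm_one_eq_lintegral_enorm]
    exact ENNReal.toReal_le_of_le_ofReal hB hhB
  calc ‖∫ x, g x * h x ∂torusMeasure‖ ≤ ∫ x, M * ‖h x‖ ∂torusMeasure := by
        refine norm_integral_le_of_norm_le (hi.norm.const_mul M) (ae_of_all _ fun x => ?_)
        rw [norm_mul]
        exact mul_le_mul_of_nonneg_right (hM x) (norm_nonneg _)
    _ ≤ M * B := by
        rw [integral_const_mul]
        exact mul_le_mul_of_nonneg_left h1 hM0

theorem norm_integral_mul_mul_le {f g h : T3 → ℂ} (hf : MemLp f 2 torusMeasure)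
    (hg : MemLp g 2 torusMeasure) {M : ℝ} (hM : ∀ x, ‖h x‖ ≤ M) :
    ‖∫ x, f x * g x * h x ∂torusMeasure‖ ≤
      M * ((∫ x, ‖f x‖ ^ 2 ∂torusMeasure + ∫ x, ‖g x‖ ^ 2 ∂torusMeasure) / 2) := by
  have hM0 : 0 ≤ M := (norm_nonneg _).trans (hM 0)
  have hf2 := hf.integrable_norm_pow two_ne_zero
  have hg2 := hg.integrable_norm_pow two_ne_zero
  rw [← integral_add hf2 hg2, ← integral_div, ← integral_const_mul]
  refine norm_integral_le_of_norm_le (((hf2.add hg2).div_const 2).const_mul M)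
    (ae_of_all _ fun x => ?_)
  rw [norm_mul, norm_mul, mul_comm]
  refine mul_le_mul (hM x) ?_ (by positivity) hM0
  have := two_mul_le_add_sq ‖f x‖ ‖g x‖
  linarith

/-- In the difference (v + w₂) - (v + w) the main part cancels, so every term other than v v'
contains an error factor. -/
theorem norm_paraproduct_sub_le {v v' w w' w₂ w₂' : ℂ} {X Y : ℝ} (hv : ‖v‖ ≤ X) (hv' : ‖v'‖ ≤ X)
    (hw : ‖w‖ ≤ Y) (hw' : ‖w'‖ ≤ Y) (hw₂ : ‖w₂‖ ≤ Y) (hw₂' : ‖w₂'‖ ≤ Y) :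
    ‖(v + w) * (v' + w₂') + ((v + w₂) - (v + w)) * (v' + w') - v * v'‖ ≤
      4 * (X * Y) + 3 * Y ^ 2 := by
  have hX0 : 0 ≤ X := (norm_nonneg _).trans hv
  have hY0 : 0 ≤ Y := (norm_nonneg _).trans hw
  have h1 : ‖v * w₂'‖ ≤ X * Y := by
    rw [norm_mul]; exact mul_le_mul hv hw₂' (norm_nonneg _) hX0
  have h2 : ‖w * v'‖ ≤ Y * X := by
    rw [norm_mul]; exact mul_le_mul hw hv' (norm_nonneg _) hY0
  have h3 : ‖w * w₂'‖ ≤ Y * Y := by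
    rw [norm_mul]; exact mul_le_mul hw hw₂' (norm_nonneg _) hY0
  have h4 : ‖(w₂ - w) * (v' + w')‖ ≤ (Y + Y) * (X + Y) := by
    rw [norm_mul]
    exact mul_le_mul ((norm_sub_le _ _).trans (add_le_add hw₂ hw))
      ((norm_add_le _ _).trans (add_le_add hv' hw')) (norm_nonneg _) (by linarith)
  have h5 : (v + w) * (v' + w₂') + ((v + w₂) - (v + w)) * (v' + w') - v * v' =
      v * w₂' + w * v' + w * w₂' + (w₂ - w) * (v' + w') := by ring
  rw [h5]
  have h6 := norm_add₃_le (a := v * w₂') (b := w * v') (c := w * w₂')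
  have h7 := norm_add_le (v * w₂' + w * v' + w * w₂') ((w₂ - w) * (v' + w'))
  nlinarith

theorem lowPass_solution {χ : ℝ → ℝ} (hχ : IsCutoff χ) {α : ℝ} {q : ℕ → ℕ} (hq : StrictMono q)
    {j : ℕ} (hj : IsSeparated q j) {m : ℕ} (h1 : 8 * wavenumber (q j) ≤ wavenumber (m + 1))
    (h2 : wavenumber (m + 1) ≤ 100 * wavenumber (q j)) {U : L2Field}
    (hU : ∀ ξ, coeff U ξ = datumCoeff α q ξ) (κ : ℝ) (u : L2Field) (i : Fin 3) (x : T3) :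
    lowPass χ m (UnitAddTorus.mFourierCoeff (comp u i)) x =
      κ * trig (cube (2 * wavenumber (q j))) (fun ξ => datumCoeff α q ξ i) x +
        lowPass χ m (fun ξ => coeff (u - κ • U : L2Field) ξ i) x := by
  rw [← lowPass_datum hχ hq hj h1 h2 i, ← lowPass_const_mul, ← sub_eq_iff_eq_add', ← lowPass_sub]
  congr 1
  funext ξ
  rw [coeff_sub, coeff_smul, hU, coeff_apply]

theorem wavenumber_add_natCast (n k : ℕ) : wavenumber (n + k : ℕ) = 2 ^ k * wavenumber n := by
  simp only [wavenumber]
  push_cast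
  rw [zpow_add₀ two_ne_zero, zpow_natCast, zpow_natCast, mul_comm]

/-! ### Flux and dissipation of a field close to the datum. -/

/-- Low part: two sup norms of order L^(2α-1) against an L¹ norm of order L² give L^(4α), and each
error term has at least one factor δ. High part: a sup bound of order L⁵ meets two factors that each
gain L⁻¹ from the gradient of u, which leaves L³. -/
theorem exists_norm_flux_sub_le {χ : ℝ → ℝ} (hχ : IsCutoff χ) {α : ℝ} (hα : 1 ≤ α)
    {q : ℕ → ℕ} (hq : StrictMono q) {U : L2Field} (hU : ∀ ξ, coeff U ξ = datumCoeff α q ξ) :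
    ∃ K : ℝ, 0 ≤ K ∧ ∀ (κ : ℝ), 0 ≤ κ → ∀ j, IsSeparated q j → ∀ δ : ℝ, 0 ≤ δ →
      ∀ u : L2Field, besovNorm χ (1 - 2 * α) ∞ (u - κ • U : L2Field) ≤ ENNReal.ofReal δ →
      sobolevSq 1 u ≠ ∞ → ∀ i k : Fin 3,
      ‖∫ x, comp u i x * comp u k x * trig (cube (2 * wavenumber (q j)))
          (fun ξ => Complex.I * ξ i * testCoeff (wavenumber (q j)) ξ k) x ∂torusMeasure -
        κ ^ 2 * ∫ x, trig (cube (2 * wavenumber (q j)))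
            (fun ξ => Complex.I * ξ i * testCoeff (wavenumber (q j)) ξ k) x *
          (trig (cube (2 * wavenumber (q j))) (fun ξ => datumCoeff α q ξ i) x *
            trig (cube (2 * wavenumber (q j))) (fun ξ => datumCoeff α q ξ k) x) ∂torusMeasure‖ ≤
      K * (κ * δ + δ ^ 2) * wavenumber (q j) ^ (4 * α) +
        8 * wavenumber (q j) ^ 3 * (sobolevSq 1 u).toReal := by
  obtain ⟨C, hC0, hC⟩ := exists_eLpNorm_lpProj_datum_le hχ (r := ∞) (by simp) α hq hU
  obtain ⟨B, hB0, hB⟩ := exists_eLpNorm_deriv_testCoeff_le hχ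
  set s := 2 * α - 1 with hs
  have hs1 : 1 ≤ s := by linarith
  -- In units of L, 8 and 32 are the wavenumbers of the last shells kept by the filters n + 3 and n
  -- + 5; the factor 2 sums the geometric series.
  set X₀ : ℝ := 2 * C * 8 ^ s
  set Y₀ : ℝ := 2 * 32 ^ s
  have hX₀ : 0 ≤ X₀ := by positivity
  have hY₀ : 0 ≤ Y₀ := by positivity
  refine ⟨(4 * (X₀ * Y₀) + 3 * Y₀ ^ 2) * B, by positivity,
    fun κ hκ j hj δ hδ u hu hS i k => ?_⟩
  set n := q j
  set L := wavenumber n with hLdef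
  have hL0 : 0 < L := wavenumber_pos n
  have hL1 : 1 ≤ L := one_le_wavenumber n
  set h := trig (cube (2 * L)) (fun ξ => Complex.I * ξ i * testCoeff L ξ k) with hh
  set V : Fin 3 → T3 → ℂ := fun i => trig (cube (2 * L)) (fun ξ => datumCoeff α q ξ i) with hV
  have hw3 : wavenumber ((n + 3 : ℕ) : ℤ) = 8 * L := by
    rw [wavenumber_add_natCast]; norm_num; rfl
  have hw5 : wavenumber ((n + 5 : ℕ) : ℤ) = 32 * L := by
    rw [wavenumber_add_natCast]; norm_num; rfl
  have hw4 : wavenumber ((n + 3 : ℕ) + 1) = 16 * L := by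
    rw [wavenumber_add_one, hw3]; ring
  have hw6 : wavenumber ((n + 5 : ℕ) + 1) = 64 * L := by
    rw [wavenumber_add_one, hw5]; ring
  have hVle : ∀ i x, ‖V i x‖ ≤ X₀ * L ^ s := by
    intro i x
    have hC' : ∀ p : ℕ, eLpNorm (lpProj χ p U) ∞ torusMeasure ≤
        ENNReal.ofReal (C * wavenumber p ^ s) := fun p => by
      have := hC p
      simpa using this
    have h1 := norm_lowPass_le hχ hC0 hs1 hC' (n + 3) i x
    rw [hw3, Real.mul_rpow (by norm_num) hL0.le] at h1
    have h2 : lowPass χ (n + 3) (fun ξ => coeff U ξ i) = V i := by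
      simp only [hU]
      exact lowPass_datum hχ hq hj (by rw [hw4]; change 8 * L ≤ _; linarith)
        (by rw [hw4]; change _ ≤ 100 * L; linarith) i
    rw [h2] at h1
    exact h1.trans (le_of_eq (by simp only [X₀]; ring))
  have hpow : (0:ℝ) ≤ L ^ s := by positivity
  have hw : ∀ m : ℕ, wavenumber m ≤ 32 * L → ∀ i x,
      ‖lowPass χ m (fun ξ => coeff (u - κ • U : L2Field) ξ i) x‖ ≤ Y₀ * δ * L ^ s := by
    intro m hm i x
    have h1 : ∀ p : ℕ, eLpNorm (lpProj χ p (u - κ • U : L2Field)) ∞ torusMeasure ≤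
        ENNReal.ofReal (δ * wavenumber p ^ s) := fun p => by
      have := eLpNorm_lpProj_le_of_besovNorm_le hu p
      rwa [neg_sub] at this
    refine (norm_lowPass_le hχ hδ hs1 h1 m i x).trans ?_
    have h2 : wavenumber m ^ s ≤ 32 ^ s * L ^ s := by
      rw [← Real.mul_rpow (by norm_num) hL0.le]
      exact Real.rpow_le_rpow (wavenumber_pos _).le hm (by linarith)
    refine (mul_le_mul_of_nonneg_left h2 (by positivity)).trans (le_of_eq ?_)
    simp only [Y₀]; ring
  have hf := memLp_comp (Lp.memLp u) i
  have hg := memLp_comp (Lp.memLp u) k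
  have hhc : Continuous h := continuous_trig _ _
  have hVc : ∀ i, Continuous (V i) := fun i => continuous_trig _ _
  have hdec := integral_mul_mul_trig_eq hχ n hf hg
    (fun ξ => Complex.I * ξ i * testCoeff L ξ k)
  have hs3 : ∀ i x, lowPass χ (n + 3) (UnitAddTorus.mFourierCoeff (comp u i)) x = κ * V i x +
      lowPass χ (n + 3) (fun ξ => coeff (u - κ • U : L2Field) ξ i) x :=
    lowPass_solution hχ hq hj (by rw [hw4]; change 8 * L ≤ _; linarith)
      (by rw [hw4]; change _ ≤ 100 * L; linarith) hU κ u
  have hs5 : ∀ i x, lowPass χ (n + 5) (UnitAddTorus.mFourierCoeff (comp u i)) x = κ * V i x +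
      lowPass χ (n + 5) (fun ξ => coeff (u - κ • U : L2Field) ξ i) x :=
    lowPass_solution hχ hq hj (by rw [hw6]; change 8 * L ≤ _; linarith)
      (by rw [hw6]; change _ ≤ 100 * L; linarith) hU κ u
  set P := lowPass χ (n + 3) (UnitAddTorus.mFourierCoeff (comp u i)) with hP
  set P' := lowPass χ (n + 3) (UnitAddTorus.mFourierCoeff (comp u k)) with hP'
  set Q := lowPass χ (n + 5) (UnitAddTorus.mFourierCoeff (comp u i)) with hQ
  set Q' := lowPass χ (n + 5) (UnitAddTorus.mFourierCoeff (comp u k)) with hQ'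
  have hPc : Continuous P := continuous_lowPass _ _ _
  have hPc' : Continuous P' := continuous_lowPass _ _ _
  have hQc : Continuous Q := continuous_lowPass _ _ _
  have hQc' : Continuous Q' := continuous_lowPass _ _ _
  have hV2 : (κ : ℂ) ^ 2 * ∫ x, h x * (V i x * V k x) ∂torusMeasure =
      ∫ x, (κ * V i x) * (κ * V k x) * h x ∂torusMeasure := by
    rw [← integral_const_mul]
    congr 1
    funext x
    ring
  have hI1 : Integrable (fun x => (P x * Q' x + (Q x - P x) * P' x) * h x) torusMeasure :=
    integrable_of_continuous (by fun_prop)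
  have hI2 : Integrable (fun x => (κ * V i x) * (κ * V k x) * h x) torusMeasure :=
    integrable_of_continuous (((continuous_const.mul (hVc i)).mul
      (continuous_const.mul (hVc k))).mul hhc)
  have hlow : ‖∫ x, (P x * Q' x + (Q x - P x) * P' x) * h x ∂torusMeasure -
      κ ^ 2 * ∫ x, h x * (V i x * V k x) ∂torusMeasure‖ ≤
      (4 * (κ * X₀ * L ^ s * (Y₀ * δ * L ^ s)) + 3 * (Y₀ * δ * L ^ s) ^ 2) * (B * L ^ 2) := by
    rw [hV2, ← integral_sub hI1 hI2]
    simp only [← sub_mul]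
    refine norm_integral_mul_le_of_eLpNorm_one (by positivity) (fun x => ?_) hhc (hB L hL1 i k)
    have hκV : ∀ i, ‖(κ : ℂ) * V i x‖ ≤ κ * X₀ * L ^ s := fun i => by
      rw [norm_mul, Complex.norm_real, Real.norm_of_nonneg hκ, mul_assoc]
      exact mul_le_mul_of_nonneg_left (hVle i x) hκ
    rw [hP, hP', hQ, hQ', hs3, hs3, hs5, hs5]
    have h3 : wavenumber ((n + 3 : ℕ) : ℤ) ≤ 32 * L := by rw [hw3]; linarith
    exact norm_paraproduct_sub_le (hκV i) (hκV k) (hw _ h3 i x) (hw _ h3 k x)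
      (hw _ hw5.le i x) (hw _ hw5.le k x)
  have hhigh : ‖∫ x, (comp u i x - P x) * (comp u k x - P' x) * h x ∂torusMeasure‖ ≤
      8 * L ^ 3 * (sobolevSq 1 u).toReal := by
    have h1 := norm_integral_mul_mul_le (hf.sub (memLp_of_continuous hPc 2))
      (hg.sub (memLp_of_continuous hPc' 2)) (h := h) (M := 512 * L ^ 5) fun x =>
        (norm_trig_le _ _ x).trans (sum_norm_deriv_testCoeff_le hL1 i k)
    refine h1.trans ?_
    have h2 := integral_norm_sq_sub_lowPass_le hχ (n + 3) u hS i
    have h3 := integral_norm_sq_sub_lowPass_le hχ (n + 3) u hS k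
    rw [hw4] at h2 h3
    have h4 : (512 * L ^ 5) * (((16 * L / 2)⁻¹ ^ 2 * (sobolevSq 1 u).toReal +
        (16 * L / 2)⁻¹ ^ 2 * (sobolevSq 1 u).toReal) / 2) =
        8 * L ^ 3 * (sobolevSq 1 u).toReal := by
      field_simp; ring
    rw [← h4]
    refine mul_le_mul_of_nonneg_left ?_ (by positivity)
    refine div_le_div_of_nonneg_right (add_le_add h2 h3) zero_le_two
  rw [hdec, add_sub_right_comm]
  refine (norm_add_le _ _).trans (add_le_add (hlow.trans ?_) hhigh)
  have hLs : L ^ s * L ^ s * L ^ 2 = L ^ (4 * α) := by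
    rw [← Real.rpow_natCast, ← Real.rpow_add hL0, ← Real.rpow_add hL0]
    congr 1; rw [hs]; push_cast; ring
  have h5 : (4 * (κ * X₀ * L ^ s * (Y₀ * δ * L ^ s)) + 3 * (Y₀ * δ * L ^ s) ^ 2) * (B * L ^ 2) =
      (4 * (X₀ * Y₀) * (κ * δ) + 3 * Y₀ ^ 2 * δ ^ 2) * B * L ^ (4 * α) := by
    rw [← hLs]; ring
  rw [h5]
  refine mul_le_mul_of_nonneg_right ?_ (by positivity)
  have h6 : (4 * (X₀ * Y₀) + 3 * Y₀ ^ 2) * B * (κ * δ + δ ^ 2) -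
      (4 * (X₀ * Y₀) * (κ * δ) + 3 * Y₀ ^ 2 * δ ^ 2) * B =
      (4 * (X₀ * Y₀) * δ ^ 2 + 3 * Y₀ ^ 2 * (κ * δ)) * B := by ring
  have h7 : 0 ≤ (4 * (X₀ * Y₀) * δ ^ 2 + 3 * Y₀ ^ 2 * (κ * δ)) * B := by positivity
  linarith

/-- The test field concentrated near the frequencies of size `L`. -/
noncomputable def testField (L : ℝ) : T3 → R3 := trigField (cube (2 * L)) (testCoeff L)

theorem flux_testField {L : ℝ} (hL : 0 ≤ L) (u : L2Field) :
    ((∫ x, (∑ i, ∑ k, u x i * u x k * pderiv i (testField L) x k) ∂torusMeasure : ℝ) : ℂ) =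
      ∑ i, ∑ k, ∫ x, comp u i x * comp u k x *
        trig (cube (2 * L)) (fun ξ => Complex.I * ξ i * testCoeff L ξ k) x ∂torusMeasure :=
  integral_flux_of_comp (Lp.memLp u) (fun _ _ => continuous_trig _ _)
    fun i k x => pderiv_trigField (isRealCoeff_testCoeff hL) i k x

/-- The datum's flux scales with κ², and the errors of the nine pairs of components add up: 9K, and
72 = 9 · 8. -/
theorem exists_flux_ge {χ : ℝ → ℝ} (hχ : IsCutoff χ) {α : ℝ} (hα : 1 ≤ α)
    {q : ℕ → ℕ} (hq : StrictMono q) {U : L2Field} (hU : ∀ ξ, coeff U ξ = datumCoeff α q ξ) :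
    ∃ c K : ℝ, 0 < c ∧ 0 ≤ K ∧ ∀ (κ : ℝ), 0 ≤ κ → ∀ j, IsSeparated q j →
      20 ≤ wavenumber (q j) → ∀ δ : ℝ, 0 ≤ δ →
      ∀ u : L2Field, besovNorm χ (1 - 2 * α) ∞ (u - κ • U : L2Field) ≤ ENNReal.ofReal δ →
      sobolevSq 1 u ≠ ∞ →
      (c * κ ^ 2 - K * (κ * δ + δ ^ 2)) * wavenumber (q j) ^ (4 * α) -
          72 * wavenumber (q j) ^ 3 * (sobolevSq 1 u).toReal ≤
        ∫ x, (∑ i, ∑ k, u x i * u x k * pderiv i (testField (wavenumber (q j))) x k)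
          ∂torusMeasure := by
  obtain ⟨K, hK0, hK⟩ := exists_norm_flux_sub_le hχ hα hq hU
  refine ⟨3 / 10 / (125 * (200 : ℝ) ^ 6), 9 * K, by norm_num, by positivity,
    fun κ hκ j hj hL δ hδ u hu hS => ?_⟩
  have hL0 : 0 ≤ wavenumber (q j) := by linarith
  have h1 := flux_datum_ge (α := α) hq hj hL
  have h2 : ∀ i k : Fin 3, _ := fun i k => hK κ hκ j hj δ hδ u hu hS i k
  have h3 := congrArg Complex.re (flux_testField hL0 u)
  rw [Complex.ofReal_re] at h3
  rw [h3]
  set L := wavenumber (q j)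
  set a : Fin 3 → Fin 3 → ℂ := fun i k => ∫ x, comp u i x * comp u k x *
    trig (cube (2 * L)) (fun ξ => Complex.I * ξ i * testCoeff L ξ k) x ∂torusMeasure
  set b : Fin 3 → Fin 3 → ℂ := fun i k => ∫ x,
    trig (cube (2 * L)) (fun ξ => Complex.I * ξ i * testCoeff L ξ k) x *
      (trig (cube (2 * L)) (fun ξ => datumCoeff α q ξ i) x *
        trig (cube (2 * L)) (fun ξ => datumCoeff α q ξ k) x) ∂torusMeasure
  change _ ≤ (∑ i, ∑ k, b i k).re at h1
  change _ ≤ (∑ i, ∑ k, a i k).re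
  have h4 : ‖∑ i, ∑ k, a i k - κ ^ 2 * ∑ i, ∑ k, b i k‖ ≤
      9 * (K * (κ * δ + δ ^ 2) * L ^ (4 * α) + 8 * L ^ 3 * (sobolevSq 1 u).toReal) := by
    have h5 : ∑ i, ∑ k, a i k - κ ^ 2 * ∑ i, ∑ k, b i k =
        ∑ i, ∑ k, (a i k - κ ^ 2 * b i k) := by
      simp only [Finset.mul_sum, Finset.sum_sub_distrib]
    rw [h5]
    refine (norm_sum_le _ _).trans ((Finset.sum_le_sum fun i _ => (norm_sum_le _ _).trans
      (Finset.sum_le_sum fun k _ => h2 i k)).trans (le_of_eq ?_))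
    simp only [Finset.sum_const, Finset.card_univ, Fintype.card_fin, nsmul_eq_mul]
    push_cast
    ring
  have h6 := (abs_le.1 ((Complex.abs_re_le_norm _).trans h4)).1
  have h7 : ((κ : ℂ) ^ 2 * ∑ i, ∑ k, b i k).re = κ ^ 2 * (∑ i, ∑ k, b i k).re := by
    rw [← Complex.ofReal_pow, Complex.re_ofReal_mul]
  rw [Complex.sub_re, h7] at h6
  have h8 := mul_le_mul_of_nonneg_left h1 (sq_nonneg κ)
  nlinarith

/-- On the spectrum of the test field the coefficients of u are those of u - κU, so the sup bound δ
L^(2α-1) applies. It meets an L¹ norm of order L^(2α+1). -/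
theorem exists_dissipation_le {χ : ℝ → ℝ} (hχ : IsCutoff χ) {α : ℝ} (hα : 1 ≤ α)
    {q : ℕ → ℕ} (hq : StrictMono q) {U : L2Field} (hU : ∀ ξ, coeff U ξ = datumCoeff α q ξ) :
    ∃ K : ℝ, 0 ≤ K ∧ ∀ (κ : ℝ), ∀ j, IsSeparated q j → ∀ δ : ℝ, 0 ≤ δ →
      ∀ u : L2Field, besovNorm χ (1 - 2 * α) ∞ (u - κ • U : L2Field) ≤ ENNReal.ofReal δ →
      |∫ x, inner ℝ (u x) (fracLaplacian α (testField (wavenumber (q j))) x) ∂torusMeasure| ≤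
        K * δ * wavenumber (q j) ^ (4 * α) := by
  obtain ⟨B, hB0, hB⟩ := exists_eLpNorm_fracLaplacian_testCoeff_le hχ α
  refine ⟨3 * (2 * 8 ^ (2 * α - 1) * B), by positivity, fun κ j hj δ hδ u hu => ?_⟩
  set L := wavenumber (q j) with hLdef
  have hL0 : 0 < L := wavenumber_pos _
  have hL1 : 1 ≤ L := one_le_wavenumber _
  have hw3 : wavenumber ((q j + 3 : ℕ) : ℤ) = 8 * L := by
    rw [wavenumber_add_natCast]; norm_num; rfl
  have hw4 : wavenumber ((q j + 3 : ℕ) + 1) = 16 * L := by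
    rw [wavenumber_add_one, hw3]; ring
  have hreal := isRealCoeff_testCoeff hL0.le
  have h1 := integral_inner_of_comp (f := u) (φ := fracLaplacian α (testField L)) (Lp.memLp u)
    (fun _ => continuous_trig _ _) fun k x => fracLaplacian_trigField α hreal k x
  have h2 : ∀ k, ∫ x, comp u k x * trig (cube (2 * L))
        (fun ξ => ((freqNorm ξ ^ (2 * α) : ℝ) : ℂ) * testCoeff L ξ k) x ∂torusMeasure =
      ∫ x, lowPass χ (q j + 3) (fun ξ => coeff (u - κ • U : L2Field) ξ k) x *
        trig (cube (2 * L))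
          (fun ξ => ((freqNorm ξ ^ (2 * α) : ℝ) : ℂ) * testCoeff L ξ k) x ∂torusMeasure := by
    intro k
    rw [integral_mul_trig (integrable_comp (Lp.memLp u) k), integral_mul_trig
      (integrable_of_continuous (continuous_lowPass _ _ _))]
    refine Finset.sum_congr rfl fun ξ hξ => ?_
    by_cases h0 : bump L ξ = 0
    · simp [testCoeff_apply, h0]
    congr 1
    have hfr := (freqNorm_of_bump_ne_zero hL0.le h0).2
    rw [lowPass, mFourierCoeff_trig, if_pos, hχ.eq_one, coeff_sub, coeff_smul, hU,
      datumCoeff_eq_zero_of_mem_testRegion hq hj, ← coeff_apply]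
    · simp
    · rw [neg_neg]; exact (mem_testRegion_of_bump_ne_zero h0).symm
    · rw [freqNorm_neg, hw4, div_le_iff₀ (by positivity)]; linarith
    · refine mem_cube_of_freqNorm_le ?_
      rw [freqNorm_neg, hw4]; linarith
  have hshell : ∀ p : ℕ, eLpNorm (lpProj χ p (u - κ • U : L2Field)) ∞ torusMeasure ≤
      ENNReal.ofReal (δ * wavenumber p ^ (2 * α - 1)) := fun p => by
    have := eLpNorm_lpProj_le_of_besovNorm_le hu p
    rwa [neg_sub] at this
  have h3 : ∀ k, ‖∫ x, lowPass χ (q j + 3) (fun ξ => coeff (u - κ • U : L2Field) ξ k) x *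
        trig (cube (2 * L))
          (fun ξ => ((freqNorm ξ ^ (2 * α) : ℝ) : ℂ) * testCoeff L ξ k) x ∂torusMeasure‖ ≤
      2 * δ * (8 * L) ^ (2 * α - 1) * (B * L ^ (2 * α + 1)) := fun k => by
    refine norm_integral_mul_le_of_eLpNorm_one (by positivity) (fun x => ?_)
      (continuous_trig _ _) (hB L hL1 k)
    rw [← hw3]
    exact norm_lowPass_le hχ hδ (by linarith) hshell _ k x
  rw [← Real.norm_eq_abs, ← Complex.norm_real, h1, Finset.sum_congr rfl fun k _ => h2 k]
  refine (norm_sum_le _ _).trans ((Finset.sum_le_sum fun k _ => h3 k).trans (le_of_eq ?_))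
  have h4 : L ^ (2 * α - 1) * L ^ (2 * α + 1) = L ^ (4 * α) := by
    rw [← Real.rpow_add hL0]; congr 1; ring
  rw [← h4, Real.mul_rpow (by norm_num) hL0.le]
  simp only [Finset.sum_const, Finset.card_univ, Fintype.card_fin, nsmul_eq_mul]
  push_cast
  ring

/-! ### The pairing with the test field. -/

theorem continuous_trigField (s : Finset Freq) (c : Freq → C3) : Continuous (trigField s c) := by
  refine (PiLp.continuous_toLp 2 _).comp (continuous_pi fun i => ?_)
  exact Complex.continuous_re.comp (continuous_trig _ _)

/-- Parseval gives order L⁵. Rounding up to L⁶ is harmless, because the pairing only has to stay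
below L^(4α) with α ≥ 1. -/
theorem integral_norm_sq_testField_le {L : ℝ} (hL : 1 ≤ L) :
    ∫ x, ‖testField L x‖ ^ 2 ∂torusMeasure ≤ (160 * L ^ 3) ^ 2 := by
  have h1 : ∀ x, ‖testField L x‖ ^ 2 =
      ∑ k, ‖trig (cube (2 * L)) (fun ξ => testCoeff L ξ k) x‖ ^ 2 := fun x => by
    rw [EuclideanSpace.norm_sq_eq]
    refine Finset.sum_congr rfl fun k _ => ?_
    rw [← congrFun (comp_trigField (isRealCoeff_testCoeff (zero_le_one.trans hL)) k) x, comp,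
      Complex.norm_real]
    rfl
  simp only [h1]
  have h2 : ∀ k ∈ (Finset.univ : Finset (Fin 3)), Integrable (fun x =>
      ‖trig (cube (2 * L)) (fun ξ => testCoeff L ξ k) x‖ ^ 2) torusMeasure := fun k _ =>
    integrable_of_continuous ((continuous_trig _ _).norm.pow 2)
  rw [integral_finsetSum _ h2]
  simp only [integral_sq_trig]
  refine (Finset.sum_le_sum fun k _ => sum_sq_norm_testCoeff_le hL k).trans ?_
  simp only [Finset.sum_const, Finset.card_univ, Fintype.card_fin, nsmul_eq_mul]
  have : L ^ 5 ≤ L ^ 6 := pow_le_pow_right₀ hL (by norm_num)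
  push_cast
  nlinarith

theorem abs_integral_inner_testField_le {L : ℝ} (hL : 1 ≤ L) (u : L2Field) :
    |∫ x, inner ℝ (u x) (testField L x) ∂torusMeasure| ≤ 160 * L ^ 3 * ‖u‖ := by
  have hc : MemLp (testField L) 2 torusMeasure :=
    memLp_of_continuous (continuous_trigField _ _) 2
  have h1 : ∫ x, inner ℝ (u x) (testField L x) ∂torusMeasure = inner ℝ u (hc.toLp _) := by
    rw [L2.inner_def]
    refine integral_congr_ae ?_
    filter_upwards [hc.coeFn_toLp] with x hx
    rw [hx]
  have h2 : ‖hc.toLp (testField L)‖ ^ 2 = ∫ x, ‖testField L x‖ ^ 2 ∂torusMeasure := by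
    rw [← real_inner_self_eq_norm_sq, L2.inner_def]
    refine integral_congr_ae ?_
    filter_upwards [hc.coeFn_toLp] with x hx
    rw [hx, real_inner_self_eq_norm_sq]
  have h3 : ‖hc.toLp (testField L)‖ ≤ 160 * L ^ 3 := by
    refine (sq_le_sq₀ (norm_nonneg _) (by positivity)).1 ?_
    rw [h2]
    exact integral_norm_sq_testField_le hL
  rw [h1, mul_comm]
  exact (abs_real_inner_le_norm _ _).trans (mul_le_mul_of_nonneg_left h3 (norm_nonneg _))

theorem integral_inner_eq_inner_toLp {φ : T3 → R3} (hφ : MemLp φ 2 torusMeasure) (u : L2Field) :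
    ∫ x, inner ℝ (u x) (φ x) ∂torusMeasure = inner ℝ (hφ.toLp φ) u := by
  rw [real_inner_comm, L2.inner_def]
  refine integral_congr_ae ?_
  filter_upwards [hφ.coeFn_toLp] with x hx
  rw [hx]

/-! ### Measurability and integrability in time. -/

section Time

variable {u : ℝ → L2Field} {S : Set ℝ}

theorem continuousOn_integral_inner
    (hu : ∀ g : L2Field, ContinuousOn (fun t => inner ℝ g (u t)) S) {φ : T3 → R3}
    (hφ : MemLp φ 2 torusMeasure) :
    ContinuousOn (fun t => ∫ x, inner ℝ (u t x) (φ x) ∂torusMeasure) S := by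
  simp only [integral_inner_eq_inner_toLp hφ]
  exact hu _

theorem continuousOn_integral_comp_mul
    (hu : ∀ g : L2Field, ContinuousOn (fun t => inner ℝ g (u t)) S) (i : Fin 3) {ρ : T3 → ℝ}
    (hρ : Continuous ρ) :
    ContinuousOn (fun t => ∫ x, comp (u t) i x * (ρ x : ℂ) ∂torusMeasure) S := by
  have hφ : Continuous fun x => (EuclideanSpace.single i (ρ x) : R3) := by
    refine (PiLp.continuous_toLp 2 _).comp (continuous_pi fun k => ?_)
    simp only [Pi.single_apply]
    split_ifs <;> fun_prop
  have h := continuousOn_integral_inner hu (memLp_of_continuous hφ 2)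
  refine (Complex.continuous_ofReal.comp_continuousOn h).congr fun t _ => ?_
  have h1 := integral_inner_of_comp (f := u t) (φ := fun x => (EuclideanSpace.single i (ρ x) : R3))
    (ψ := fun k x => if k = i then (ρ x : ℂ) else 0) (Lp.memLp (u t))
    (fun k => by split_ifs <;> fun_prop) fun k x => by
      simp only [PiLp.single_apply]
      split_ifs <;> simp
  rw [Function.comp_apply, h1, Finset.sum_eq_single i]
  · simp
  · intro k _ hk
    simp [hk]
  · simp

/-- Weak continuity is tested against the real and imaginary parts of a character, placed in one
component. -/
theorem continuousOn_coeff
    (hu : ∀ g : L2Field, ContinuousOn (fun t => inner ℝ g (u t)) S) (ξ : Freq) (i : Fin 3) :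
    ContinuousOn (fun t => coeff (u t) ξ i) S := by
  have hc : Continuous fun x => UnitAddTorus.mFourier (-ξ) x :=
    (UnitAddTorus.mFourier (-ξ)).continuous
  have h1 := continuousOn_integral_comp_mul hu i (Complex.continuous_re.comp hc)
  have h2 := continuousOn_integral_comp_mul hu i (Complex.continuous_im.comp hc)
  refine (h1.add (h2.mul (continuousOn_const (c := Complex.I)))).congr fun t _ => ?_
  have hi := integrable_comp (Lp.memLp (u t)) i
  simp only [Pi.add_apply, Pi.mul_apply, Function.comp_apply]
  rw [coeff_apply, ← neg_neg ξ, ← integral_mul_mFourier, neg_neg, ← integral_mul_const,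
    ← integral_add]
  · congr 1
    funext x
    rw [mul_assoc, ← mul_add]
    congr 1
    exact (Complex.re_add_im _).symm
  · exact integrable_mul_continuous hi
      (Complex.continuous_ofReal.comp (Complex.continuous_re.comp hc))
  · exact (integrable_mul_continuous hi
      (Complex.continuous_ofReal.comp (Complex.continuous_im.comp hc))).mul_const _

theorem mFourierCoeff_mul_trig {f : T3 → ℂ} (hf : Integrable f torusMeasure) (s : Finset Freq)
    (e : Freq → ℂ) (ξ : Freq) :
    UnitAddTorus.mFourierCoeff (fun x => f x * trig s e x) ξ =
      ∑ η ∈ s, e η * UnitAddTorus.mFourierCoeff f (ξ - η) := by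
  have h := integral_mul_trig_mul_trig hf s {-ξ} e 1
  simp only [Finset.sum_singleton, Pi.one_apply, mul_one, neg_add_rev, neg_neg] at h
  rw [← neg_neg ξ, ← integral_mul_mFourier, neg_neg]
  simp only [sub_eq_add_neg]
  rw [← h]
  congr 1
  funext x
  simp [trig, mul_assoc]

/-- Weak continuity does not make a quadratic quantity continuous. By Parseval, however, it is a
pointwise limit of finite sums of products of continuous Fourier coefficients. -/
theorem aemeasurable_integral_comp_mul_comp (hS : MeasurableSet S)
    (hu : ∀ g : L2Field, ContinuousOn (fun t => inner ℝ g (u t)) S) (i k : Fin 3)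
    (s : Finset Freq) (e : Freq → ℂ) :
    AEMeasurable (fun t => ∫ x, comp (u t) i x * comp (u t) k x * trig s e x ∂torusMeasure)
      (volume.restrict S) := by
  have hsum : ∀ t, HasSum (fun ξ => (starRingEnd ℂ) (coeff (u t) ξ i) *
      ∑ η ∈ s, e η * coeff (u t) (ξ - η) k)
      (∫ x, comp (u t) i x * comp (u t) k x * trig s e x ∂torusMeasure) := by
    intro t
    have hf := memLp_comp (Lp.memLp (u t)) i
    have hk := memLp_comp (Lp.memLp (u t)) k
    have hg : MemLp (fun x => comp (u t) k x * trig s e x) 2 torusMeasure := by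
      refine MemLp.of_le_mul (c := ∑ ξ ∈ s, ‖e ξ‖) hk
        (hk.aestronglyMeasurable.mul (continuous_trig s e).aestronglyMeasurable)
        (ae_of_all _ fun x => ?_)
      rw [norm_mul, mul_comm]
      exact mul_le_mul_of_nonneg_right (norm_trig_le s e x) (norm_nonneg _)
    have h := hasSum_inner_mFourierCoeff hf hg
    simp only [mFourierCoeff_mul_trig (hk.integrable one_le_two)] at h
    have heq : ∀ x, (starRingEnd ℂ) (comp (u t) i x) * (comp (u t) k x * trig s e x) =
        comp (u t) i x * comp (u t) k x * trig s e x := fun x => by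
      rw [comp, Complex.conj_ofReal, mul_assoc]
    simp only [heq] at h
    exact h
  refine aemeasurable_of_tendsto_metrizable_ae atTop (f := fun (F : Finset Freq) t =>
    ∑ ξ ∈ F, (starRingEnd ℂ) (coeff (u t) ξ i) * ∑ η ∈ s, e η * coeff (u t) (ξ - η) k)
    (fun F => ?_) (ae_of_all _ fun t => hsum t)
  refine ContinuousOn.aemeasurable ?_ hS
  refine continuousOn_finsetSum _ fun ξ _ => ContinuousOn.mul ?_ ?_
  · exact Complex.continuous_conj.comp_continuousOn (continuousOn_coeff hu ξ i)
  · exact continuousOn_finsetSum _ fun η _ => continuousOn_const.mul (continuousOn_coeff hu _ k)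

theorem aemeasurable_sobolevSq (hS : MeasurableSet S)
    (hu : ∀ g : L2Field, ContinuousOn (fun t => inner ℝ g (u t)) S) (s : ℝ) :
    AEMeasurable (fun t => sobolevSq s (u t)) (volume.restrict S) := by
  refine AEMeasurable.tsum fun ξ => ?_
  have h : ContinuousOn (fun t => coeff (u t) ξ) S :=
    ((PiLp.continuous_toLp 2 _).comp_continuousOn (g := WithLp.toLp 2)
      (f := fun t i => coeff (u t) ξ i)
      (continuousOn_pi.2 fun i => continuousOn_coeff hu ξ i))
  exact ((h.aemeasurable hS).enorm.pow_const 2).const_mul _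

theorem integral_norm_sq_comp_le (v : L2Field) (i : Fin 3) :
    ∫ x, ‖comp v i x‖ ^ 2 ∂torusMeasure ≤ ‖v‖ ^ 2 := by
  rw [← real_inner_self_eq_norm_sq, L2.inner_def]
  simp only [real_inner_self_eq_norm_sq]
  refine integral_mono ((memLp_comp (Lp.memLp v) i).integrable_norm_pow two_ne_zero)
    ((Lp.memLp v).integrable_norm_pow two_ne_zero) fun x => ?_
  refine pow_le_pow_left₀ (norm_nonneg _) ?_ 2
  rw [comp, Complex.norm_real]
  exact PiLp.norm_apply_le _ i

/-- A crude bound for fixed L; it serves only to make the flux integrable in time. -/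
theorem abs_flux_testField_le {L : ℝ} (hL : 1 ≤ L) (v : L2Field) :
    |∫ x, (∑ i, ∑ k, v x i * v x k * pderiv i (testField L) x k) ∂torusMeasure| ≤
      9 * (512 * L ^ 5) * ‖v‖ ^ 2 := by
  rw [← Real.norm_eq_abs, ← Complex.norm_real, flux_testField (zero_le_one.trans hL)]
  have h : ∀ i k, ‖∫ x, comp v i x * comp v k x * trig (cube (2 * L))
      (fun ξ => Complex.I * ξ i * testCoeff L ξ k) x ∂torusMeasure‖ ≤
      (512 * L ^ 5) * ‖v‖ ^ 2 := fun i k => by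
    refine (norm_integral_mul_mul_le (memLp_comp (Lp.memLp v) i) (memLp_comp (Lp.memLp v) k)
      fun x => (norm_trig_le _ _ x).trans (sum_norm_deriv_testCoeff_le hL i k)).trans ?_
    refine mul_le_mul_of_nonneg_left ?_ (by positivity)
    have h1 := integral_norm_sq_comp_le v i
    have h2 := integral_norm_sq_comp_le v k
    linarith
  refine (norm_sum_le _ _).trans ((Finset.sum_le_sum fun i _ => (norm_sum_le _ _).trans
    (Finset.sum_le_sum fun k _ => h i k)).trans (le_of_eq ?_))
  simp only [Finset.sum_const, Finset.card_univ, Fintype.card_fin, nsmul_eq_mul]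
  push_cast
  ring

theorem integrableOn_flux_testField (hS : MeasurableSet S)
    (hu : ∀ g : L2Field, ContinuousOn (fun t => inner ℝ g (u t)) S)
    (hsq : ∫⁻ t in S, ‖u t‖ₑ ^ 2 < ∞) {L : ℝ} (hL : 1 ≤ L) :
    IntegrableOn (fun t => ∫ x, (∑ i, ∑ k, u t x i * u t x k * pderiv i (testField L) x k)
      ∂torusMeasure) S := by
  constructor
  · have h : AEMeasurable (fun t => (∑ i, ∑ k, ∫ x, comp (u t) i x * comp (u t) k x *
        trig (cube (2 * L)) (fun ξ => Complex.I * ξ i * testCoeff L ξ k) x ∂torusMeasure).re)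
        (volume.restrict S) := by
      refine Complex.measurable_re.comp_aemeasurable ?_
      exact Finset.aemeasurable_fun_sum _ fun i _ => Finset.aemeasurable_fun_sum _ fun k _ =>
        aemeasurable_integral_comp_mul_comp hS hu i k _ _
    refine (h.congr (ae_of_all _ fun t => ?_)).aestronglyMeasurable
    beta_reduce
    rw [← flux_testField (zero_le_one.trans hL), Complex.ofReal_re]
  · have h : ∀ t, ‖∫ x, (∑ i, ∑ k, u t x i * u t x k * pderiv i (testField L) x k)
        ∂torusMeasure‖ₑ ≤ ENNReal.ofReal (9 * (512 * L ^ 5)) * ‖u t‖ₑ ^ 2 := fun t => by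
      rw [← ofReal_norm, ← ofReal_norm, ← ENNReal.ofReal_pow (norm_nonneg _),
        ← ENNReal.ofReal_mul (by positivity), Real.norm_eq_abs]
      exact ENNReal.ofReal_le_ofReal (abs_flux_testField_le hL (u t))
    refine (lintegral_mono h).trans_lt ?_
    rw [lintegral_const_mul' _ _ ENNReal.ofReal_ne_top]
    exact ENNReal.mul_lt_top ENNReal.ofReal_lt_top hsq

end Time

/-! ### The gap condition and the conclusion. -/

/-- Logarithms turn the hypothesis into 2αm < (5 - 4α)n, and α ≥ 1 gives 2m ≤ 2αm and (5 - 4α)n ≤ n.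
-/
theorem two_mul_lt_of_gap {α : ℝ} (hα : 1 ≤ α) {m n : ℕ}
    (h : wavenumber m ^ (2 * α) * wavenumber n ^ (4 * α - 5) < 1) : 2 * m < n := by
  rw [wavenumber_natCast, wavenumber_natCast, ← Real.rpow_natCast, ← Real.rpow_natCast,
    ← Real.rpow_mul zero_le_two, ← Real.rpow_mul zero_le_two, ← Real.rpow_add two_pos] at h
  have h1 : (m : ℝ) * (2 * α) + n * (4 * α - 5) < 0 := by
    by_contra hneg
    exact absurd h (not_lt.2 (Real.one_le_rpow one_le_two (not_lt.1 hneg)))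
  have hm : (0 : ℝ) ≤ m := Nat.cast_nonneg m
  have hn : (0 : ℝ) ≤ n := Nat.cast_nonneg n
  have h2 : (2 : ℝ) * m < n := by nlinarith
  exact_mod_cast h2

/-- Doubling makes q (j+1) - q j exceed q j ≥ j. On the lower side, q j - q (j-1) is at least q
(j-1) + 1 ≥ j. So j ≥ 8 suffices on both sides. -/
theorem isSeparated_of_gap {q : ℕ → ℕ} (hq : StrictMono q) (hgap : ∀ i, 2 * q i < q (i + 1)) {j : ℕ}
    (hj : 8 ≤ j) : IsSeparated q j := by
  have hid : ∀ i, i ≤ q i := fun i => hq.le_apply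
  refine ⟨fun i hi => ?_, fun i hi => ?_⟩
  · obtain ⟨k, rfl⟩ : ∃ k, j = k + 1 := ⟨j - 1, by omega⟩
    have h1 : q i ≤ q k := hq.monotone (by omega)
    have h2 := hgap k
    have h3 := hid k
    omega
  · have h1 : q (j + 1) ≤ q i := hq.monotone hi
    have h2 := hgap j
    have h3 := hid j
    omega

theorem nat_le_wavenumber {q : ℕ → ℕ} (hq : StrictMono q) (j : ℕ) : (j : ℝ) ≤ wavenumber (q j) := by
  rw [wavenumber_natCast]
  have h1 : j < 2 ^ q j := (hq.le_apply).trans_lt Nat.lt_two_pow_self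
  exact_mod_cast h1.le

/-- A weak solution that stays close to its initial value in the Besov norm transfers energy through
the shell `j` at a rate that its size cannot sustain. -/
theorem exists_flux_growth {χ : ℝ → ℝ} (hχ : IsCutoff χ) {α : ℝ} (hα : 1 ≤ α)
    {q : ℕ → ℕ} (hq : StrictMono q) {U : L2Field} (hU : ∀ ξ, coeff U ξ = datumCoeff α q ξ)
    {κ ν : ℝ} (hκ : 0 < κ) (hν : 0 < ν) :
    ∃ c δ : ℝ, 0 < c ∧ 0 < δ ∧ ∀ T : ℝ, ∀ u : ℝ → L2Field,
      IsWeakSolution α ν T (κ • U) u → ∀ t ∈ Ioo 0 T,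
      (∀ s ∈ Ioc 0 t, besovNorm χ (1 - 2 * α) ∞ (u s - κ • U : L2Field) ≤ ENNReal.ofReal δ) →
      ∃ C : ℝ, ∀ j, IsSeparated q j → 20 ≤ wavenumber (q j) →
        c * t * wavenumber (q j) ^ (4 * α) ≤ C * wavenumber (q j) ^ 3 := by
  obtain ⟨c, K, hc, hK0, hK⟩ := exists_flux_ge hχ hα hq hU
  obtain ⟨K', hK'0, hK'⟩ := exists_dissipation_le hχ hα hq hU
  -- `D` collects the coefficients of δ in both error terms, with δ² ≤ δ as δ ≤ 1; the final 1 keeps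
  -- it positive. The choice δ D ≤ cκ²/2 preserves half of the datum's flux.
  set D := K * (κ + 1) + ν * K' + 1 with hD
  have hD0 : 0 < D := by positivity
  set δ := min 1 (c * κ ^ 2 / (2 * D)) with hδ
  have hδ0 : 0 < δ := lt_min one_pos (by positivity)
  have hδ1 : δ ≤ 1 := min_le_left _ _
  have hδD : δ * D ≤ c * κ ^ 2 / 2 := by
    have h1 := mul_le_mul_of_nonneg_right (min_le_right 1 (c * κ ^ 2 / (2 * D))) hD0.le
    refine h1.trans (le_of_eq ?_)
    field_simp
  refine ⟨c * κ ^ 2 / 2, δ, by positivity, hδ0, fun T u hu t ht hB => ?_⟩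
  have hsub : Ioc 0 t ⊆ Ico 0 T := fun s hs => ⟨hs.1.le, hs.2.trans_lt ht.2⟩
  have hsub' : Icc 0 t ⊆ Ico 0 T := fun s hs => ⟨hs.1, hs.2.trans_lt ht.2⟩
  have hwc : ∀ g : L2Field, ContinuousOn (fun t => inner ℝ g (u t)) (Ioc 0 t) := fun g =>
    (hu.weakly_continuous g).mono hsub
  have hfin : ∫⁻ s in Ioc 0 t, (‖u s‖ₑ ^ 2 + sobolevSq 1 (u s)) < ∞ :=
    (lintegral_mono_set hsub).trans_lt hu.square_integrable
  have hfin1 : ∫⁻ s in Ioc 0 t, ‖u s‖ₑ ^ 2 < ∞ :=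
    (lintegral_mono fun s => le_self_add).trans_lt hfin
  have hfin2 : ∫⁻ s in Ioc 0 t, sobolevSq 1 (u s) < ∞ :=
    (lintegral_mono fun s => le_add_self).trans_lt hfin
  have hmeas := aemeasurable_sobolevSq measurableSet_Ioc hwc 1
  have hSint : IntegrableOn (fun s => (sobolevSq 1 (u s)).toReal) (Ioc 0 t) :=
    integrable_toReal_of_lintegral_ne_top hmeas hfin2.ne
  have hStop : ∀ᵐ s ∂volume.restrict (Ioc 0 t), sobolevSq 1 (u s) ≠ ∞ := by
    filter_upwards [ae_lt_top' hmeas hfin2.ne] with s hs using hs.ne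
  -- The three contributions of order L³: the high-frequency product integrated in time, and the
  -- pairings at the times t and 0. None of the constants depends on j.
  refine ⟨72 * (∫ s in Ioc 0 t, (sobolevSq 1 (u s)).toReal) + 160 * ‖u t‖ +
    160 * ‖(κ • U : L2Field)‖, fun j hj hL => ?_⟩
  set L := wavenumber (q j) with hLdef
  have hL1 : 1 ≤ L := by linarith
  have hL0 : 0 ≤ L := by linarith
  have heq := hu.weak_equation (testField L) (isSmooth_trigField _ _) (isDivFree_testField hL0) t
    ⟨ht.1.le, ht.2⟩
  rw [intervalIntegral.integral_of_le ht.1.le] at heq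
  have hflux := integrableOn_flux_testField measurableSet_Ioc hwc hfin1 hL1
  have hlapc : Continuous (fracLaplacian α (testField L)) := by
    have h1 : fracLaplacian α (testField L) = trigField (cube (2 * L)) (fun ξ => WithLp.toLp 2
        fun k => ((freqNorm ξ ^ (2 * α) : ℝ) : ℂ) * testCoeff L ξ k) := by
      funext x
      ext k
      have h2 := congrArg Complex.re
        (fracLaplacian_trigField α (isRealCoeff_testCoeff hL0) k x)
      rw [Complex.ofReal_re] at h2
      exact h2
    rw [h1]
    exact continuous_trigField _ _
  have hdiss : IntegrableOn (fun s => ν * ∫ x, inner ℝ (u s x)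
      (fracLaplacian α (testField L) x) ∂torusMeasure) (Ioc 0 t) := by
    refine IntegrableOn.mono_set ?_ Ioc_subset_Icc_self
    refine ContinuousOn.integrableOn_Icc (continuousOn_const.mul ?_)
    exact continuousOn_integral_inner (fun g => (hu.weakly_continuous g).mono hsub')
      (memLp_of_continuous hlapc 2)
  have hlower : ∫ s in Ioc 0 t, (c * κ ^ 2 / 2 * L ^ (4 * α) -
        72 * L ^ 3 * (sobolevSq 1 (u s)).toReal) ≤
      ∫ s in Ioc 0 t, ((∫ x, (∑ i, ∑ k, u s x i * u s x k * pderiv i (testField L) x k)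
          ∂torusMeasure)
        - ν * (∫ x, inner ℝ (u s x) (fracLaplacian α (testField L) x) ∂torusMeasure)) := by
    refine integral_mono_ae ((integrable_const _).sub (hSint.const_mul _))
      (hflux.sub hdiss) ?_
    filter_upwards [hStop, ae_restrict_mem measurableSet_Ioc] with s hs hst
    have h1 := hK κ hκ.le j hj hL δ hδ0.le (u s) (hB s hst) hs
    have h2 := (abs_le.1 (hK' κ j hj δ hδ0.le (u s) (hB s hst))).2
    have h3 := mul_le_mul_of_nonneg_left h2 hν.le
    have h4 : (0 : ℝ) ≤ L ^ (4 * α) := Real.rpow_nonneg hL0 _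
    have h5 : c * κ ^ 2 / 2 ≤ c * κ ^ 2 - K * (κ * δ + δ ^ 2) - ν * (K' * δ) := by
      have h6 : K * (κ * δ + δ ^ 2) ≤ K * (κ * δ + δ) :=
        mul_le_mul_of_nonneg_left (by nlinarith) hK0
      have h7 : δ * D = K * (κ * δ + δ) + ν * (K' * δ) + δ := by rw [hD]; ring
      linarith
    have h8 := mul_le_mul_of_nonneg_right h5 h4
    simp only [← hLdef] at h1 h3
    linarith
  have hval : ∫ s in Ioc 0 t, (c * κ ^ 2 / 2 * L ^ (4 * α) -
        72 * L ^ 3 * (sobolevSq 1 (u s)).toReal) =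
      c * κ ^ 2 / 2 * t * L ^ (4 * α) -
        72 * L ^ 3 * ∫ s in Ioc 0 t, (sobolevSq 1 (u s)).toReal := by
    rw [integral_sub (integrable_const _) (hSint.const_mul _), setIntegral_const,
      integral_const_mul]
    simp only [Measure.real, Real.volume_Ioc, sub_zero, ENNReal.toReal_ofReal ht.1.le, smul_eq_mul]
    ring
  have h1 := (abs_le.1 (abs_integral_inner_testField_le hL1 (u t))).2
  have h2 := (abs_le.1 (abs_integral_inner_testField_le hL1 (κ • U : L2Field))).1
  linarith

/-- A limsup below δ would keep the solution δ-close to its initial value on some interval (0, t].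
Then c t L^(4α) ≤ C L³ along all late shells, against L^(4α) ≥ L⁴. -/
theorem exists_le_limsup_besovNorm {χ : ℝ → ℝ} (hχ : IsCutoff χ) {α : ℝ} (hα : 1 ≤ α)
    {q : ℕ → ℕ} (hq : StrictMono q) (hgap : ∀ i, 2 * q i < q (i + 1)) {U : L2Field}
    (hU : ∀ ξ, coeff U ξ = datumCoeff α q ξ) {κ ν : ℝ} (hκ : 0 < κ) (hν : 0 < ν) :
    ∃ δ : ℝ, 0 < δ ∧ ∀ T : ℝ, 0 < T → ∀ u : ℝ → L2Field, IsWeakSolution α ν T (κ • U) u →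
      ENNReal.ofReal δ ≤ limsup
        (fun t => besovNorm χ (1 - 2 * α) ∞ (u t - κ • U : L2Field)) (𝓝[>] (0 : ℝ)) := by
  obtain ⟨c, δ, hc, hδ, h⟩ := exists_flux_growth hχ hα hq hU hκ hν
  refine ⟨δ, hδ, fun T hT u hu => ?_⟩
  by_contra hlt
  have hev := eventually_lt_of_limsup_lt (not_le.1 hlt)
  obtain ⟨t₀, ht₀, hsub⟩ := mem_nhdsGT_iff_exists_Ioc_subset.1 hev
  have ht : min t₀ (T / 2) ∈ Ioo 0 T :=
    ⟨lt_min ht₀ (by positivity), (min_le_right _ _).trans_lt (by linarith)⟩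
  obtain ⟨C, hC⟩ := h T u hu _ ht fun s hs =>
    (hsub (⟨hs.1, hs.2.trans (min_le_left _ _)⟩ : s ∈ Ioc 0 t₀) : _ < _).le
  set t := min t₀ (T / 2)
  have hct : 0 < c * t := mul_pos hc ht.1
  -- The index `max N 20` gives L ≥ 20, separation of the shell, and c t L > C at once, since L is
  -- at least the index.
  obtain ⟨N, hN⟩ := exists_nat_gt (C / (c * t))
  have hj : 20 ≤ max N 20 := le_max_right _ _
  have hLj := nat_le_wavenumber hq (max N 20)
  have hL20 : 20 ≤ wavenumber (q (max N 20)) := le_trans (by exact_mod_cast hj) hLj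
  have hLN : (N : ℝ) ≤ wavenumber (q (max N 20)) :=
    le_trans (by exact_mod_cast le_max_left N 20) hLj
  have h1 := hC _ (isSeparated_of_gap hq hgap (le_trans (by norm_num) hj)) hL20
  set L := wavenumber (q (max N 20))
  have hL0 : 0 < L := by linarith
  have h2 : L ^ 4 ≤ L ^ (4 * α) := by
    rw [← Real.rpow_natCast]
    exact Real.rpow_le_rpow_of_exponent_le (by linarith) (by push_cast; linarith)
  have h3 : (c * t * L) * L ^ 3 ≤ C * L ^ 3 := by
    refine le_trans ?_ h1
    have := mul_le_mul_of_nonneg_left h2 hct.le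
    refine le_trans (le_of_eq (by ring)) this
  have h4 := le_of_mul_le_mul_right h3 (by positivity)
  have h5 : C < c * t * L := by
    rw [div_lt_iff₀ hct] at hN
    have := mul_le_mul_of_nonneg_left hLN hct.le
    linarith
  linarith

end FracNSE

theorem proposition2p2 (α : ℝ) (hα : 1 ≤ α) (hα' : α < 5 / 4)
    (q : ℕ → ℕ) (hq : StrictMono q)
    (hgap : ∀ i, FracNSE.wavenumber (q i) ^ (2 * α) *
      FracNSE.wavenumber (q (i + 1)) ^ (4 * α - 5) < 1)
    (χ : ℝ → ℝ) (hχ : FracNSE.IsCutoff χ) :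
    ∃ U : FracNSE.L2Field,
      (∀ ξ, FracNSE.coeff U ξ = FracNSE.datumCoeff α q ξ) ∧
      FracNSE.IsDivFree U ∧
      (∀ r : ℝ≥0∞, 1 < r →
        FracNSE.besovNorm χ (1 + 3 * (r⁻¹).toReal - 2 * α) r U < ∞) ∧
      (∀ η : ℝ≥0∞, 0 < η → ∃ κ : ℝ, 0 < κ ∧
        FracNSE.besovNorm χ (1 - 2 * α) ∞ (κ • U : FracNSE.L2Field) < η) ∧
      ∀ κ : ℝ, 0 < κ → ∀ ν : ℝ, 0 < ν →
        (∀ T : ℝ, 0 < T → ∀ u : ℝ → FracNSE.L2Field,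
          FracNSE.IsWeakSolution α ν T (κ • U) u →
          ∃ δ : ℝ, 0 < δ ∧ ENNReal.ofReal δ ≤
            limsup (fun t => FracNSE.besovNorm χ (1 - 2 * α) ∞ (u t - κ • U : FracNSE.L2Field))
              (𝓝[>] (0 : ℝ))) ∧
        (∃ δ : ℝ, 0 < δ ∧ ∀ T : ℝ, 0 < T → ∀ u : ℝ → FracNSE.L2Field,
          FracNSE.IsWeakSolution α ν T (κ • U) u →
          FracNSE.EnergyInequality α ν T (κ • U) u →
          ENNReal.ofReal δ ≤
              limsup (fun t => FracNSE.besovNorm χ (1 - 2 * α) ∞ (u t - κ • U : FracNSE.L2Field))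
                (𝓝[>] (0 : ℝ)) ∧
            ¬ Tendsto (fun t => FracNSE.besovNorm χ (1 - 2 * α) ∞
                (u t - κ • U : FracNSE.L2Field)) (𝓝[>] (0 : ℝ)) (𝓝 0)) := by
  obtain ⟨U, hU⟩ := FracNSE.exists_datum hα' hq
  have hbesov : ∀ r : ℝ≥0∞, 1 < r →
      FracNSE.besovNorm χ (1 + 3 * (r⁻¹).toReal - 2 * α) r U < ∞ := fun r hr =>
    FracNSE.besovNorm_datum_lt_top hχ hr α hq hU
  have htop : FracNSE.besovNorm χ (1 - 2 * α) ∞ U < ∞ := by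
    simpa using hbesov ∞ ENNReal.one_lt_top
  refine ⟨U, hU, fun ξ => ?_, hbesov, fun η hη => FracNSE.exists_besovNorm_smul_lt htop hη,
    fun κ hκ ν hν => ?_⟩
  · rw [hU]
    exact FracNSE.sum_mul_datumCoeff α hq ξ
  obtain ⟨δ, hδ, h⟩ := FracNSE.exists_le_limsup_besovNorm hχ hα hq
    (fun i => FracNSE.two_mul_lt_of_gap hα (hgap i)) hU hκ hν
  refine ⟨fun T hT u hu => ⟨δ, hδ, h T hT u hu⟩, δ, hδ, fun T hT u hu _ => ⟨h T hT u hu, ?_⟩⟩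
  intro htend
  have h1 := h T hT u hu
  rw [htend.limsup_eq] at h1
  exact absurd h1 (not_le.2 (ENNReal.ofReal_pos.2 hδ))
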